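/- Let $N$ and $d\ge 2$ be natural numbers. Let $\mathbb R^{d,N}_{\neq}\subset\mathbb R^{Nd}=(\mathbb R^d)^N$ be the open set of ordered configurations $(x_1,\dots,x_N)$ with $x_i\ne x_j$ for $i\neq j$, let ${}^N\mathbb R^d$ be the set of $N$-element subsets of $\mathbb R^d$, and let $\pi(x_1,\dots,x_N)=\{x_1,\dots,x_N\}$ be the projection $\mathbb R^{d,N}_{\neq}\to{}^N\mathbb R^d$. Give ${}^N\mathbb R^d$ the Riemannian manifold structure for which the $N!$-sheeted covering map $\pi$ is a local isometry, and let $dq$ be its volume measure. A loop $\alpha$ in ${}^N\mathbb R^d$ permutes the $N$ points of its base configuration; let $(-1)^{\sigma_\alpha}$ be the sign of this permutation. Let $F$ be the fermionic line bundle: a smooth complex line bundle over ${}^N\mathbb R^d$ with a smooth Hermitian metric $(\cdot,\cdot)_q$ and a smooth metric connection $\nabla$ whose holonomy along every smooth loop $\alpha$ is multiplication by $(-1)^{\sigma_\alpha}$. Let $\hat F=\pi^*F$, with fibres $\hat F_x=F_{\pi(x)}$, be its lift to $\mathbb R^{d,N}_{\neq}$, and let $\hat I$ be a global trivialization of $\hat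 F$ as a Hermitian bundle with connection, i.e. a family of unitary maps $\hat I_x:F_{\pi(x)}\to\mathbb C$ that are carried into each other by parallel transport. Let $L^2(F)$ be the Hilbert space of measurable square-integrable sections of $F$ modulo equality almost everywhere, with inner product $\int dq\,(\phi(q),\psi(q))_q$, and let $\mathrm{Anti}\,L^2(\mathbb R^{Nd})$ be the space of anti-symmetric functions in $L^2(\mathbb R^{Nd})$. Let $\hbar,m>0$, and let $V:\mathbb R^{Nd}\to\mathbb R$ be measurable, bounded and invariant under permutations of the $N$ particles, so that it is also a function on ${}^N\mathbb R^d$. Let $\tilde H_F$ be the operator $-\frac{\hbar^2}{2m}\Delta+V$ in $L^2(F)$ whose domain is the space $C_0^\infty(F)$ of smooth sections with compact support, where $\Delta$ is the metric trace of the second covariant derivative of sections. Let $\tilde H_{\mathrm{Anti}}$ be the operator $-\frac{\hbar^2}{2m}\Delta+V$ in $\mathrm{Anti}\,L^2(\mathbb R^{Nd})$ with the usual Laplacian, whose domain is the space of anti-symmetric functions in $C_0^\infty(\mathbb R^{Nd})$. Then the formula $$(U\psi)(x_1,\dots,x_N)=\frac1{\sqrt{N!}}\;\hat I_{(x_1,\dots,x_N)}\,\psi(\{x_1,\dots,x_N\})\qquad\text{for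 almost every }(x_1,\dots,x_N)$$ defines a unitary isomorphism $U:L^2(F)\to\mathrm{Anti}\,L^2(\mathbb R^{Nd})$; the operator $\tilde H_{\mathrm{Anti}}$ has a unique self-adjoint extension $H_{\mathrm{Anti}}$ in $\mathrm{Anti}\,L^2(\mathbb R^{Nd})$; and there is a self-adjoint extension $H_F$ of $\tilde H_F$ in $L^2(F)$ such that $$U(\mathscr D(H_F))=\mathscr D(H_{\mathrm{Anti}}),\qquad H_F=U^{-1}H_{\mathrm{Anti}}\,U,$$ where $\mathscr D(H)$ denotes the domain of $H$. Moreover, the unitary groups $e^{-iH_Ft/\hbar}$ and $e^{-iH_{\mathrm{Anti}}t/\hbar}$ exist, i.e. for $H=H_F$ and for $H=H_{\mathrm{Anti}}$ there is exactly one strongly continuous one-parameter unitary group with generator $-iH/\hbar$, and $$e^{-iH_Ft/\hbar}=U^{-1}\,e^{-iH_{\mathrm{Anti}}t/\hbar}\,U\qquad\text{for all }t\in\mathbb R.$$ -/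

import Mathlib

open scoped Manifold ContDiff Topology ENNReal
open MeasureTheory Bundle

noncomputable section

namespace Fermion

variable {N d : ℕ}

/-- `(ℝ^d)^N = ℝ^{Nd}` with its Euclidean structure; `x i` is the position of the `i`-th particle. -/
abbrev OrdSpace (N d : ℕ) : Type := PiLp 2 (fun _ : Fin N => EuclideanSpace ℝ (Fin d))

/-- The action of a permutation on ordered configurations,
`(x_1, …, x_N) ↦ (x_{σ(1)}, …, x_{σ(N)})`. -/
def permute (σ : Equiv.Perm (Fin N)) : OrdSpace N d ≃ₗᵢ[ℝ] OrdSpace N d :=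
  LinearIsometryEquiv.piLpCongrLeft 2 ℝ (EuclideanSpace ℝ (Fin d)) σ.symm

@[simp] lemma permute_apply (σ : Equiv.Perm (Fin N)) (x : OrdSpace N d) (i : Fin N) :
    permute σ x i = x (σ i) := by
  simp [permute, LinearIsometryEquiv.piLpCongrLeft_apply, Equiv.piCongrLeft'_apply]

lemma isOpen_collisionFree : IsOpen {x : OrdSpace N d | Function.Injective fun i => x i} := by
  have : {x : OrdSpace N d | Function.Injective fun i => x i}
      = ⋂ i : Fin N, ⋂ j : Fin N, {x : OrdSpace N d | i ≠ j → x i ≠ x j} := by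
    ext x
    simp only [Set.mem_ofPred_eq, Set.mem_iInter]
    exact ⟨fun h i j hij he => hij (h he), fun h i j he => by_contra fun hij => h i j hij he⟩
  rw [this]
  refine isOpen_iInter_of_finite fun i => isOpen_iInter_of_finite fun j => ?_
  by_cases hij : i = j
  · simp [hij]
  · have h : IsOpen {x : OrdSpace N d | x i ≠ x j} :=
      isOpen_ne_fun (by fun_prop) (by fun_prop)
    simpa [hij] using h

/-- `ℝ^{d,N}_≠`, the open set of ordered configurations without collisions. -/
def OrdConf (N d : ℕ) : TopologicalSpace.Opens (OrdSpace N d) :=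
  ⟨{x | Function.Injective fun i => x i}, isOpen_collisionFree⟩

/-- `ᴺℝ^d`, the set of unordered configurations: the `N`-element subsets of `ℝ^d`. -/
def Conf (N d : ℕ) : Type := {S : Set (EuclideanSpace ℝ (Fin d)) // S.encard = N}

/-- The projection `π(x_1, …, x_N) = {x_1, …, x_N}` from ordered to unordered configurations. -/
def proj (x : OrdConf N d) : Conf N d :=
  ⟨Set.range fun i => x.1 i, by
    have h : Function.Injective fun i => x.1 i := x.2
    rw [← Set.image_univ, h.encard_image, Set.encard_univ, ENat.card_eq_coe_fintype_card,
      Fintype.card_fin]⟩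

lemma proj_surjective : Function.Surjective (proj : OrdConf N d → Conf N d) := by
  rintro ⟨S, hS⟩
  have hfin : S.Finite := Set.finite_of_encard_eq_coe hS
  have := hfin.fintype
  have hcard : Fintype.card S = N := by
    have h : S.encard = (Fintype.card S : ℕ∞) := by
      rw [← Set.coe_fintypeCard]
    rw [hS] at h
    exact_mod_cast h.symm
  let e : Fin N ≃ S := (Fintype.equivFinOfCardEq hcard).symm
  refine ⟨⟨WithLp.toLp 2 fun i => (e i : EuclideanSpace ℝ (Fin d)), ?_⟩, ?_⟩
  · intro i j h
    exact e.injective (Subtype.ext h)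
  · apply Subtype.ext
    ext y
    constructor
    · rintro ⟨i, rfl⟩
      exact (e i).2
    · intro hy
      exact ⟨e.symm ⟨y, hy⟩, by simp⟩

/-- Reordering a collision-free configuration. -/
def reorder (σ : Equiv.Perm (Fin N)) (x : OrdConf N d) : OrdConf N d :=
  ⟨permute σ x.1, fun i j h => σ.injective (x.2 (by simpa using h))⟩

lemma continuous_reorder (σ : Equiv.Perm (Fin N)) :
    Continuous (reorder σ : OrdConf N d → OrdConf N d) :=
  Continuous.subtype_mk ((permute σ).continuous.comp continuous_subtype_val) _

lemma proj_eq_proj_iff {x y : OrdConf N d} :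
    proj x = proj y ↔ ∃ σ : Equiv.Perm (Fin N), y = reorder σ x := by
  constructor
  · intro h
    have hr : (Set.range fun i => x.1 i) = Set.range fun i => y.1 i := congrArg Subtype.val h
    have hx : Function.Injective fun i => x.1 i := x.2
    have hy : Function.Injective fun i => y.1 i := y.2
    let ex := Equiv.ofInjective _ hx
    let ey := Equiv.ofInjective _ hy
    refine ⟨(ey.trans (Equiv.setCongr hr.symm)).trans ex.symm, ?_⟩
    apply Subtype.ext
    ext1 i
    have h1 : x.1 (ex.symm (Equiv.setCongr hr.symm (ey i))) = y.1 i := by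
      have := congrArg Subtype.val (ex.apply_symm_apply (Equiv.setCongr hr.symm (ey i)))
      exact this
    simpa [reorder] using h1.symm
  · rintro ⟨σ, rfl⟩
    apply Subtype.ext
    ext z
    constructor
    · rintro ⟨i, rfl⟩
      exact ⟨σ.symm i, by simp [reorder]⟩
    · rintro ⟨i, rfl⟩
      exact ⟨σ i, by simp [reorder]⟩

/-- The quotient topology of `ᴺℝ^d`. -/
instance : TopologicalSpace (Conf N d) := TopologicalSpace.coinduced proj inferInstance

lemma isQuotientMap_proj : Topology.IsQuotientMap (proj : OrdConf N d → Conf N d) :=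
  ⟨⟨rfl⟩, proj_surjective⟩

lemma continuous_proj : Continuous (proj : OrdConf N d → Conf N d) := isQuotientMap_proj.continuous

lemma isOpenMap_proj : IsOpenMap (proj : OrdConf N d → Conf N d) := by
  intro W hW
  rw [← isQuotientMap_proj.isOpen_preimage]
  have : proj ⁻¹' (proj '' W) = ⋃ σ : Equiv.Perm (Fin N), (reorder σ) ⁻¹' W := by
    ext x
    simp only [Set.mem_preimage, Set.mem_image, Set.mem_iUnion]
    constructor
    · rintro ⟨y, hy, h⟩
      obtain ⟨σ, rfl⟩ := proj_eq_proj_iff.1 h.symm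
      exact ⟨σ, hy⟩
    · rintro ⟨σ, hσ⟩
      exact ⟨_, hσ, (proj_eq_proj_iff.2 ⟨σ, rfl⟩).symm⟩
  rw [this]
  exact isOpen_iUnion fun σ => hW.preimage (continuous_reorder σ)

lemma exists_injOn_proj (x : OrdConf N d) : ∃ W : Set (OrdConf N d), IsOpen W ∧ x ∈ W ∧
    Set.InjOn proj W := by
  have h1 : ∀ σ : Equiv.Perm (Fin N), ∀ᶠ p : OrdConf N d × OrdConf N d in 𝓝 (x, x),
      p.2 = reorder σ p.1 → p.2 = p.1 := by
    intro σ
    by_cases hσ : reorder σ x = x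
    · have : σ = 1 := by
        ext i
        have h2 : x.1 (σ i) = x.1 i := by
          have := congrArg (fun y : OrdConf N d => y.1 i) hσ
          simpa [reorder] using this
        simpa using congrArg Fin.val (x.2 h2)
      refine Filter.Eventually.of_forall fun p hp => ?_
      rw [hp, this]
      apply Subtype.ext
      ext1 i
      simp [reorder]
    · have hc : IsOpen {p : OrdConf N d × OrdConf N d | p.2 ≠ reorder σ p.1} :=
        isOpen_ne_fun continuous_snd ((continuous_reorder σ).comp continuous_fst)
      filter_upwards [hc.mem_nhds (show (x, x) ∈ {p : OrdConf N d × OrdConf N d |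
        p.2 ≠ reorder σ p.1} from fun h => hσ h.symm)] with p hp h
      exact absurd h hp
  have h2 := Filter.eventually_all.2 h1
  rw [nhds_prod_eq, Filter.Eventually, Filter.mem_prod_self_iff] at h2
  obtain ⟨t, ht, h3⟩ := h2
  obtain ⟨W, hWt, hW, hxW⟩ := mem_nhds_iff.1 ht
  refine ⟨W, hW, hxW, fun a ha b hb hab => ?_⟩
  obtain ⟨σ, hσ⟩ := proj_eq_proj_iff.1 hab
  exact (h3 (Set.mk_mem_prod (hWt ha) (hWt hb)) σ hσ).symm

lemma isLocalHomeomorph_proj : IsLocalHomeomorph (proj : OrdConf N d → Conf N d) := by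
  rw [isLocalHomeomorph_iff_isOpenEmbedding_restrict]
  intro x
  obtain ⟨W, hW, hxW, hinj⟩ := exists_injOn_proj x
  refine ⟨W, hW.mem_nhds hxW, ?_⟩
  exact Topology.IsOpenEmbedding.of_continuous_injective_isOpenMap
    (continuous_proj.comp continuous_subtype_val) (Set.injOn_iff_injective.1 hinj)
    (isOpenMap_proj.domRestrict hW)

/-- The manifold structure of `ᴺℝ^d` for which `π` is a local diffeomorphism: the charts are the
local inverses of `π`. Since permutations are isometries of `ℝ^{Nd}`, these charts are isometric
for the Riemannian metric that makes `π` a local isometry. -/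
instance : ChartedSpace (OrdSpace N d) (Conf N d) :=
  isLocalHomeomorph_proj.chartedSpace proj_surjective

lemma exists_eq_chart {e : OpenPartialHomeomorph (Conf N d) (OrdSpace N d)}
    (he : e ∈ atlas (OrdSpace N d) (Conf N d)) {q : Conf N d} (hq : q ∈ e.source) :
    ∃ z : OrdConf N d, proj z = q ∧ e q = z.1 := by
  obtain ⟨p, rfl⟩ := he
  rw [OpenPartialHomeomorph.trans_source] at hq
  exact ⟨_, isLocalHomeomorph_proj.apply_localInverseAt_of_mem hq.1, rfl⟩

instance : IsManifold 𝓘(ℝ, OrdSpace N d) ∞ (Conf N d) := by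
  refine isManifold_of_contDiffOn _ _ _ fun e e' he he' => ?_
  simp only [modelWithCornersSelf_coe, modelWithCornersSelf_coe_symm, Function.comp_id,
    Function.id_comp, Set.range_id, Set.inter_univ, Set.preimage_id_eq, id_eq]
  intro x hx
  apply ContDiffAt.contDiffWithinAt
  have key : ∀ y ∈ (e.symm.trans e').source, ∃ z z' : OrdConf N d, z.1 = y ∧
      proj z = proj z' ∧ (e.symm.trans e') y = z'.1 := by
    intro y hy
    rw [OpenPartialHomeomorph.trans_source] at hy
    obtain ⟨z, hz, hz'⟩ := exists_eq_chart he (e.map_target hy.1)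
    obtain ⟨w, hw, hw'⟩ := exists_eq_chart he' hy.2
    refine ⟨z, w, ?_, hz.trans hw.symm, hw'⟩
    rw [← hz']
    exact e.right_inv hy.1
  obtain ⟨z, z', hz, hzz', hz'⟩ := key x hx
  obtain ⟨σ, rfl⟩ := proj_eq_proj_iff.1 hzz'
  obtain ⟨W, hW, hxW, hinj⟩ := exists_injOn_proj (reorder σ z)
  have hW' : IsOpen (Subtype.val '' W) := (OrdConf N d).isOpen.isOpenMap_subtype_val W hW
  have hmem : x ∈ (e.symm.trans e').source := hx
  have h0 : ∀ᶠ y in 𝓝 x, y ∈ (e.symm.trans e').source := (e.symm.trans e').open_source.mem_nhds hmem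
  have h1 : ∀ᶠ y in 𝓝 x, (e.symm.trans e') y ∈ Subtype.val '' W := by
    refine ((e.symm.trans e').continuousAt hmem).eventually_mem (hW'.mem_nhds ?_)
    rw [hz']
    exact ⟨_, hxW, rfl⟩
  have h2 : ∀ᶠ y in 𝓝 x, permute σ y ∈ Subtype.val '' W := by
    refine ((permute σ).continuous.continuousAt).eventually_mem (hW'.mem_nhds ?_)
    rw [← hz]
    exact ⟨_, hxW, rfl⟩
  refine ((permute σ).contDiff.contDiffAt (x := x)).congr_of_eventuallyEq ?_
  filter_upwards [h0, h1, h2] with y hy hy1 hy2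
  obtain ⟨a, b, ha, hab, hb⟩ := key y hy
  obtain ⟨u, hu, hu'⟩ := hy1
  obtain ⟨v, hv, hv'⟩ := hy2
  have hub : u = b := Subtype.ext (hu'.trans hb)
  have hva : v = reorder σ a := Subtype.ext (hv'.trans (by rw [← ha]; rfl))
  have : u = v := hinj hu hv (by
    rw [hub, ← hab, hva]
    exact proj_eq_proj_iff.2 ⟨σ, rfl⟩)
  change (e.symm.trans e') y = _
  rw [← hu', this, hv']

instance : SecondCountableTopology (Conf N d) :=
  isQuotientMap_proj.secondCountableTopology isOpenMap_proj

instance : MeasurableSpace (Conf N d) := borel _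

instance : BorelSpace (Conf N d) := ⟨rfl⟩

/-- The Riemannian volume measure `dq` of `ᴺℝ^d`. As `π` is an `N!`-sheeted local isometry, it is
`1/N!` times the image of the Lebesgue measure. -/
def confVolume (N d : ℕ) : Measure (Conf N d) :=
  (N.factorial : ℝ≥0∞)⁻¹ • Measure.map proj (Measure.comap Subtype.val (volume : Measure (OrdSpace N d)))

/-! ### Hermitian line bundles -/

/-- A complex vector bundle is a real vector bundle. -/
instance vectorBundleReal {B : Type*} [TopologicalSpace B] {F : B → Type*}
    [∀ q, NormedAddCommGroup (F q)] [∀ q, InnerProductSpace ℂ (F q)]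
    [TopologicalSpace (TotalSpace ℂ F)] [FiberBundle ℂ F] [h : VectorBundle ℂ ℂ F] :
    VectorBundle ℝ ℂ F where
  trivialization_linear' e he := by
    have := h.trivialization_linear' e
    exact ⟨fun b hb => ⟨fun x y => (this.linear b hb).map_add x y, fun c x => by
      simpa using (this.linear b hb).map_smul (c : ℂ) x⟩⟩
  continuousOn_coordChange' e e' he he' := by
    have h1 := h.continuousOn_coordChange' e e'
    have h2 := (ContinuousLinearMap.continuous_restrictScalars (𝕜 := ℂ) (E := ℂ) (F := ℂ) ℝ).comp_continuousOn h1
    refine h2.congr fun b hb => ContinuousLinearMap.ext fun v => ?_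
    simp only [Function.comp_apply, ContinuousLinearMap.coe_restrictScalars']
    have hlin : ∀ e : Trivialization ℂ (TotalSpace.proj : TotalSpace ℂ F → B),
        [MemTrivializationAtlas e] → e.IsLinear ℝ := fun e he => by
      have := h.trivialization_linear' e
      exact ⟨fun b hb => ⟨fun x y => (this.linear b hb).map_add x y, fun c x => by
        simpa using (this.linear b hb).map_smul (c : ℂ) x⟩⟩
    have := hlin e
    have := hlin e'
    exact (e.coordChangeL_apply e' hb v).trans (e.coordChangeL_apply (R := ℂ) e' hb v).symm

section Bundle

set_option linter.unusedSectionVars false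

variable (F : Conf N d → Type*)
  [∀ q, NormedAddCommGroup (F q)] [∀ q, InnerProductSpace ℂ (F q)]
  [TopologicalSpace (TotalSpace ℂ F)] [FiberBundle ℂ F] [VectorBundle ℂ ℂ F]

/-- A section is smooth at a point. -/
def SmoothSectionAt {F : Conf N d → Type*}
    [∀ q, NormedAddCommGroup (F q)] [∀ q, InnerProductSpace ℂ (F q)]
    [TopologicalSpace (TotalSpace ℂ F)] [FiberBundle ℂ F] [VectorBundle ℂ ℂ F]
    (ψ : ∀ q, F q) (q : Conf N d) : Prop :=
  ContMDiffAt 𝓘(ℝ, OrdSpace N d) (𝓘(ℝ, OrdSpace N d).prod 𝓘(ℝ, ℂ)) ∞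
    (fun p => TotalSpace.mk' ℂ p (ψ p)) q

/-- The inner product `(·,·)_q` of the fibre `F_q` depends smoothly on `q`. -/
class SmoothFiberMetric : Prop where
  contMDiffAt_inner : ∀ (ψ φ : ∀ q, F q) (q : Conf N d),
    SmoothSectionAt ψ q → SmoothSectionAt φ q →
    ContMDiffAt 𝓘(ℝ, OrdSpace N d) 𝓘(ℝ, ℂ) ∞ (fun p => inner ℂ (ψ p) (φ p)) q

/-! ### Square-integrable sections -/

variable {F} in
/-- A section is measurable if its coordinates in the local trivializations are (the coordinate
map `continuousLinearMapAt` of a trivialization is extended by `0` off its base set). -/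
def MeasurableSection (ψ : ∀ q, F q) : Prop :=
  ∀ q₀, Measurable fun q => (trivializationAt ℂ F q₀).continuousLinearMapAt ℂ q (ψ q)

variable {F}

/-- The local frame of a trivialization. -/
def frame (q₀ : Conf N d) (q : Conf N d) : F q := (trivializationAt ℂ F q₀).symmL ℂ q 1

lemma measurableSection_frame (q₁ : Conf N d) :
    MeasurableSection (frame q₁ : ∀ q, F q) := by
  intro q₀
  classical
  set e₀ := trivializationAt ℂ F q₀
  set e₁ := trivializationAt ℂ F q₁
  have hc : ContinuousOn (fun q => e₁.coordChangeL ℂ e₀ q (1 : ℂ)) (e₁.baseSet ∩ e₀.baseSet) := by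
    have h := continuousOn_coordChange ℂ e₁ e₀
    intro q hq
    exact (h q hq).clm_apply continuousWithinAt_const
  have hm : MeasurableSet (e₁.baseSet ∩ e₀.baseSet) :=
    (e₁.open_baseSet.inter e₀.open_baseSet).measurableSet
  have := hc.measurable_piecewise (continuousOn_const (c := (0:ℂ))) hm
  convert this using 1
  ext q
  by_cases h1 : q ∈ e₁.baseSet
  · by_cases h0 : q ∈ e₀.baseSet
    · have h10 : q ∈ e₁.baseSet ∩ e₀.baseSet := ⟨h1, h0⟩
      rw [Set.piecewise_eq_of_mem _ _ _ h10]
      rw [e₁.coordChangeL_apply e₀ h10, frame, e₁.symmL_apply h1,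
        e₀.continuousLinearMapAt_apply_of_mem ℂ h0]
    · rw [Set.piecewise_eq_of_notMem _ _ _ (fun h => h0 h.2)]
      rw [Trivialization.continuousLinearMapAt_apply, e₀.linearMapAt_def_of_notMem h0]; rfl
  · rw [Set.piecewise_eq_of_notMem _ _ _ (fun h => h1 h.1), frame, e₁.symmL_apply_of_notMem h1,
      map_zero]

lemma frame_eq {q₁ q : Conf N d} (hq : q ∈ (trivializationAt ℂ F q₁).baseSet) (v : F q) :
    v = (trivializationAt ℂ F q₁).continuousLinearMapAt ℂ q v • frame q₁ q := by
  rw [frame, ← map_smul, smul_eq_mul, mul_one, Trivialization.symmL_continuousLinearMapAt _ hq]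

lemma exists_index [Nonempty (Conf N d)] : ∃ (c : ℕ → Conf N d) (n : Conf N d → ℕ),
    Measurable n ∧ ∀ q, q ∈ (trivializationAt ℂ F (c (n q))).baseSet := by
  classical
  obtain ⟨s, hs, hs'⟩ := TopologicalSpace.countable_cover_nhds
    (f := fun q : Conf N d => (trivializationAt ℂ F q).baseSet)
    (fun q => (trivializationAt ℂ F q).open_baseSet.mem_nhds
      (FiberBundle.mem_baseSet_trivializationAt ℂ F q))
  have hne : s.Nonempty := by
    rw [Set.nonempty_iff_ne_empty]
    rintro rfl
    obtain ⟨q⟩ := ‹Nonempty (Conf N d)›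
    have : q ∈ (Set.univ : Set (Conf N d)) := trivial
    simp [← hs'] at this
  obtain ⟨c, rfl⟩ := hs.exists_eq_range hne
  have hex : ∀ q, ∃ k, q ∈ (trivializationAt ℂ F (c k)).baseSet := by
    intro q
    have : q ∈ (Set.univ : Set (Conf N d)) := trivial
    rw [← hs'] at this
    simpa using this
  exact ⟨c, fun q => Nat.find (hex q),
    measurable_find hex fun k => (trivializationAt ℂ F (c k)).open_baseSet.measurableSet,
    fun q => Nat.find_spec (hex q)⟩

lemma measurable_glue {β : Type*} [MeasurableSpace β] {n : Conf N d → ℕ} (hn : Measurable n)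
    {g : ℕ → Conf N d → β} (hg : ∀ k, Measurable (g k)) : Measurable fun q => g (n q) q := by
  have : Measurable fun p : ℕ × Conf N d => g p.1 p.2 := measurable_from_prod_countable_right hg
  exact this.comp (hn.prodMk measurable_id)

lemma measurable_inner_frame [ContMDiffVectorBundle ∞ ℂ F 𝓘(ℝ, OrdSpace N d)]
    [SmoothFiberMetric F] (q₁ : Conf N d) :
    Measurable fun q => inner ℂ (frame q₁ q : F q) (frame q₁ q) := by
  classical
  set e₁ := trivializationAt ℂ F q₁ with he₁
  have hc : ContinuousOn (fun q => inner ℂ (frame q₁ q : F q) (frame q₁ q)) e₁.baseSet := by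
    intro q hq
    apply ContinuousAt.continuousWithinAt
    have hs : SmoothSectionAt (frame q₁ : ∀ q, F q) q := by
      rw [SmoothSectionAt, e₁.contMDiffAt_section_iff hq]
      refine (contMDiffAt_const (c := (1 : ℂ))).congr_of_eventuallyEq ?_
      filter_upwards [e₁.open_baseSet.mem_nhds hq] with p hp
      change (e₁ ⟨p, e₁.symmL ℂ p 1⟩).2 = 1
      rw [e₁.symmL_apply hp, e₁.apply_mk_symm hp]
    exact (SmoothFiberMetric.contMDiffAt_inner _ _ q hs hs).continuousAt
  have := hc.measurable_piecewise (continuousOn_const (c := (0:ℂ))) e₁.open_baseSet.measurableSet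
  convert this using 1
  ext q
  by_cases h1 : q ∈ e₁.baseSet
  · rw [Set.piecewise_eq_of_mem _ _ _ h1]
  · rw [Set.piecewise_eq_of_notMem _ _ _ h1, frame, e₁.symmL_apply_of_notMem h1, inner_zero_left]

lemma measurable_inner_section [ContMDiffVectorBundle ∞ ℂ F 𝓘(ℝ, OrdSpace N d)]
    [SmoothFiberMetric F] {ψ φ : ∀ q, F q} (hψ : MeasurableSection ψ) (hφ : MeasurableSection φ) :
    Measurable fun q => inner ℂ (ψ q) (φ q) := by
  rcases isEmpty_or_nonempty (Conf N d) with h | h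
  · exact measurable_of_empty _
  obtain ⟨c, n, hn, hmem⟩ := exists_index (F := F)
  have key : ∀ q, inner ℂ (ψ q) (φ q) =
      (starRingEnd ℂ) ((trivializationAt ℂ F (c (n q))).continuousLinearMapAt ℂ q (ψ q)) *
      ((trivializationAt ℂ F (c (n q))).continuousLinearMapAt ℂ q (φ q) *
        inner ℂ (frame (c (n q)) q : F q) (frame (c (n q)) q)) := by
    intro q
    conv_lhs => rw [frame_eq (hmem q) (ψ q), frame_eq (hmem q) (φ q), inner_smul_left,
      inner_smul_right]
  simp_rw [key]
  refine measurable_glue hn (g := fun k q =>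
    (starRingEnd ℂ) ((trivializationAt ℂ F (c k)).continuousLinearMapAt ℂ q (ψ q)) *
      ((trivializationAt ℂ F (c k)).continuousLinearMapAt ℂ q (φ q) *
        inner ℂ (frame (c k) q : F q) (frame (c k) q))) fun k => ?_
  exact (Complex.continuous_conj.measurable.comp (hψ _)).mul ((hφ _).mul (measurable_inner_frame _))

lemma MeasurableSection.norm [ContMDiffVectorBundle ∞ ℂ F 𝓘(ℝ, OrdSpace N d)]
    [SmoothFiberMetric F] {ψ : ∀ q, F q} (hψ : MeasurableSection ψ) :
    Measurable fun q => ‖ψ q‖ := by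
  have := (Complex.continuous_re.measurable.comp (measurable_inner_section hψ hψ)).sqrt
  convert this using 2 with q
  exact norm_eq_sqrt_re_inner (𝕜 := ℂ) (ψ q)

lemma MeasurableSection.smul {ψ : ∀ q, F q} (hψ : MeasurableSection ψ) {f : Conf N d → ℂ}
    (hf : Measurable f) : MeasurableSection fun q => f q • ψ q := by
  intro q₀
  simp only [map_smul]
  exact hf.smul (hψ q₀)

lemma exists_unit_section [ContMDiffVectorBundle ∞ ℂ F 𝓘(ℝ, OrdSpace N d)]
    [SmoothFiberMetric F] : ∃ u : ∀ q, F q, MeasurableSection u ∧ (∀ q, ‖u q‖ = 1) ∧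
      ∀ q (v : F q), v = inner ℂ (u q) v • u q := by
  rcases isEmpty_or_nonempty (Conf N d) with h | h
  · exact ⟨fun q => 0, fun q => h.elim q, fun q => h.elim q, fun q => h.elim q⟩
  obtain ⟨c, n, hn, hmem⟩ := exists_index (F := F)
  have hne : ∀ q, (frame (c (n q)) q : F q) ≠ 0 := by
    intro q h0
    have h1 := (trivializationAt ℂ F (c (n q))).continuousLinearMapAt_symmL (R := ℂ) (hmem q) (1 : ℂ)
    change (trivializationAt ℂ F (c (n q))).continuousLinearMapAt ℂ q (frame (c (n q)) q) = 1 at h1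
    rw [h0, map_zero] at h1
    exact zero_ne_one h1
  have hu : ∀ q, ‖((‖(frame (c (n q)) q : F q)‖⁻¹ : ℝ) : ℂ) • (frame (c (n q)) q : F q)‖ = 1 := by
    intro q
    rw [norm_smul, Complex.norm_real, norm_inv, norm_norm, inv_mul_cancel₀ (norm_ne_zero_iff.2 (hne q))]
  refine ⟨fun q => ((‖(frame (c (n q)) q : F q)‖⁻¹ : ℝ) : ℂ) • frame (c (n q)) q, ?_, hu, ?_⟩
  · intro q₀
    refine measurable_glue hn (g := fun k q => (trivializationAt ℂ F q₀).continuousLinearMapAt ℂ q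
      (((‖(frame (c k) q : F q)‖⁻¹ : ℝ) : ℂ) • frame (c k) q)) fun k => ?_
    refine MeasurableSection.smul (measurableSection_frame _) ?_ q₀
    exact Complex.measurable_ofReal.comp (measurableSection_frame (F := F) (c k)).norm.inv
  · intro q v
    beta_reduce
    generalize hw : ((‖(frame (c (n q)) q : F q)‖⁻¹ : ℝ) : ℂ) • (frame (c (n q)) q : F q) = w
    have hw1 : ‖w‖ = 1 := by rw [← hw]; exact hu q
    have hv : ∃ z : ℂ, v = z • w := by
      refine ⟨(trivializationAt ℂ F (c (n q))).continuousLinearMapAt ℂ q v *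
        (‖(frame (c (n q)) q : F q)‖ : ℂ), ?_⟩
      rw [← hw, smul_smul, mul_assoc, ← Complex.ofReal_mul,
        mul_inv_cancel₀ (norm_ne_zero_iff.2 (hne q)), Complex.ofReal_one, mul_one]
      exact frame_eq (hmem q) v
    obtain ⟨z, rfl⟩ := hv
    rw [inner_smul_right, inner_self_eq_norm_sq_to_K, hw1]
    simp

variable (F) in
/-- The space of square-integrable (measurable) sections, before identification of sections that
agree almost everywhere. -/
def sqIntSections [ContMDiffVectorBundle ∞ ℂ F 𝓘(ℝ, OrdSpace N d)] [SmoothFiberMetric F] :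
    Submodule ℂ (∀ q, F q) where
  carrier := {ψ | MeasurableSection ψ ∧ MemLp (fun q => ‖ψ q‖) 2 (confVolume N d)}
  zero_mem' := ⟨fun q₀ => by simp, by simp⟩
  add_mem' := by
    rintro ψ φ ⟨h1, h1'⟩ ⟨h2, h2'⟩
    have h3 : MeasurableSection (ψ + φ) := fun q₀ => by
      simp only [Pi.add_apply, map_add]
      exact (h1 q₀).add (h2 q₀)
    refine ⟨h3, (h1'.add h2').mono h3.norm.aestronglyMeasurable (Filter.Eventually.of_forall ?_)⟩
    intro q
    simp only [Pi.add_apply, norm_norm]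
    exact (norm_add_le (ψ q) (φ q)).trans (le_abs_self _)
  smul_mem' := by
    rintro c ψ ⟨h1, h1'⟩
    refine ⟨h1.smul (f := fun _ => c) measurable_const, ?_⟩
    simpa [norm_smul] using h1'.const_mul ‖c‖

variable [ContMDiffVectorBundle ∞ ℂ F 𝓘(ℝ, OrdSpace N d)] [SmoothFiberMetric F]

lemma integrable_inner_section (ψ φ : sqIntSections F) :
    Integrable (fun q => inner ℂ (ψ.1 q) (φ.1 q)) (confVolume N d) := by
  refine (ψ.2.2.integrable_mul φ.2.2).mono
    (measurable_inner_section ψ.2.1 φ.2.1).aestronglyMeasurable (Filter.Eventually.of_forall ?_)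
  intro q
  simpa using norm_inner_le_norm (𝕜 := ℂ) (ψ.1 q) (φ.1 q)

/-- The inner product `⟨ψ, φ⟩ = ∫ dq (ψ(q), φ(q))_q` of square-integrable sections. -/
def innerSection (ψ φ : sqIntSections F) : ℂ :=
  ∫ q, inner ℂ (ψ.1 q) (φ.1 q) ∂(confVolume N d)

lemma innerSection_self (ψ : sqIntSections F) :
    innerSection ψ ψ = ((∫ q, ‖ψ.1 q‖ ^ 2 ∂(confVolume N d) : ℝ) : ℂ) := by
  have h : ((∫ q, ‖ψ.1 q‖ ^ 2 ∂(confVolume N d) : ℝ) : ℂ)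
      = ∫ q, ((‖ψ.1 q‖ ^ 2 : ℝ) : ℂ) ∂(confVolume N d) := integral_complex_ofReal.symm
  rw [innerSection, h]
  congr 1
  ext q
  rw [inner_self_eq_norm_sq_to_K]
  simp

lemma innerSection_conj (ψ φ : sqIntSections F) :
    (starRingEnd ℂ) (innerSection φ ψ) = innerSection ψ φ := by
  rw [innerSection, ← integral_conj]
  simp [innerSection]

lemma innerSection_add_left (ψ φ χ : sqIntSections F) :
    innerSection (ψ + φ) χ = innerSection ψ χ + innerSection φ χ := by
  rw [innerSection, innerSection, innerSection,
    ← integral_add (integrable_inner_section _ _) (integrable_inner_section _ _)]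
  congr 1
  ext q
  exact inner_add_left _ _ _

lemma innerSection_smul_left (ψ φ : sqIntSections F) (c : ℂ) :
    innerSection (c • ψ) φ = (starRingEnd ℂ) c * innerSection ψ φ := by
  rw [innerSection, innerSection, ← integral_const_mul]
  congr 1
  ext q
  exact inner_smul_left _ _ _

lemma innerSection_self_nonneg (ψ : sqIntSections F) : 0 ≤ RCLike.re (innerSection ψ ψ) := by
  rw [innerSection_self]
  simp only [RCLike.re_to_complex, Complex.ofReal_re]
  positivity

variable (F) in
/-- The space of square-integrable sections, with the inner product `innerSection`. -/
def PreL2 : Type _ := sqIntSections F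

instance : AddCommGroup (PreL2 F) := inferInstanceAs (AddCommGroup (sqIntSections F))

instance : Module ℂ (PreL2 F) := inferInstanceAs (Module ℂ (sqIntSections F))

instance preL2Core : PreInnerProductSpace.Core ℂ (PreL2 F) where
  inner := innerSection (F := F)
  conj_inner_symm := innerSection_conj (F := F)
  re_inner_nonneg := innerSection_self_nonneg (F := F)
  add_left := innerSection_add_left (F := F)
  smul_left := innerSection_smul_left (F := F)

instance : SeminormedAddCommGroup (PreL2 F) :=
  InnerProductSpace.Core.toSeminormedAddCommGroup (𝕜 := ℂ)

instance : InnerProductSpace ℂ (PreL2 F) := InnerProductSpace.ofCore preL2Core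

/-- A square-integrable section as an element of `PreL2 F`. -/
def toPreL2 (ψ : sqIntSections F) : PreL2 F := ψ

lemma norm_sq_toPreL2 (ψ : sqIntSections F) :
    ‖toPreL2 ψ‖ ^ 2 = ∫ q, ‖ψ.1 q‖ ^ 2 ∂(confVolume N d) := by
  have h : inner ℂ (toPreL2 ψ) (toPreL2 ψ) = innerSection ψ ψ := rfl
  rw [norm_sq_eq_re_inner (𝕜 := ℂ), h, innerSection_self]
  simp

variable (F) in
/-- The Hilbert space `L²(F)` of square-integrable sections of `F` modulo equality almost
everywhere (sections are identified if their difference has norm zero, see `toL2_eq_iff`). -/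
abbrev L2Section : Type _ := SeparationQuotient (PreL2 F)

/-- The element of `L²(F)` given by a square-integrable section. -/
def toL2 (ψ : ∀ q, F q) (h : ψ ∈ sqIntSections F) : L2Section F :=
  SeparationQuotient.mk (toPreL2 ⟨ψ, h⟩)

lemma toL2_eq_iff {ψ φ : ∀ q, F q} (hψ : ψ ∈ sqIntSections F) (hφ : φ ∈ sqIntSections F) :
    toL2 ψ hψ = toL2 φ hφ ↔ ∀ᵐ q ∂(confVolume N d), ψ q = φ q := by
  have hsub := (sqIntSections F).sub_mem hψ hφ
  have h0 : toL2 ψ hψ = toL2 φ hφ ↔ ‖toPreL2 ⟨ψ - φ, hsub⟩‖ ^ 2 = 0 := by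
    rw [pow_eq_zero_iff two_ne_zero]
    refine (SeparationQuotient.mk_eq_mk.trans Metric.inseparable_iff).trans ?_
    rw [dist_eq_norm]
    rfl
  rw [h0, norm_sq_toPreL2, integral_eq_zero_iff_of_nonneg (fun q => by positivity)
    hsub.2.integrable_sq]
  refine Filter.eventually_congr (Filter.Eventually.of_forall fun q => ?_)
  simp [sub_eq_zero]

instance : CompleteSpace (PreL2 F) := by
  obtain ⟨u, hu, hu1, hu2⟩ := exists_unit_section (F := F)
  have hn : ∀ q (v : F q), ‖inner ℂ (u q) v‖ = ‖v‖ := fun q v => by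
    conv_rhs => rw [hu2 q v, norm_smul, hu1, mul_one]
  have hmem : ∀ ψ : sqIntSections F,
      MemLp (fun q => inner ℂ (u q) (ψ.1 q)) 2 (confVolume N d) := fun ψ =>
    ψ.2.2.mono (measurable_inner_section hu ψ.2.1).aestronglyMeasurable
      (Filter.Eventually.of_forall fun q => by simp [hn])
  let J : PreL2 F →+ Lp ℂ 2 (confVolume N d) :=
    { toFun := fun ψ => (hmem ψ).toLp _
      map_zero' := by
        rw [← MemLp.toLp_zero (MemLp.zero (μ := confVolume N d) (p := 2) (ε := ℂ))]
        apply MemLp.toLp_congr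
        refine Filter.Eventually.of_forall fun q => ?_
        exact inner_zero_right _
      map_add' := fun ψ φ => by
        rw [← MemLp.toLp_add]
        apply MemLp.toLp_congr
        refine Filter.Eventually.of_forall fun q => ?_
        exact inner_add_right _ _ _ }
  have hJ : Isometry J := by
    refine AddMonoidHomClass.isometry_of_norm J fun ψ => ?_
    have h1 : ∀ ψ : sqIntSections F, ‖(hmem ψ).toLp _‖ ^ 2 = ‖toPreL2 ψ‖ ^ 2 := by
      intro ψ
      rw [norm_sq_toPreL2, norm_sq_eq_re_inner (𝕜 := ℂ), L2.inner_def]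
      have h2 : ∫ q, inner ℂ ((hmem ψ).toLp _ q) ((hmem ψ).toLp _ q) ∂(confVolume N d)
          = ∫ q, ((‖ψ.1 q‖ ^ 2 : ℝ) : ℂ) ∂(confVolume N d) := by
        apply integral_congr_ae
        filter_upwards [(hmem ψ).coeFn_toLp] with q hq
        rw [hq, inner_self_eq_norm_sq_to_K, hn]
        simp
      rw [h2, integral_complex_ofReal]
      simp
    exact (pow_left_inj₀ (norm_nonneg _) (norm_nonneg _) two_ne_zero).1 (h1 ψ)
  refine (hJ.isUniformInducing.completeSpace_congr ?_).2 inferInstance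
  intro f
  obtain ⟨g, hg, hfg⟩ := (Lp.aestronglyMeasurable f)
  have hsec : MeasurableSection fun q => g q • u q := hu.smul hg.measurable
  have hg2 : MemLp g 2 (confVolume N d) := (memLp_congr_ae hfg).1 (Lp.memLp f)
  refine ⟨(⟨fun q => g q • u q, hsec, by simpa [norm_smul, hu1] using hg2.norm⟩ :
    sqIntSections F), ?_⟩
  apply Lp.ext
  refine ((hmem _).coeFn_toLp).trans (Filter.EventuallyEq.trans ?_ hfg.symm)
  refine Filter.Eventually.of_forall fun q => ?_
  simp only [inner_smul_right, inner_self_eq_norm_sq_to_K, hu1]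
  simp

/-! ### Hermitian connections, parallel transport, holonomy -/

/-- `∇` is a (smooth) Hermitian connection: it is `ℂ`-linear, it maps smooth sections to smooth
sections, and the inner product of the fibres is parallel,
`d(ψ, φ)(v) = (∇_v ψ, φ) + (ψ, ∇_v φ)`. The Leibniz rule is part of `CovariantDerivative`. -/
structure IsHermitianConnection (nab : CovariantDerivative 𝓘(ℝ, OrdSpace N d) ℂ F) : Prop where
  smooth : CovariantDerivative.ContMDiffCovariantDerivative nab ∞
  smul : ∀ (c : ℂ) (ψ : ∀ q, F q) (q : Conf N d) (v : TangentSpace 𝓘(ℝ, OrdSpace N d) q),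
    SmoothSectionAt ψ q → nab (fun p => c • ψ p) q v = c • nab ψ q v
  metric : ∀ (ψ φ : ∀ q, F q) (q : Conf N d) (v : TangentSpace 𝓘(ℝ, OrdSpace N d) q),
    SmoothSectionAt ψ q → SmoothSectionAt φ q →
    mfderiv 𝓘(ℝ, OrdSpace N d) 𝓘(ℝ, ℂ) (fun p => inner ℂ (ψ p) (φ p)) q v =
      (inner ℂ (nab ψ q v) (φ q) + inner ℂ (ψ q) (nab φ q v) : ℂ)

/-- The velocity `γ'(t)` of a curve `γ : [0,1] → ᴺℝ^d`. -/
def velocity (γ : ℝ → Conf N d) (t : ℝ) : TangentSpace 𝓘(ℝ, OrdSpace N d) (γ t) :=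
  mfderivWithin 𝓘(ℝ, ℝ) 𝓘(ℝ, OrdSpace N d) γ (Set.Icc 0 1) t (1 : ℝ)

/-- `s(t) ∈ F_{γ(t)}`, `t ∈ [0,1]`, is parallel along the curve `γ`, so that `s(1)` is the parallel
transport of `s(0)`. As the connection is metric, `d/dt (ψ(γ(t)), s(t)) = (∇_{γ'(t)} ψ, s(t)) +
(ψ(γ(t)), D_t s(t))` for all sections `ψ`, and the vanishing of `D_t s` is expressed by the absence
of the last term. -/
def IsParallelAlong (nab : CovariantDerivative 𝓘(ℝ, OrdSpace N d) ℂ F) (γ : ℝ → Conf N d)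
    (s : ∀ t, F (γ t)) : Prop :=
  ∀ t ∈ Set.Icc (0 : ℝ) 1, ∀ ψ : ∀ q, F q, SmoothSectionAt ψ (γ t) →
    HasDerivWithinAt (fun τ => (inner ℂ (ψ (γ τ)) (s τ) : ℂ))
      (inner ℂ (nab ψ (γ t) (velocity γ t)) (s t)) (Set.Icc 0 1) t

/-- A smooth curve `[0,1] → ℝ^{d,N}_≠` of ordered configurations. Since `π` is a covering and a
local diffeomorphism, the smooth curves in `ᴺℝ^d` are the curves `π ∘ c` with `c` of this kind. -/
def IsSmoothPath (c : ℝ → OrdConf N d) : Prop :=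
  ContDiffOn ℝ ∞ (fun t => (c t : OrdSpace N d)) (Set.Icc 0 1)

/-- The holonomies of `∇` are `h_α = (-1)^{σ_α}` for all loops `α` in `ᴺℝ^d`. The loop `α = π ∘ c`
consists of the curves `c_1, …, c_N` in `ℝ^d`, and if `c_i(1) = c_{σ(i)}(0)` for all `i`, then the
permutation of the configuration `α(0) = α(1)` defined by `α` is `c_i(0) ↦ c_{σ(i)}(0)`. -/
def HasFermionicHolonomy (nab : CovariantDerivative 𝓘(ℝ, OrdSpace N d) ℂ F) : Prop :=
  ∀ c : ℝ → OrdConf N d, IsSmoothPath c → ∀ σ : Equiv.Perm (Fin N), c 1 = reorder σ (c 0) →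
    ∀ s : ∀ t, F (proj (c t)), IsParallelAlong nab (fun t => proj (c t)) s →
      TotalSpace.mk' ℂ (proj (c 1)) (s 1) =
        TotalSpace.mk' ℂ (proj (c 0)) (((Equiv.Perm.sign σ : ℤ) : ℂ) • s 0)

/-- `Î` is a global trivialization, as a Hermitian bundle, of the lift `F̂ = π^* F` of `F`, the bundle
over `ℝ^{d,N}_≠` with fibres `F̂_x = F_{π(x)}`: the unitary maps `Î_x : F_{π(x)} → ℂ` are carried
into each other by parallel transport (that of `F̂` along `c` is that of `F` along `π ∘ c`). -/
def IsLiftTrivialization (nab : CovariantDerivative 𝓘(ℝ, OrdSpace N d) ℂ F)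
    (I : ∀ x : OrdConf N d, F (proj x) ≃ₗᵢ[ℂ] ℂ) : Prop :=
  ∀ c : ℝ → OrdConf N d, IsSmoothPath c →
    ∀ s : ∀ t, F (proj (c t)), IsParallelAlong nab (fun t => proj (c t)) s →
      I (c 1) (s 1) = I (c 0) (s 0)

/-! ### The Hamiltonian on sections -/

/-- Near `q`, the coordinate vector field with constant coordinates `v` in the preferred chart at
`q`. This chart is an isometry onto an open subset of `ℝ^{Nd}`, so the field is parallel for the
Levi-Civita connection. -/
def coordField (q : Conf N d) (v : OrdSpace N d) (p : Conf N d) :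
    TangentSpace 𝓘(ℝ, OrdSpace N d) p :=
  (trivializationAt (OrdSpace N d) (TangentSpace 𝓘(ℝ, OrdSpace N d)) q).symmL ℝ p v

/-- The Laplacian `Δψ = g^{ab} D_a D_b ψ` of a section, the metric trace of the second covariant
derivative: in the isometric chart at `q`, `Δψ(q) = ∑_a ∇_{∂_a} ∇_{∂_a} ψ (q)` with `∂_a` the
coordinate fields of an orthonormal basis. -/
def laplacianSection (nab : CovariantDerivative 𝓘(ℝ, OrdSpace N d) ℂ F) (ψ : ∀ q, F q)
    (q : Conf N d) : F q :=
  ∑ a, nab (fun p => nab ψ p (coordField q (stdOrthonormalBasis ℝ (OrdSpace N d) a) p)) q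
    (coordField q (stdOrthonormalBasis ℝ (OrdSpace N d) a) q)

/-- An ordering of an unordered configuration. -/
def ordering (q : Conf N d) : OrdConf N d := Function.surjInv proj_surjective q

/-- `-(ħ²/2m) Δψ + V ψ` for a section `ψ`; here `V(q)` is the value of the permutation-symmetric
function `V` on the orderings of `q`. -/
def hamSection (ħ m : ℝ) (V : OrdSpace N d → ℝ)
    (nab : CovariantDerivative 𝓘(ℝ, OrdSpace N d) ℂ F) (ψ : ∀ q, F q) (q : Conf N d) : F q :=
  -(ħ ^ 2 / (2 * m)) • laplacianSection nab ψ q + V (ordering q).1 • ψ q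

/-- The operator `H` in `L²(F)` extends `-(ħ²/2m) Δ + V` on `C_0^∞(F)`, the smooth sections with
compact support. -/
def ExtendsSectionHam (ħ m : ℝ) (V : OrdSpace N d → ℝ)
    (nab : CovariantDerivative 𝓘(ℝ, OrdSpace N d) ℂ F) (H : L2Section F →ₗ.[ℂ] L2Section F) : Prop :=
  ∀ ψ : ∀ q, F q, (∀ q, SmoothSectionAt ψ q) → (∃ K, IsCompact K ∧ ∀ q ∉ K, ψ q = 0) →
    ∃ (h₁ : ψ ∈ sqIntSections F) (h₂ : hamSection ħ m V nab ψ ∈ sqIntSections F),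
      (toL2 ψ h₁, toL2 (hamSection ħ m V nab ψ) h₂) ∈ H.graph

open Classical in
/-- `(Uψ)(x_1, …, x_N) = (N!)^{-1/2} Î_{(x_1, …, x_N)} ψ({x_1, …, x_N})`, extended by `0` to the
collision configurations. -/
def liftSection (I : ∀ x : OrdConf N d, F (proj x) ≃ₗᵢ[ℂ] ℂ) (ψ : ∀ q, F q)
    (x : OrdSpace N d) : ℂ :=
  if h : x ∈ OrdConf N d then
    ((1 / Real.sqrt N.factorial : ℝ) : ℂ) * I ⟨x, h⟩ (ψ (proj ⟨x, h⟩))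
  else 0

end Bundle

/-! ### Anti-symmetric functions -/

/-- `Anti L²(ℝ^{Nd})`, the anti-symmetric functions in `L²(ℝ^{Nd})`. -/
def antiL2 (N d : ℕ) : Submodule ℂ (Lp ℂ 2 (volume : Measure (OrdSpace N d))) where
  carrier := {f | ∀ σ : Equiv.Perm (Fin N), (fun x => f (permute σ x)) =ᵐ[volume]
    fun x => ((Equiv.Perm.sign σ : ℤ) : ℂ) * f x}
  zero_mem' σ := by
    have h := Lp.coeFn_zero ℂ 2 (volume : Measure (OrdSpace N d))
    filter_upwards [h, (permute σ).measurePreserving.quasiMeasurePreserving.ae h] with x h1 h2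
    simp [h1, h2]
  add_mem' {f g} hf hg σ := by
    have h := Lp.coeFn_add f g
    filter_upwards [h, (permute σ).measurePreserving.quasiMeasurePreserving.ae h, hf σ, hg σ]
      with x h1 h2 h3 h4
    rw [h2, h1, Pi.add_apply, Pi.add_apply, h3, h4, mul_add]
  smul_mem' c f hf σ := by
    have h := Lp.coeFn_smul c f
    filter_upwards [h, (permute σ).measurePreserving.quasiMeasurePreserving.ae h, hf σ]
      with x h1 h2 h3
    rw [h2, h1, Pi.smul_apply, Pi.smul_apply, h3, smul_eq_mul, smul_eq_mul]
    ring

lemma mem_antiL2_iff (f : Lp ℂ 2 (volume : Measure (OrdSpace N d))) :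
    f ∈ antiL2 N d ↔ ∀ σ : Equiv.Perm (Fin N),
      Lp.compMeasurePreservingₗᵢ ℂ (permute σ) (permute σ).measurePreserving f =
        ((Equiv.Perm.sign σ : ℤ) : ℂ) • f := by
  refine forall_congr' fun σ => ?_
  have h1 := Lp.coeFn_compMeasurePreserving f (permute (d := d) σ).measurePreserving
  have h2 := Lp.coeFn_smul (((Equiv.Perm.sign σ : ℤ) : ℂ)) f
  constructor
  · intro h
    exact Lp.ext (h1.trans (h.trans h2.symm))
  · intro h
    have h3 : Lp.compMeasurePreserving (permute σ) (permute σ).measurePreserving f =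
        ((Equiv.Perm.sign σ : ℤ) : ℂ) • f := h
    rw [h3] at h1
    exact h1.symm.trans h2

instance : CompleteSpace (antiL2 N d) := by
  have : IsClosed (antiL2 N d : Set (Lp ℂ 2 (volume : Measure (OrdSpace N d)))) := by
    have h : (antiL2 N d : Set (Lp ℂ 2 (volume : Measure (OrdSpace N d)))) =
        ⋂ σ : Equiv.Perm (Fin N), {f |
          Lp.compMeasurePreservingₗᵢ ℂ (permute σ) (permute σ).measurePreserving f =
          ((Equiv.Perm.sign σ : ℤ) : ℂ) • f} := by
      ext f
      simpa using mem_antiL2_iff f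
    rw [h]
    exact isClosed_iInter fun σ =>
      isClosed_eq (LinearIsometry.continuous _) (continuous_const_smul _)
  exact this.completeSpace_coe

/-- `-(ħ²/2m) Δφ + V φ` for a function `φ` on `ℝ^{Nd}`. -/
def hamFun (ħ m : ℝ) (V : OrdSpace N d → ℝ) (φ : OrdSpace N d → ℂ) (x : OrdSpace N d) : ℂ :=
  -(ħ ^ 2 / (2 * m)) • Laplacian.laplacian φ x + V x • φ x

/-- The operator `H` in `Anti L²(ℝ^{Nd})` extends `-(ħ²/2m) Δ + V` on `Anti C_0^∞(ℝ^{Nd})`. -/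
def ExtendsAntiHam (ħ m : ℝ) (V : OrdSpace N d → ℝ) (H : antiL2 N d →ₗ.[ℂ] antiL2 N d) : Prop :=
  ∀ φ : OrdSpace N d → ℂ, ContDiff ℝ ∞ φ → HasCompactSupport φ →
    (∀ (σ : Equiv.Perm (Fin N)) (x : OrdSpace N d),
      φ (permute σ x) = ((Equiv.Perm.sign σ : ℤ) : ℂ) * φ x) →
    ∃ f g : antiL2 N d, f.1 =ᵐ[volume] φ ∧ g.1 =ᵐ[volume] hamFun ħ m V φ ∧ (f, g) ∈ H.graph

/-! ### Time evolution -/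

/-- `T(t) = e^{-iHt/ħ}`: the strongly continuous one-parameter unitary group with generator
`-iH/ħ`. That is, `ψ ∈ 𝒟(H)` and `Hψ = φ` if and only if `T(t)ψ` is differentiable at `t = 0` with
derivative `-(i/ħ)φ`. -/
structure IsTimeEvolution {E : Type*} [NormedAddCommGroup E] [InnerProductSpace ℂ E]
    (ħ : ℝ) (H : E →ₗ.[ℂ] E) (T : ℝ → (E ≃ₗᵢ[ℂ] E)) : Prop where
  map_zero : ∀ ψ, T 0 ψ = ψ
  map_add : ∀ s t ψ, T (s + t) ψ = T s (T t ψ)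
  continuous : ∀ ψ, Continuous fun t => T t ψ
  generator : ∀ ψ φ, (ψ, φ) ∈ H.graph ↔
    HasDerivAt (fun t => T t ψ) (-(Complex.I / ħ) • φ) 0

end Fermion

end

/-!
The connection of the fermionic line bundle becomes the flat one after lifting to the ordered
configurations. Through the trivialization `Î`, a section `ψ` of `F` turns into the function
`x ↦ Î_x ψ(π(x))` (`pull`), and since `Î` is carried along by parallel transport, `∇` turns into the
ordinary differential (`hasFDerivAt_pull`). The proof of this compares with a local frame `s`: the
connection form `ω` of `s` is continuous, `exp(-∫ω) s` is parallel along segments, hence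
`Î s` is a constant times the exponential of `∫ω` along segments (`pull_frame_segment`), which has
the right derivative at the base point of the segments; other sections are treated through their
inner product with `s`. Iterating, lifts of smooth sections are smooth (`contDiffAt_pull`) and the
lift of `Δψ` is the Laplacian of the lift (`laplacian_pull`).

For `d ≥ 2` the ordered configurations are path connected (`exists_smooth_path`), so `x` and its
reordering `σx` are joined by a path. Its projection is a loop with permutation `σ`; transport of
the unit vectors `Î_x⁻¹ 1` along it is trivial for `Î` and is multiplication by the sign of `σ` in
`F`. Hence lifts are exactly the anti-symmetric functions (`pull_permute`, `exists_liftSection_eq`).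
As `π` has `N!` sheets, the factor `1/√N!` makes the lift isometric (`eLpNorm_liftSection`), and
`U` is unitary (`exists_unitary`).

The operator `-(ħ²/2m) Δ + V` on `Anti C_0^∞(ℝ^{Nd})` is essentially self-adjoint
(`exists_antiHam`): it is symmetric, and so is its adjoint, because elements of the domain of the
adjoint have a weak Laplacian in `L²` (test functions may be anti-symmetrized first), which on the
Fourier side is multiplication by a real function (`IsWeakLaplacian.fourier_eq`).

Since `U` maps `C_0^∞(F)` into `Anti C_0^∞` and intertwines the differential expressions,
`H_F = U⁻¹ H_Anti U` is a self-adjoint extension (`extendsSectionHam_conjOp`). The unitary groups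
come from Stone's theorem (`existsUnique_isTimeEvolution`), proved by Yosida approximation, and
conjugation by `U` carries one group into the other (`IsTimeEvolution.conj`).
-/

noncomputable section

namespace Fermion

/-! ### Self-adjoint operators and their graphs -/

section SelfAdjoint

variable {E : Type*} [NormedAddCommGroup E] [InnerProductSpace ℂ E]

/-- The operator `U⁻¹ H U` with domain `U⁻¹ 𝒟(H)`. -/
def conjOp {E' : Type*} [NormedAddCommGroup E'] [InnerProductSpace ℂ E'] (U : E' ≃ₗᵢ[ℂ] E)
    (H : E →ₗ.[ℂ] E) : E' →ₗ.[ℂ] E' where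
  domain := H.domain.comap U.toLinearEquiv.toLinearMap
  toFun := U.symm.toLinearEquiv.toLinearMap ∘ₗ H.toFun ∘ₗ
    U.toLinearEquiv.toLinearMap.restrict (fun _ h => h)

theorem mem_graph_conjOp {E' : Type*} [NormedAddCommGroup E'] [InnerProductSpace ℂ E']
    (U : E' ≃ₗᵢ[ℂ] E) (H : E →ₗ.[ℂ] E) (x y : E') :
    (x, y) ∈ (conjOp U H).graph ↔ (U x, U y) ∈ H.graph := by
  simp only [LinearPMap.mem_graph_iff]
  constructor
  · rintro ⟨⟨z, hz⟩, h1, h2⟩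
    subst h1
    refine ⟨⟨U z, hz⟩, rfl, ?_⟩
    rw [← h2]
    exact (U.apply_symm_apply _).symm
  · rintro ⟨⟨z, hz⟩, h1, h2⟩
    dsimp only at h1 h2
    subst h1
    refine ⟨⟨x, hz⟩, rfl, ?_⟩
    apply U.injective
    rw [← h2]
    exact U.apply_symm_apply _

variable [CompleteSpace E]

/-- A densely defined operator is self-adjoint if and only if its graph is its own adjoint
relation. -/
theorem isSelfAdjoint_iff_graph {H : E →ₗ.[ℂ] E} (hd : Dense (H.domain : Set E)) :
    IsSelfAdjoint H ↔ ∀ x y, (x, y) ∈ H.graph ↔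
      ∀ a b, (a, b) ∈ H.graph → inner ℂ b x = inner ℂ a y := by
  have key : ∀ x y, (x, y) ∈ H.adjoint.graph ↔
      ∀ a b, (a, b) ∈ H.graph → inner ℂ b x = inner ℂ a y := by
    intro x y
    rw [LinearPMap.adjoint_graph_eq_graph_adjoint hd, Submodule.mem_adjoint_iff]
    simp only [sub_eq_zero]
  rw [LinearPMap.isSelfAdjoint_def]
  constructor
  · intro h x y
    rw [← key, h]
  · intro h
    refine LinearPMap.eq_of_eq_graph ?_
    ext ⟨x, y⟩
    rw [key, h]

theorem mem_graph_iff_of_isSelfAdjoint {H : E →ₗ.[ℂ] E} (hH : IsSelfAdjoint H) (x y : E) :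
    (x, y) ∈ H.graph ↔ ∀ a b, (a, b) ∈ H.graph → inner ℂ b x = inner ℂ a y :=
  (isSelfAdjoint_iff_graph hH.dense_domain).1 hH x y

/-- If the adjoint relation of a densely defined symmetric relation `G` is symmetric, it is the
graph of a self-adjoint operator, and this is the only self-adjoint operator extending `G`. -/
theorem exists_unique_selfAdjoint_extension (G : Submodule ℂ (E × E))
    (hd : Dense (G.map (LinearMap.fst ℂ E E) : Set E))
    (hs : ∀ x y a b, (x, y) ∈ G → (a, b) ∈ G → inner ℂ b x = inner ℂ a y)
    (hs' : ∀ x y a b, (x, y) ∈ G.adjoint → (a, b) ∈ G.adjoint → inner ℂ b x = inner ℂ a y) :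
    ∃ H : E →ₗ.[ℂ] E, IsSelfAdjoint H ∧ G ≤ H.graph ∧
      ∀ H' : E →ₗ.[ℂ] E, IsSelfAdjoint H' → G ≤ H'.graph → H' = H := by
  have hmem : ∀ x y, (x, y) ∈ G.adjoint ↔ ∀ a b, (a, b) ∈ G → inner ℂ b x = inner ℂ a y := by
    intro x y
    rw [Submodule.mem_adjoint_iff]
    simp only [sub_eq_zero]
  have hle : G ≤ G.adjoint := by
    rintro ⟨x, y⟩ hxy
    exact (hmem x y).2 fun a b hab => hs x y a b hxy hab
  have hgr : G.adjoint.toLinearPMap.graph = G.adjoint := by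
    refine Submodule.toLinearPMap_graph_eq _ ?_
    rintro ⟨x, y⟩ hxy (rfl : x = 0)
    refine hd.eq_zero_of_inner_right ℂ ?_
    rintro a ⟨⟨a, b⟩, hab, rfl⟩
    have := (hmem 0 y).1 hxy a b hab
    rw [inner_zero_right] at this
    exact this.symm
  have hdom : Dense (G.adjoint.toLinearPMap.domain : Set E) := by
    rw [Submodule.toLinearPMap_domain]
    exact hd.mono (Submodule.map_mono hle)
  have hsa : IsSelfAdjoint G.adjoint.toLinearPMap := by
    rw [isSelfAdjoint_iff_graph hdom, hgr]
    refine fun x y => ⟨fun h a b hab => hs' x y a b h hab, fun h => ?_⟩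
    exact (hmem x y).2 fun a b hab => h a b (hle hab)
  refine ⟨G.adjoint.toLinearPMap, hsa, by rwa [hgr], fun H' hH' hG => ?_⟩
  have h1 : H'.graph ≤ G.adjoint := by
    rintro ⟨x, y⟩ hxy
    exact (hmem x y).2 fun a b hab => (mem_graph_iff_of_isSelfAdjoint hH' x y).1 hxy a b (hG hab)
  refine LinearPMap.eq_of_eq_graph (le_antisymm (h1.trans_eq hgr.symm) ?_)
  rw [hgr]
  rintro ⟨x, y⟩ hxy
  exact (mem_graph_iff_of_isSelfAdjoint hH' x y).2 fun a b hab => hs' x y a b hxy (h1 hab)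

theorem isSelfAdjoint_conjOp {E' : Type*} [NormedAddCommGroup E'] [InnerProductSpace ℂ E']
    [CompleteSpace E'] (U : E' ≃ₗᵢ[ℂ] E) {H : E →ₗ.[ℂ] E} (hH : IsSelfAdjoint H) :
    IsSelfAdjoint (conjOp U H) := by
  have hd : Dense ((conjOp U H).domain : Set E') :=
    hH.dense_domain.preimage U.toHomeomorph.isOpenMap
  rw [isSelfAdjoint_iff_graph hd]
  intro x y
  simp only [mem_graph_conjOp]
  rw [mem_graph_iff_of_isSelfAdjoint hH]
  constructor
  · intro h a b hab
    simpa using h _ _ hab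
  · intro h a b hab
    simpa [← U.inner_map_map] using h (U.symm a) (U.symm b) (by simpa using hab)

end SelfAdjoint

/-! ### Stone's theorem -/

section Stone

open Complex Filter

variable {E : Type*} [NormedAddCommGroup E] [InnerProductSpace ℂ E] [CompleteSpace E]

/-- Since the graph of `H` is closed, `E × E` is the orthogonal sum of the graph of `n⁻¹ H` and its
rotated copy. The decomposition of `(u, 0)` solves `(1 + H²/n²) x = u`. -/
theorem exists_yosida {H : E →ₗ.[ℂ] E} (hH : IsSelfAdjoint H) {n : ℝ} (hn : 0 < n) (u : E) :
    ∃ x v, (x, v) ∈ H.graph ∧ (v, ((n ^ 2 : ℝ) : ℂ) • (u - x)) ∈ H.graph := by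
  let L : WithLp 2 (E × E) →L[ℂ] E × E :=
    ((ContinuousLinearMap.id ℂ E).prodMap ((n : ℂ) • ContinuousLinearMap.id ℂ E)).comp
      (WithLp.prodContinuousLinearEquiv 2 ℂ E E).toContinuousLinearMap
  let K : Submodule ℂ (WithLp 2 (E × E)) := H.graph.comap L.toLinearMap
  have hL : ∀ p, L p = (p.fst, (n : ℂ) • p.snd) := fun p => rfl
  have hK : ∀ p, p ∈ K ↔ (p.fst, (n : ℂ) • p.snd) ∈ H.graph := fun p => Iff.rfl
  have hcl : IsClosed (K : Set (WithLp 2 (E × E))) := hH.isClosed.preimage L.continuous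
  have : CompleteSpace K := hcl.completeSpace_coe
  have hn0 : (n : ℂ) ≠ 0 := by exact_mod_cast hn.ne'
  obtain ⟨p, hp, q, hq, hpq⟩ :=
    Submodule.exists_add_mem_mem_orthogonal (K := K) (WithLp.toLp 2 (u, (0 : E)))
  have h1 : u = p.fst + q.fst := congrArg WithLp.fst hpq
  have h2 : 0 = p.snd + q.snd := congrArg WithLp.snd hpq
  have hp' := (hK p).1 hp
  refine ⟨p.fst, (n : ℂ) • p.snd, hp', ?_⟩
  rw [mem_graph_iff_of_isSelfAdjoint hH]
  intro a b hab
  have h3 : (WithLp.toLp 2 (a, (n : ℂ)⁻¹ • b) : WithLp 2 (E × E)) ∈ K := by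
    rw [hK]
    simpa [smul_smul, hn0] using hab
  have h4 := (Submodule.mem_orthogonal K q).1 hq _ h3
  rw [WithLp.prod_inner_apply] at h4
  have h5 : q.snd = -p.snd := (neg_eq_of_add_eq_zero_right h2.symm).symm
  have h6 : q.fst = u - p.fst := by rw [h1]; abel
  simp only [WithLp.ofLp_fst, WithLp.ofLp_snd, h5, h6, inner_smul_left, inner_neg_right] at h4
  simp only [map_inv₀, conj_ofReal] at h4
  rw [inner_smul_right, inner_smul_right]
  field_simp at h4
  push_cast
  linear_combination (-(n : ℂ)) * h4

/-- Symmetry of a self-adjoint operator, in terms of its graph. -/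
theorem inner_graph {H : E →ₗ.[ℂ] E} (hH : IsSelfAdjoint H) {x y a b : E}
    (h : (x, y) ∈ H.graph) (h' : (a, b) ∈ H.graph) : inner ℂ b x = inner ℂ a y :=
  (mem_graph_iff_of_isSelfAdjoint hH x y).1 h a b h'

/-- If `(1 + H²/n²) x = u` and `v = H x`, pairing with `x` gives `|x|² + |v|²/n² = Re ⟨x, u⟩`. -/
theorem yosida_identity {H : E →ₗ.[ℂ] E} (hH : IsSelfAdjoint H) {n : ℝ} {u x v : E}
    (h1 : (x, v) ∈ H.graph) (h2 : (v, ((n ^ 2 : ℝ) : ℂ) • (u - x)) ∈ H.graph) :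
    ‖v‖ ^ 2 = n ^ 2 * ((inner ℂ x u : ℂ).re - ‖x‖ ^ 2) := by
  have h := inner_graph hH h2 h1
  rw [inner_smul_right, inner_sub_right, inner_self_eq_norm_sq_to_K,
    inner_self_eq_norm_sq_to_K] at h
  have h' := congrArg Complex.re h
  rw [Complex.re_ofReal_mul, Complex.sub_re] at h'
  simpa [← Complex.ofReal_pow] using h'

theorem yosida_bound {H : E →ₗ.[ℂ] E} (hH : IsSelfAdjoint H) {n : ℝ} (hn : 0 < n) {u x v : E}
    (h1 : (x, v) ∈ H.graph) (h2 : (v, ((n ^ 2 : ℝ) : ℂ) • (u - x)) ∈ H.graph) :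
    ‖x‖ ≤ ‖u‖ ∧ ‖v‖ ≤ n * ‖u‖ := by
  have h := yosida_identity hH h1 h2
  have h3 : (inner ℂ x u : ℂ).re ≤ ‖x‖ * ‖u‖ := (re_le_norm _).trans (norm_inner_le_norm x u)
  have h4 : 0 ≤ (inner ℂ x u : ℂ).re - ‖x‖ ^ 2 := by
    have : 0 ≤ n ^ 2 * ((inner ℂ x u : ℂ).re - ‖x‖ ^ 2) := h ▸ sq_nonneg _
    exact (mul_nonneg_iff_of_pos_left (by positivity)).1 this
  have hx : ‖x‖ ≤ ‖u‖ := by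
    rcases (norm_nonneg x).eq_or_lt with h0 | h0
    · rw [← h0]; exact norm_nonneg u
    · nlinarith
  refine ⟨hx, ?_⟩
  refine abs_le_of_sq_le_sq' ?_ (by positivity) |>.2
  rw [h, mul_pow]
  gcongr
  nlinarith [norm_nonneg x, norm_nonneg u, sq_nonneg ‖x‖]

/-- The Yosida approximation `H (1 + H²/n²)⁻¹` of a self-adjoint operator, together with
`(1 + H²/n²)⁻¹`, as bounded operators. -/
theorem exists_yosida_clm {H : E →ₗ.[ℂ] E} (hH : IsSelfAdjoint H) {n : ℝ} (hn : 0 < n) :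
    ∃ J B : E →L[ℂ] E, (∀ u, ‖J u‖ ≤ ‖u‖) ∧ (∀ u, ‖B u‖ ≤ n * ‖u‖) ∧
      (∀ u x v, (J u = x ∧ B u = v) ↔
        ((x, v) ∈ H.graph ∧ (v, ((n ^ 2 : ℝ) : ℂ) • (u - x)) ∈ H.graph)) := by
  choose J B hJ hB using fun u => exists_yosida hH hn u
  have huniq : ∀ u x v, (x, v) ∈ H.graph → (v, ((n ^ 2 : ℝ) : ℂ) • (u - x)) ∈ H.graph →
      J u = x ∧ B u = v := by
    intro u x v h1 h2
    have h3 := H.graph.sub_mem (hJ u) h1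
    have h4 := H.graph.sub_mem (hB u) h2
    rw [Prod.mk_sub_mk] at h3 h4
    have h5 : ((n ^ 2 : ℝ) : ℂ) • (u - J u) - ((n ^ 2 : ℝ) : ℂ) • (u - x)
        = ((n ^ 2 : ℝ) : ℂ) • (0 - (J u - x)) := by module
    rw [h5] at h4
    have h6 := yosida_bound hH hn h3 h4
    simp only [norm_zero, mul_zero, norm_le_zero_iff, sub_eq_zero] at h6
    exact h6
  have hadd : ∀ u w, J (u + w) = J u + J w ∧ B (u + w) = B u + B w := by
    intro u w
    refine huniq _ _ _ (H.graph.add_mem (hJ u) (hJ w)) ?_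
    have := H.graph.add_mem (hB u) (hB w)
    convert this using 1
    rw [Prod.mk_add_mk]
    congr 1
    module
  have hsmul : ∀ (c : ℂ) u, J (c • u) = c • J u ∧ B (c • u) = c • B u := by
    intro c u
    refine huniq _ _ _ (H.graph.smul_mem c (hJ u)) ?_
    have := H.graph.smul_mem c (hB u)
    convert this using 1
    rw [Prod.smul_mk]
    congr 1
    module
  have hb := fun u => yosida_bound hH hn (hJ u) (hB u)
  let J' : E →L[ℂ] E := LinearMap.mkContinuous
    { toFun := J, map_add' := fun u w => (hadd u w).1, map_smul' := fun c u => (hsmul c u).1 } 1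
    fun u => by simpa using (hb u).1
  let B' : E →L[ℂ] E := LinearMap.mkContinuous
    { toFun := B, map_add' := fun u w => (hadd u w).2, map_smul' := fun c u => (hsmul c u).2 } n
    fun u => (hb u).2
  refine ⟨J', B', fun u => (hb u).1, fun u => (hb u).2, fun u x v => ⟨?_, ?_⟩⟩
  · rintro ⟨rfl, rfl⟩
    exact ⟨hJ u, hB u⟩
  · rintro ⟨h1, h2⟩
    exact huniq u x v h1 h2

/-- The properties of the Yosida approximations: they are bounded self-adjoint operators that
commute with each other and converge to `H` on the domain of `H`. -/
theorem exists_yosida_seq {H : E →ₗ.[ℂ] E} (hH : IsSelfAdjoint H) :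
    ∃ B : ℕ → E →L[ℂ] E, (∀ n, IsSelfAdjoint (B n)) ∧ (∀ n m, Commute (B n) (B m)) ∧
      ∀ x y, (x, y) ∈ H.graph → Tendsto (fun n => B n x) atTop (𝓝 y) := by
  have hpos : ∀ n : ℕ, (0 : ℝ) < n + 1 := fun n => by positivity
  choose J B hJ hB h using fun n : ℕ => exists_yosida_clm hH (hpos n)
  have hg : ∀ n u, (J n u, B n u) ∈ H.graph ∧
      (B n u, (((n + 1 : ℝ) ^ 2 : ℝ) : ℂ) • (u - J n u)) ∈ H.graph :=
    fun n u => (h n u _ _).1 ⟨rfl, rfl⟩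
  -- `H` commutes with its Yosida approximations
  have hc : ∀ n x y, (x, y) ∈ H.graph → J n y = B n x ∧
      B n y = (((n + 1 : ℝ) ^ 2 : ℝ) : ℂ) • (x - J n x) := by
    intro n x y hxy
    refine (h n y _ _).2 ⟨(hg n x).2, ?_⟩
    have := H.graph.smul_mem (((n + 1 : ℝ) ^ 2 : ℝ) : ℂ) (H.graph.sub_mem hxy (hg n x).1)
    simpa using this
  refine ⟨B, fun n => ?_, fun n m => ?_, fun x y hxy => ?_⟩
  · rw [ContinuousLinearMap.isSelfAdjoint_iff_isSymmetric]
    intro u w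
    simp only [ContinuousLinearMap.coe_coe]
    have hn0 : (((n + 1 : ℝ) ^ 2 : ℝ) : ℂ) ≠ 0 := by exact_mod_cast (by positivity)
    have e : ∀ u, u = J n u + ((((n + 1 : ℝ) ^ 2 : ℝ) : ℂ))⁻¹ •
        ((((n + 1 : ℝ) ^ 2 : ℝ) : ℂ) • (u - J n u)) := by
      intro u
      rw [smul_smul, inv_mul_cancel₀ hn0, one_smul]
      abel
    have h1 := inner_graph hH (hg n w).1 (hg n u).1
    have h2 := inner_graph hH (hg n w).2 (hg n u).2
    conv_lhs => rw [e w]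
    conv_rhs => rw [e u]
    rw [inner_add_right, inner_add_left, h1, inner_smul_left, inner_smul_right, h2, map_inv₀,
      conj_ofReal]
  · ext u
    have h1 := hc n _ _ (hg m u).1
    have h2 := hc n _ _ (hg m u).2
    have h3 : J m (B n u) = B n (J m u) ∧ B m (B n u) = B n (B m u) := by
      refine (h m _ _ _).2 ⟨?_, ?_⟩
      · have h4 := hg n (B m u)
        rw [h1.1] at h4
        exact h4.1
      · have h4 := hg n ((((m + 1 : ℝ) ^ 2 : ℝ) : ℂ) • (u - J m u))
        rw [h2.1] at h4
        simpa using h4.1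
    exact h3.2.symm
  · -- on the domain, `(1 - J) x = n⁻² H B x` is small; density and `‖J‖ ≤ 1` do the rest
    have hJ1 : ∀ z ∈ H.domain, Tendsto (fun n => J n z) atTop (𝓝 z) := by
      intro z hz
      obtain ⟨w, hw⟩ := LinearPMap.mem_domain_iff.1 hz
      have hb : ∀ n : ℕ, ‖J n z - z‖ ≤ ‖w‖ * (1 / ((n : ℝ) + 1)) := by
        intro n
        have h1 := hB n w
        rw [(hc n z w hw).2, norm_smul, norm_sub_rev, Complex.norm_real, Real.norm_eq_abs,
          abs_of_pos (by positivity)] at h1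
        have := hpos n
        rw [mul_one_div, le_div_iff₀ this]
        nlinarith
      rw [tendsto_iff_norm_sub_tendsto_zero]
      refine squeeze_zero (fun n => norm_nonneg _) hb ?_
      simpa using tendsto_one_div_add_atTop_nhds_zero_nat.const_mul ‖w‖
    have hJ2 : Tendsto (fun n => J n y) atTop (𝓝 y) := by
      rw [Metric.tendsto_atTop]
      intro ε hε
      obtain ⟨z, hz, hyz⟩ := Metric.dense_iff.1 hH.dense_domain y (ε / 3) (by positivity)
      rw [Metric.mem_ball, dist_eq_norm] at hz
      obtain ⟨M, hM⟩ := Metric.tendsto_atTop.1 (hJ1 z hyz) (ε / 3) (by positivity)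
      refine ⟨M, fun n hn => ?_⟩
      have h1 := hM n hn
      rw [dist_eq_norm] at h1 ⊢
      have h2 : ‖J n (y - z)‖ ≤ ‖z - y‖ := (hJ n _).trans_eq (norm_sub_rev _ _)
      have h3 : J n y - y = J n (y - z) + (J n z - z) + (z - y) := by
        rw [map_sub]; abel
      rw [h3]
      refine (norm_add₃_le).trans_lt ?_
      linarith
    refine hJ2.congr fun n => (hc n x y hxy).1

end Stone

section Stone

open Complex Filter NormedSpace

variable {E : Type*} [NormedAddCommGroup E] [InnerProductSpace ℂ E] [CompleteSpace E]

/-- The unitary group `e^{-itB}` of a bounded operator. -/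
def expGroup (B : E →L[ℂ] E) (t : ℝ) : E →L[ℂ] E := exp (t • (-I • B))

theorem expGroup_zero (B : E →L[ℂ] E) : expGroup B 0 = 1 := by simp [expGroup]

theorem expGroup_add (B : E →L[ℂ] E) (s t : ℝ) :
    expGroup B (s + t) = expGroup B s * expGroup B t := by
  let +nondep : NormedAlgebra ℚ (E →L[ℂ] E) := .restrictScalars ℚ ℂ (E →L[ℂ] E)
  rw [expGroup, add_smul, exp_add_of_commute]
  · rfl
  · exact ((Commute.refl (-I • B)).smul_left s).smul_right t

theorem norm_expGroup {B : E →L[ℂ] E} (hB : IsSelfAdjoint B) (t : ℝ) (x : E) :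
    ‖expGroup B t x‖ = ‖x‖ := by
  let +nondep : NormedAlgebra ℚ (E →L[ℂ] E) := .restrictScalars ℚ ℂ (E →L[ℂ] E)
  have h : t • (-I • B) ∈ skewAdjoint (E →L[ℂ] E) := by
    rw [skewAdjoint.mem_iff, star_smul, star_smul, hB.star_eq]
    simp
  have hu : expGroup B t ∈ unitary (E →L[ℂ] E) := exp_mem_unitary_of_mem_skewAdjoint h
  have h1 : star (expGroup B t) * expGroup B t = 1 := (Unitary.mem_iff.1 hu).1
  have h2 : ‖expGroup B t x‖ ^ 2 = ‖x‖ ^ 2 := by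
    have := ContinuousLinearMap.apply_norm_sq_eq_inner_adjoint_left (expGroup B t) x
    rw [← ContinuousLinearMap.star_eq_adjoint] at this
    change _ = RCLike.re (inner ℂ ((star (expGroup B t) * expGroup B t) x) x) at this
    rw [this, h1]
    exact (norm_sq_eq_re_inner (𝕜 := ℂ) x).symm
  exact (pow_left_inj₀ (norm_nonneg _) (norm_nonneg _) two_ne_zero).1 h2

theorem hasDerivAt_expGroup (B : E →L[ℂ] E) (t : ℝ) (x : E) :
    HasDerivAt (fun s => expGroup B s x) (-I • expGroup B t (B x)) t := by
  have h := ((ContinuousLinearMap.apply ℂ E x).restrictScalars ℝ).hasFDerivAt.comp_hasDerivAt t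
    (hasDerivAt_exp_smul_const (𝕂 := ℝ) (-I • B) t)
  refine h.congr_deriv ?_
  simp [expGroup]

theorem norm_expGroup_sub_le {B : E →L[ℂ] E} (hB : IsSelfAdjoint B) (t : ℝ) (x : E) :
    ‖expGroup B t x - x‖ ≤ |t| * ‖B x‖ := by
  have h := Convex.norm_image_sub_le_of_norm_hasDerivWithin_le (s := Set.univ)
    (f := fun s => expGroup B s x) (C := ‖B x‖) (x := 0) (y := t)
    (fun s _ => (hasDerivAt_expGroup B s x).hasDerivWithinAt)
    (fun s _ => by simp [norm_smul, norm_expGroup hB]) convex_univ trivial trivial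
  simpa [expGroup_zero, mul_comm] using h

/-- As `B` and `C` commute, `e^{-itB} = e^{-itC} e^{-it(B - C)}`. This makes the unitary groups of
the Yosida approximations a Cauchy sequence on the domain of `H`. -/
theorem norm_expGroup_sub_expGroup_le {B C : E →L[ℂ] E} (hB : IsSelfAdjoint B)
    (hC : IsSelfAdjoint C) (h : Commute B C) (t : ℝ) (x : E) :
    ‖expGroup B t x - expGroup C t x‖ ≤ |t| * ‖B x - C x‖ := by
  let +nondep : NormedAlgebra ℚ (E →L[ℂ] E) := .restrictScalars ℚ ℂ (E →L[ℂ] E)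
  have h1 : expGroup B t = expGroup C t * expGroup (B - C) t := by
    rw [expGroup, expGroup, expGroup, ← exp_add_of_commute]
    · congr 1
      module
    · have : Commute C (B - C) := h.symm.sub_right (Commute.refl C)
      exact (((this.smul_left (-I)).smul_left t).smul_right (-I)).smul_right t
  rw [h1, mul_apply_eq_comp, ← map_sub, norm_expGroup hC]
  exact norm_expGroup_sub_le (hB.sub hC) t x

/-- Second order Taylor estimate for `e^{-itB}`. -/
theorem norm_expGroup_sub_taylor_le {B : E →L[ℂ] E} (hB : IsSelfAdjoint B) (t : ℝ) (x z : E) :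
    ‖expGroup B t x - x + t • (I • B x)‖ ≤ |t| * (|t| * ‖B z‖ + 2 * ‖B x - z‖) := by
  have hd : ∀ s : ℝ, HasDerivAt (fun s => expGroup B s x - x + s • (I • B x))
      (-I • expGroup B s (B x) + (1 : ℝ) • (I • B x)) s := fun s =>
    ((hasDerivAt_expGroup B s x).sub_const x).add ((hasDerivAt_id s).smul_const _)
  have h := Convex.norm_image_sub_le_of_norm_hasDerivWithin_le (s := Set.uIcc 0 t)
    (C := |t| * ‖B z‖ + 2 * ‖B x - z‖) (x := 0) (y := t)
    (fun s _ => (hd s).hasDerivWithinAt) (fun s hs => ?_) (convex_uIcc 0 t)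
    Set.left_mem_uIcc Set.right_mem_uIcc
  · simpa [expGroup_zero, mul_comm] using h
  · have hst : |s| ≤ |t| := by simpa using Set.abs_sub_left_of_mem_uIcc hs
    have e : -I • expGroup B s (B x) + (1 : ℝ) • (I • B x) =
        -I • (expGroup B s (B x - z) + (expGroup B s z - z) - (B x - z)) := by
      rw [map_sub]
      module
    rw [e, norm_smul, norm_neg, norm_I, one_mul]
    refine (norm_sub_le _ _).trans ?_
    have h1 := norm_add_le (expGroup B s (B x - z)) (expGroup B s z - z)
    rw [norm_expGroup hB] at h1
    have h2 := norm_expGroup_sub_le hB s z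
    have h3 : |s| * ‖B z‖ ≤ |t| * ‖B z‖ := by gcongr
    linarith

/-- Existence part of Stone's theorem: the unitary groups of the Yosida approximations of `H`
converge strongly to a unitary group with generator `-iH`. -/
theorem exists_unitaryGroup {H : E →ₗ.[ℂ] E} (hH : IsSelfAdjoint H) :
    ∃ U : ℝ → (E →ₗ[ℂ] E), (∀ t x, ‖U t x‖ = ‖x‖) ∧ (∀ x, U 0 x = x) ∧
      (∀ s t x, U (s + t) x = U s (U t x)) ∧ (∀ x, Continuous fun t => U t x) ∧
      ∀ x y, (x, y) ∈ H.graph → HasDerivAt (fun t => U t x) (-I • y) 0 := by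
  obtain ⟨B, hB, hcomm, hlim⟩ := exists_yosida_seq hH
  have hdense : ∀ (x : E) {ε : ℝ}, 0 < ε → ∃ z w, (z, w) ∈ H.graph ∧ ‖z - x‖ < ε := by
    intro x ε hε
    obtain ⟨z, hz, hyz⟩ := Metric.dense_iff.1 hH.dense_domain x ε hε
    obtain ⟨w, hw⟩ := LinearPMap.mem_domain_iff.1 hyz
    exact ⟨z, w, hw, by rwa [Metric.mem_ball, dist_eq_norm] at hz⟩
  have hcau : ∀ t x, ∃ y, Tendsto (fun n => expGroup (B n) t x) atTop (𝓝 y) := by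
    intro t x
    refine cauchySeq_tendsto_of_complete (Metric.cauchySeq_iff.2 fun ε hε => ?_)
    obtain ⟨z, w, hzw, hzx⟩ := hdense x (ε := ε / 3) (by positivity)
    have hc := (hlim z w hzw).cauchySeq
    obtain ⟨M, hM⟩ := Metric.cauchySeq_iff.1 hc (ε / (3 * (|t| + 1))) (by positivity)
    refine ⟨M, fun n hn m hm => ?_⟩
    have h1 := hM n hn m hm
    rw [dist_eq_norm] at h1 ⊢
    have h2 := norm_expGroup_sub_expGroup_le (hB n) (hB m) (hcomm n m) t z
    have h3 : expGroup (B n) t x - expGroup (B m) t x =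
        -expGroup (B n) t (z - x) + (expGroup (B n) t z - expGroup (B m) t z) +
          expGroup (B m) t (z - x) := by
      rw [map_sub, map_sub]
      abel
    rw [h3]
    refine norm_add₃_le.trans_lt ?_
    rw [norm_neg, norm_expGroup (hB n), norm_expGroup (hB m)]
    have h4 : |t| * ‖B n z - B m z‖ ≤ ε / 3 := by
      calc |t| * ‖B n z - B m z‖ ≤ (|t| + 1) * (ε / (3 * (|t| + 1))) := by gcongr; linarith
        _ = ε / 3 := by field_simp
    linarith
  choose V hV using hcau
  have hnorm : ∀ t x, ‖V t x‖ = ‖x‖ := fun t x =>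
    tendsto_nhds_unique (hV t x).norm (by simp [norm_expGroup (hB _)])
  let U : ℝ → (E →ₗ[ℂ] E) := fun t =>
    { toFun := V t
      map_add' := fun x y => tendsto_nhds_unique (hV t (x + y))
        (by simpa using (hV t x).add (hV t y))
      map_smul' := fun c x => tendsto_nhds_unique (hV t (c • x))
        (by simpa using (hV t x).const_smul c) }
  have hUV : ∀ t x, U t x = V t x := fun t x => rfl
  have hU : ∀ t x, ‖U t x‖ = ‖x‖ := hnorm
  have h0 : ∀ x, U 0 x = x := fun x =>
    tendsto_nhds_unique (hV 0 x) (by simp [expGroup_zero])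
  have hadd : ∀ s t x, U (s + t) x = U s (U t x) := by
    intro s t x
    refine tendsto_nhds_unique (hV (s + t) x) ?_
    have h1 : Tendsto (fun n => expGroup (B n) s (expGroup (B n) t x - V t x)) atTop (𝓝 0) := by
      rw [tendsto_zero_iff_norm_tendsto_zero]
      simp only [norm_expGroup (hB _)]
      exact tendsto_iff_norm_sub_tendsto_zero.1 (hV t x)
    have h2 := h1.add (hV s (V t x))
    rw [zero_add] at h2
    refine h2.congr fun n => ?_
    rw [map_sub, expGroup_add, mul_apply_eq_comp]
    abel
  have hle : ∀ t x y, (x, y) ∈ H.graph → ‖U t x - x‖ ≤ |t| * ‖y‖ := by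
    intro t x y hxy
    refine le_of_tendsto_of_tendsto ((hV t x).sub_const x).norm
      ((hlim x y hxy).norm.const_mul |t|) (Eventually.of_forall fun n => ?_)
    exact norm_expGroup_sub_le (hB n) t x
  have hcont0 : ∀ x, Tendsto (fun t => U t x) (𝓝 0) (𝓝 x) := by
    intro x
    rw [Metric.tendsto_nhds_nhds]
    intro ε hε
    obtain ⟨z, w, hzw, hzx⟩ := hdense x (ε := ε / 3) (by positivity)
    refine ⟨ε / (3 * (‖w‖ + 1)), by positivity, fun {t} ht => ?_⟩
    rw [dist_zero_right, Real.norm_eq_abs] at ht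
    have h1 : U t x - x = -U t (z - x) + (U t z - z) + (z - x) := by
      rw [map_sub]; abel
    rw [dist_eq_norm, h1]
    refine norm_add₃_le.trans_lt ?_
    rw [norm_neg, hU]
    have h4 : |t| * ‖w‖ ≤ ε / 3 := by
      calc |t| * ‖w‖ ≤ (ε / (3 * (‖w‖ + 1))) * (‖w‖ + 1) := by gcongr; linarith
        _ = ε / 3 := by field_simp
    linarith [hle t z w hzw]
  refine ⟨U, hU, h0, hadd, fun x => ?_, fun x y hxy => ?_⟩
  · rw [continuous_iff_continuousAt]
    intro t
    have h1 : Tendsto (fun s => U (s - t) x) (𝓝 t) (𝓝 x) :=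
      (hcont0 x).comp (by simpa using (continuous_sub_right t).tendsto t)
    rw [ContinuousAt, tendsto_iff_norm_sub_tendsto_zero]
    rw [tendsto_iff_norm_sub_tendsto_zero] at h1
    refine h1.congr fun s => ?_
    rw [← hU t (U (s - t) x - x), map_sub, ← hadd, add_sub_cancel]
  · rw [hasDerivAt_iff_isLittleO, Asymptotics.isLittleO_iff]
    intro c hc
    obtain ⟨z, w, hzw, hzy⟩ := hdense y (ε := c / 4) (by positivity)
    have hb : ∀ t, ‖U t x - x + t • (I • y)‖ ≤ |t| * (|t| * ‖w‖ + 2 * ‖y - z‖) := by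
      intro t
      refine le_of_tendsto_of_tendsto
        (((hV t x).sub_const x).add (((hlim x y hxy).const_smul I).const_smul t)).norm
        (((((hlim z w hzw).norm).const_mul |t|).add
          ((((hlim x y hxy).sub_const z).norm).const_mul 2)).const_mul |t|)
        (Eventually.of_forall fun n => ?_)
      exact norm_expGroup_sub_taylor_le (hB n) t x z
    have ht : ∀ᶠ t : ℝ in 𝓝 0, |t| < c / (2 * (‖w‖ + 1)) := by
      have := Metric.ball_mem_nhds (0 : ℝ) (show 0 < c / (2 * (‖w‖ + 1)) by positivity)
      filter_upwards [this] with t ht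
      simpa using ht
    filter_upwards [ht] with t ht
    rw [h0, sub_zero]
    have e : U t x - x - t • (-I • y) = U t x - x + t • (I • y) := by module
    rw [e, Real.norm_eq_abs, mul_comm c]
    refine (hb t).trans ?_
    gcongr
    have h4 : |t| * ‖w‖ ≤ c / 2 := by
      calc |t| * ‖w‖ ≤ (c / (2 * (‖w‖ + 1))) * (‖w‖ + 1) := by gcongr; linarith
        _ = c / 2 := by field_simp
    rw [norm_sub_rev] at hzy
    linarith

/-- Existence part of Stone's theorem. -/
theorem exists_isTimeEvolution {ħ : ℝ} (hħ : 0 < ħ) {H : E →ₗ.[ℂ] E} (hH : IsSelfAdjoint H) :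
    ∃ T, IsTimeEvolution ħ H T := by
  obtain ⟨U, hU, h0, hadd, hcont, hderiv⟩ := exists_unitaryGroup hH
  have hinv : ∀ t x, U t (U (-t) x) = x := fun t x => by rw [← hadd, add_neg_cancel, h0]
  let V : ℝ → (E ≃ₗᵢ[ℂ] E) := fun t => LinearIsometryEquiv.ofSurjective ⟨U t, hU t⟩
    fun x => ⟨U (-t) x, hinv t x⟩
  have hV : ∀ t x, V t x = U t x := fun t x => rfl
  have hc : (ħ : ℂ) ≠ 0 := by exact_mod_cast hħ.ne'
  have hd : ∀ x y, (x, y) ∈ H.graph →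
      HasDerivAt (fun t => V (t / ħ) x) (-(I / ħ) • y) 0 := by
    intro x y hxy
    have h1 : HasDerivAt (fun t : ℝ => t / ħ) (1 / ħ) 0 := (hasDerivAt_id (0 : ℝ)).div_const ħ
    have h2 : HasDerivAt (fun t => U t x) (-I • y) (0 / ħ) := by simpa using hderiv x y hxy
    refine (h2.scomp (0 : ℝ) h1).congr_deriv ?_
    rw [← Complex.coe_smul, smul_smul]
    congr 1
    push_cast
    ring
  refine ⟨fun t => V (t / ħ), ⟨fun x => ?_, fun s t x => ?_, fun x => ?_, fun x y => ⟨hd x y, ?_⟩⟩⟩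
  · simp [hV, h0]
  · simp [hV, add_div, hadd]
  · exact (hcont x).comp (continuous_id.div_const ħ)
  · intro hxy
    rw [mem_graph_iff_of_isSelfAdjoint hH]
    intro a b hab
    have h1 : HasDerivAt (fun t => inner ℂ a (V (t / ħ) x)) (inner ℂ a (-(I / ħ) • y)) 0 := by
      simpa using (hasDerivAt_const (0 : ℝ) a).inner ℂ hxy
    have h2 : HasDerivAt (fun t : ℝ => V (-t / ħ) a) (-(-(I / ħ) • b)) 0 := by
      have h3 : HasDerivAt (fun t => V (t / ħ) a) (-(I / ħ) • b) (-0) := by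
        simpa using hd a b hab
      exact (h3.scomp (0 : ℝ) (hasDerivAt_neg (0 : ℝ))).congr_deriv (by simp)
    have h4 : HasDerivAt (fun t : ℝ => inner ℂ (V (-t / ħ) a) x)
        (inner ℂ (-(-(I / ħ) • b)) x) 0 := by
      simpa only [inner_zero_right, zero_add] using h2.inner ℂ (hasDerivAt_const (0 : ℝ) x)
    have h5 : (fun t : ℝ => inner ℂ (V (-t / ħ) a) x) = fun t => inner ℂ a (V (t / ħ) x) := by
      funext t
      rw [← (V (t / ħ)).inner_map_map, hV, hV, neg_div, hinv]
    rw [h5] at h4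
    have h6 := h4.unique h1
    rw [neg_smul, neg_neg, inner_smul_left, inner_smul_right] at h6
    simp only [map_div₀, conj_I, conj_ofReal] at h6
    have h7 : -(I / ħ) ≠ 0 := neg_ne_zero.2 (div_ne_zero I_ne_zero hc)
    refine mul_left_cancel₀ h7 ?_
    rw [← h6, neg_div]

/-- Uniqueness part of Stone's theorem: on the domain, `⟨S(t)x, T(t)x⟩` is constant. -/
theorem IsTimeEvolution.unique {ħ : ℝ} {H : E →ₗ.[ℂ] E} (hH : IsSelfAdjoint H)
    {S T : ℝ → (E ≃ₗᵢ[ℂ] E)} (hS : IsTimeEvolution ħ H S) (hT : IsTimeEvolution ħ H T) :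
    S = T := by
  have key : ∀ {T : ℝ → (E ≃ₗᵢ[ℂ] E)}, IsTimeEvolution ħ H T → ∀ x y, (x, y) ∈ H.graph → ∀ t,
      (T t x, T t y) ∈ H.graph ∧ HasDerivAt (fun s => T s x) (-(I / ħ) • T t y) t := by
    intro T hT x y hxy t
    have h1 := (hT.generator x y).1 hxy
    have h2 : HasDerivAt (fun s => T t (T s x)) (T t (-(I / ħ) • y)) 0 :=
      ((T t).toLinearIsometry.toContinuousLinearMap.restrictScalars ℝ).hasFDerivAt.comp_hasDerivAt
        0 h1
    rw [map_smul] at h2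
    refine ⟨(hT.generator _ _).2 (h2.congr_of_eventuallyEq ?_), ?_⟩
    · refine Eventually.of_forall fun s => ?_
      dsimp only
      rw [← hT.map_add, ← hT.map_add, add_comm]
    · have h3 : HasDerivAt (fun s => T t (T s x)) (-(I / ħ) • T t y) (t - t) := by
        simpa using h2
      have h4 := HasDerivAt.scomp (h := fun s => s - t) t h3 ((hasDerivAt_id t).sub_const t)
      rw [one_smul] at h4
      refine h4.congr_of_eventuallyEq (Eventually.of_forall fun s => ?_)
      simp [← hT.map_add]
  have hdom : ∀ t, ∀ x ∈ H.domain, S t x = T t x := by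
    intro t x hx
    obtain ⟨y, hxy⟩ := LinearPMap.mem_domain_iff.1 hx
    have hd : ∀ t, HasDerivAt (fun s => inner ℂ (S s x) (T s x)) 0 t := by
      intro t
      obtain ⟨h1, h2⟩ := key hS x y hxy t
      obtain ⟨h3, h4⟩ := key hT x y hxy t
      refine (h2.inner ℂ h4).congr_deriv ?_
      rw [inner_smul_left, inner_smul_right, ← inner_graph hH h3 h1]
      simp only [map_neg, map_div₀, conj_I, conj_ofReal]
      ring
    have hc : inner ℂ (S t x) (T t x) = inner ℂ x x := by
      have := is_const_of_deriv_eq_zero (fun t => (hd t).differentiableAt)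
        (fun t => (hd t).deriv) t 0
      simpa [hS.map_zero, hT.map_zero] using this
    have h5 := norm_sub_sq (𝕜 := ℂ) (S t x) (T t x)
    rw [hc, ← norm_sq_eq_re_inner, (S t).norm_map, (T t).norm_map] at h5
    have h6 : ‖S t x - T t x‖ ^ 2 = 0 := by rw [h5]; ring
    rwa [sq_eq_zero_iff, norm_eq_zero, sub_eq_zero] at h6
  funext t
  refine LinearIsometryEquiv.ext fun x => ?_
  exact congrFun (Continuous.ext_on hH.dense_domain (S t).continuous (T t).continuous
    fun x hx => hdom t x hx) x

theorem existsUnique_isTimeEvolution {ħ : ℝ} (hħ : 0 < ħ) {H : E →ₗ.[ℂ] E}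
    (hH : IsSelfAdjoint H) : ∃! T, IsTimeEvolution ħ H T := by
  obtain ⟨T, hT⟩ := exists_isTimeEvolution hħ hH
  exact ⟨T, hT, fun S hS => hS.unique hH hT⟩

end Stone

section Conj

variable {E : Type*} [NormedAddCommGroup E] [InnerProductSpace ℂ E]

theorem hasDerivAt_comp_linearIsometryEquiv {G G' : Type*} [NormedAddCommGroup G]
    [InnerProductSpace ℂ G] [NormedAddCommGroup G'] [InnerProductSpace ℂ G'] (W : G ≃ₗᵢ[ℂ] G')
    {f : ℝ → G} {f' : G} {t : ℝ} (h : HasDerivAt f f' t) :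
    HasDerivAt (fun t => W (f t)) (W f') t :=
  (W.toLinearIsometry.toContinuousLinearMap.restrictScalars ℝ).hasFDerivAt.comp_hasDerivAt t h

/-- Conjugation by a unitary map carries the time evolution of `H` to that of `U⁻¹ H U`. -/
theorem IsTimeEvolution.conj {E' : Type*} [NormedAddCommGroup E'] [InnerProductSpace ℂ E']
    (U : E' ≃ₗᵢ[ℂ] E) {ħ : ℝ} {H : E →ₗ.[ℂ] E} {T : ℝ → (E ≃ₗᵢ[ℂ] E)}
    (hT : IsTimeEvolution ħ H T) :
    IsTimeEvolution ħ (conjOp U H) fun t => (U.trans (T t)).trans U.symm where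
  map_zero x := by simp [hT.map_zero]
  map_add s t x := by simp [hT.map_add]
  continuous x := U.symm.continuous.comp (hT.continuous (U x))
  generator x y := by
    rw [mem_graph_conjOp, hT.generator]
    constructor
    · intro h
      simpa using hasDerivAt_comp_linearIsometryEquiv U.symm h
    · intro h
      simpa using hasDerivAt_comp_linearIsometryEquiv U h

end Conj

/-! ### Weak Laplacians of square-integrable functions -/

section WeakLaplacian

open Filter SchwartzMap
open scoped Laplacian FourierTransform SchwartzMap

variable {X : Type*} [NormedAddCommGroup X] [InnerProductSpace ℝ X] [FiniteDimensional ℝ X]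

theorem norm_laplacian_le (f : X → ℂ) (x : X) :
    ‖Laplacian.laplacian f x‖ ≤ Module.finrank ℝ X * ‖iteratedFDeriv ℝ 2 f x‖ := by
  rw [InnerProductSpace.laplacian_eq_iteratedFDeriv_stdOrthonormalBasis]
  refine (norm_sum_le _ _).trans ?_
  refine (Finset.sum_le_card_nsmul _ _ (‖iteratedFDeriv ℝ 2 f x‖) fun i _ => ?_).trans_eq (by simp)
  refine (ContinuousMultilinearMap.le_opNorm _ _).trans ?_
  simp [Fin.prod_univ_two]

theorem continuous_laplacian {φ : X → ℂ} (hφ : ContDiff ℝ 2 φ) :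
    Continuous (Laplacian.laplacian φ) := by
  rw [InnerProductSpace.laplacian_eq_iteratedFDeriv_stdOrthonormalBasis]
  have h := hφ.continuous_iteratedFDeriv (m := 2) le_rfl
  exact continuous_finsetSum _ fun i _ =>
    (ContinuousMultilinearMap.apply ℝ (fun _ : Fin 2 => X) ℂ _).continuous.comp h

theorem hasCompactSupport_laplacian {φ : X → ℂ} (hs : HasCompactSupport φ) :
    HasCompactSupport (Laplacian.laplacian φ) := by
  refine (hs.iteratedFDeriv (𝕜 := ℝ) 2).mono fun x hx h => hx ?_
  have := norm_laplacian_le φ x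
  rw [h, norm_zero, mul_zero] at this
  exact norm_le_zero_iff.1 this

/-- Smooth cutoff functions with uniformly bounded derivatives up to second order. -/
theorem exists_cutoff : ∃ (χ : ℕ → X → ℝ) (C : ℝ), (∀ n, ContDiff ℝ ∞ (χ n)) ∧
    (∀ n, HasCompactSupport (χ n)) ∧ (∀ (n : ℕ) (x : X), ‖x‖ < n + 1 → χ n x = 1) ∧
    ∀ n, ∀ i ≤ 2, ∀ x, ‖iteratedFDeriv ℝ i (χ n) x‖ ≤ C := by
  let b : ContDiffBump (0 : X) := ⟨1, 2, one_pos, one_lt_two⟩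
  have hb : ContDiff ℝ ∞ b := b.contDiff
  have hbs : HasCompactSupport b := b.hasCompactSupport
  have hbd : ∀ i : ℕ, ∃ C, ∀ x, ‖iteratedFDeriv ℝ i b x‖ ≤ C := fun i =>
    (hbs.iteratedFDeriv i).exists_bound_of_continuous
      (hb.continuous_iteratedFDeriv (by exact_mod_cast le_top))
  choose C hC using hbd
  have hC0 : ∀ i, 0 ≤ C i := fun i => (norm_nonneg _).trans (hC i 0)
  have hpos : ∀ n : ℕ, (0 : ℝ) < n + 1 := fun n => by positivity
  refine ⟨fun (n : ℕ) x => b ((n + 1 : ℝ)⁻¹ • x), C 0 + C 1 + C 2, fun n => ?_, fun n => ?_,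
    fun n x hx => ?_, fun n i hi x => ?_⟩
  · exact hb.comp (contDiff_const_smul _)
  · exact hbs.comp_homeomorph (Homeomorph.smulOfNeZero _ (inv_ne_zero (hpos n).ne'))
  · apply b.one_of_mem_closedBall
    rw [mem_closedBall_zero_iff, norm_smul, norm_inv, Real.norm_eq_abs, abs_of_pos (hpos n),
      inv_mul_le_iff₀ (hpos n)]
    simpa [b] using hx.le
  · rw [iteratedFDeriv_comp_const_smul (f := b) _ (hb.of_le (by exact_mod_cast le_top)), norm_smul]
    have h1 : ‖((n + 1 : ℝ)⁻¹) ^ i‖ ≤ 1 := by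
      rw [norm_pow, norm_inv, Real.norm_eq_abs, abs_of_pos (hpos n)]
      refine pow_le_one₀ (by positivity) (inv_le_one_of_one_le₀ ?_)
      have : (0 : ℝ) ≤ n := by positivity
      linarith
    have h2 : C i ≤ C 0 + C 1 + C 2 := by
      have h0 := hC0 0
      have h1 := hC0 1
      have h2 := hC0 2
      interval_cases i <;> linarith
    calc _ ≤ 1 * C i := mul_le_mul h1 (hC i _) (norm_nonneg _) zero_le_one
      _ ≤ _ := by rw [one_mul]; exact h2

variable [MeasurableSpace X] [BorelSpace X]

/-- The derivatives of a Schwartz function are square-integrable. -/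
theorem memLp_norm_iteratedFDeriv (u : 𝓢(X, ℂ)) (i : ℕ) :
    MemLp (fun x => ‖iteratedFDeriv ℝ i u x‖) 2 (volume : Measure X) := by
  have hc : Continuous fun x => ‖iteratedFDeriv ℝ i u x‖ :=
    ((u.smooth ⊤).continuous_iteratedFDeriv (by exact_mod_cast le_top)).norm
  rw [memLp_two_iff_integrable_sq hc.aestronglyMeasurable]
  set k := Module.finrank ℝ X + 1 with hk
  have hint : Integrable (fun x : X => (1 + ‖x‖) ^ (-(k : ℝ))) volume :=
    integrable_one_add_norm (by rw [hk]; push_cast; linarith)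
  obtain ⟨C, hC⟩ : ∃ C, ∀ x, (1 + ‖x‖) ^ k * ‖iteratedFDeriv ℝ i u x‖ ≤ C :=
    ⟨_, fun x => one_add_le_sup_seminorm_apply (𝕜 := ℝ) (m := (k, i)) le_rfl le_rfl u x⟩
  refine (hint.const_mul (C ^ 2)).mono' (hc.pow 2).aestronglyMeasurable
    (Eventually.of_forall fun x => ?_)
  have h1 : (1 : ℝ) ≤ 1 + ‖x‖ := by linarith [norm_nonneg x]
  have h2 : 1 ≤ (1 + ‖x‖) ^ k := one_le_pow₀ h1
  have h3 : 0 ≤ ‖iteratedFDeriv ℝ i u x‖ := norm_nonneg _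
  rw [Real.rpow_neg (by positivity), Real.rpow_natCast, Real.norm_eq_abs, abs_of_nonneg (sq_nonneg _),
    ← div_eq_mul_inv, le_div_iff₀ (by positivity)]
  have h4 := hC x
  have h5 : 0 ≤ (1 + ‖x‖) ^ k * ‖iteratedFDeriv ℝ i u x‖ := by positivity
  calc ‖iteratedFDeriv ℝ i u x‖ ^ 2 * (1 + ‖x‖) ^ k
      ≤ ‖iteratedFDeriv ℝ i u x‖ ^ 2 * ((1 + ‖x‖) ^ k * (1 + ‖x‖) ^ k) := by
        gcongr
        exact le_mul_of_one_le_left (by positivity) h2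
    _ = ((1 + ‖x‖) ^ k * ‖iteratedFDeriv ℝ i u x‖) ^ 2 := by ring
    _ ≤ C ^ 2 := by gcongr

/-- `k` is the Laplacian of `f` in the sense of distributions. -/
def IsWeakLaplacian (f k : Lp ℂ 2 (volume : Measure X)) : Prop :=
  ∀ φ : X → ℂ, ContDiff ℝ ∞ φ → HasCompactSupport φ →
    ∫ x, Laplacian.laplacian φ x * f x = ∫ x, φ x * k x

/-- By a cutoff argument, the defining identity of the weak Laplacian extends to Schwartz
functions. -/
theorem IsWeakLaplacian.integral_schwartz {f k : Lp ℂ 2 (volume : Measure X)}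
    (h : IsWeakLaplacian f k) (u : 𝓢(X, ℂ)) :
    ∫ x, Laplacian.laplacian (u : X → ℂ) x * f x = ∫ x, u x * k x := by
  obtain ⟨χ, C, hχ, hχs, hχ1, hχC⟩ := exists_cutoff (X := X)
  have hu : ContDiff ℝ ∞ u := u.smooth ⊤
  have hw : ∀ n, ContDiff ℝ ∞ (fun x => χ n x • u x) := fun n => (hχ n).smul hu
  have hws : ∀ n, HasCompactSupport (fun x => χ n x • u x) := fun n => (hχs n).smul_right
  have hlim : ∀ x, ∀ᶠ n in atTop, (fun y => χ n y • u y) =ᶠ[𝓝 x] u := by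
    intro x
    obtain ⟨M, hM⟩ := exists_nat_gt ‖x‖
    filter_upwards [eventually_ge_atTop M] with n hn
    have hx : ‖x‖ < n + 1 := by
      have : (M : ℝ) ≤ n := by exact_mod_cast hn
      linarith
    filter_upwards [(isOpen_lt continuous_norm continuous_const).mem_nhds hx] with y hy
    rw [hχ1 n y hy, one_smul]
  have hf : MemLp (fun x => ‖f x‖) 2 (volume : Measure X) := (Lp.memLp f).norm
  have hk : MemLp (fun x => ‖k x‖) 2 (volume : Measure X) := (Lp.memLp k).norm
  have hD : MemLp (fun x => ‖iteratedFDeriv ℝ 0 u x‖ + ‖iteratedFDeriv ℝ 1 u x‖ +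
      ‖iteratedFDeriv ℝ 2 u x‖) 2 (volume : Measure X) :=
    ((memLp_norm_iteratedFDeriv u 0).add (memLp_norm_iteratedFDeriv u 1)).add
      (memLp_norm_iteratedFDeriv u 2)
  have hC0 : 0 ≤ C := (norm_nonneg _).trans (hχC 0 0 (by norm_num) 0)
  have hb : ∀ n x, ‖iteratedFDeriv ℝ 2 (fun y => χ n y • u y) x‖ ≤
      (2 * C) * (‖iteratedFDeriv ℝ 0 u x‖ + ‖iteratedFDeriv ℝ 1 u x‖ +
      ‖iteratedFDeriv ℝ 2 u x‖) := by
    intro n x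
    refine (norm_iteratedFDeriv_smul_le (N := ∞) (n := 2) (hχ n) hu x
      (WithTop.coe_le_coe.2 le_top)).trans ?_
    simp only [Finset.sum_range_succ, Finset.sum_range_zero]
    have h0 := hχC n 0 (by norm_num) x
    have h1 := hχC n 1 (by norm_num) x
    have h2 := hχC n 2 (by norm_num) x
    have e0 := norm_nonneg (u x)
    have e1 := norm_nonneg (iteratedFDeriv ℝ 1 u x)
    have e2 := norm_nonneg (iteratedFDeriv ℝ 2 u x)
    rw [norm_iteratedFDeriv_zero] at h0
    simp only [Nat.choose, Nat.sub_zero, norm_iteratedFDeriv_zero, Nat.cast_one,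
      Nat.cast_ofNat, Nat.reduceAdd, Nat.reduceSub, zero_add, one_mul]
    nlinarith [mul_le_mul_of_nonneg_right h0 e2, mul_le_mul_of_nonneg_right h1 e1,
      mul_le_mul_of_nonneg_right h2 e0, mul_nonneg hC0 e2, mul_nonneg hC0 e0]
  have hcl : ∀ n, Continuous (Laplacian.laplacian fun y => χ n y • u y) := fun n =>
    continuous_laplacian ((hw n).of_le (WithTop.coe_le_coe.2 le_top))
  have hL : Tendsto (fun n => ∫ x, Laplacian.laplacian (fun y => χ n y • u y) x * f x) atTop
      (𝓝 (∫ x, Laplacian.laplacian (u : X → ℂ) x * f x)) := by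
    refine tendsto_integral_of_dominated_convergence (fun x => (Module.finrank ℝ X * (2 * C)) *
      ((‖iteratedFDeriv ℝ 0 u x‖ + ‖iteratedFDeriv ℝ 1 u x‖ +
      ‖iteratedFDeriv ℝ 2 u x‖) * ‖f x‖)) (fun n => ?_) ?_ (fun n => ?_) ?_
    · exact (hcl n).aestronglyMeasurable.mul (Lp.aestronglyMeasurable f)
    · exact (hD.integrable_mul hf).const_mul _
    · refine Eventually.of_forall fun x => ?_
      rw [norm_mul, ← mul_assoc]
      gcongr
      refine (norm_laplacian_le _ x).trans ?_
      rw [mul_assoc]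
      gcongr
      exact hb n x
    · refine Eventually.of_forall fun x => tendsto_const_nhds.congr' ?_
      filter_upwards [hlim x] with n hn
      rw [(InnerProductSpace.laplacian_congr_nhds hn).eq_of_nhds]
  have hR : Tendsto (fun n => ∫ x, (χ n x • u x) * k x) atTop (𝓝 (∫ x, u x * k x)) := by
    refine tendsto_integral_of_dominated_convergence (fun x => C *
      (‖iteratedFDeriv ℝ 0 u x‖ * ‖k x‖)) (fun n => ?_) ?_ (fun n => ?_) ?_
    · exact (hw n).continuous.aestronglyMeasurable.mul (Lp.aestronglyMeasurable k)
    · exact ((memLp_norm_iteratedFDeriv u 0).integrable_mul hk).const_mul _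
    · refine Eventually.of_forall fun x => ?_
      have h0 := hχC n 0 (by norm_num) x
      rw [norm_iteratedFDeriv_zero] at h0
      rw [norm_mul, norm_smul, norm_iteratedFDeriv_zero, mul_assoc]
      gcongr
    · refine Eventually.of_forall fun x => tendsto_const_nhds.congr' ?_
      filter_upwards [hlim x] with n hn
      rw [show χ n x • u x = u x from hn.eq_of_nhds]
  exact tendsto_nhds_unique hL (hR.congr fun n => (h _ (hw n) (hws n)).symm)

/-- On the Fourier side the weak Laplacian is multiplication by `-(2π|ξ|)²`. -/
theorem IsWeakLaplacian.fourier_eq {f k : Lp ℂ 2 (volume : Measure X)}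
    (h : IsWeakLaplacian f k) :
    ∀ᵐ ξ : X, (𝓕 k : Lp ℂ 2 (volume : Measure X)) ξ =
      ((-((2 * Real.pi) ^ 2 * ‖ξ‖ ^ 2) : ℝ) : ℂ) * (𝓕 f : Lp ℂ 2 (volume : Measure X)) ξ := by
  have h1 : Δ (f : 𝓢'(X, ℂ)) = (k : 𝓢'(X, ℂ)) := by
    ext u
    rw [TemperedDistribution.laplacian_apply_apply, Lp.toTemperedDistribution_apply,
      Lp.toTemperedDistribution_apply]
    simpa [SchwartzMap.laplacian_apply] using h.integral_schwartz u
  have hT : (fun x : X => ((‖x‖ ^ 2 : ℝ) : ℂ)).HasTemperateGrowth := by fun_prop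
  have h2 : ((𝓕 k : Lp ℂ 2 (volume : Measure X)) : 𝓢'(X, ℂ)) =
      ((-(2 * Real.pi) ^ 2 : ℝ) : ℂ) •
      TemperedDistribution.smulLeftCLM ℂ (fun x => ((‖x‖ ^ 2 : ℝ) : ℂ))
        ((𝓕 f : Lp ℂ 2 (volume : Measure X)) : 𝓢'(X, ℂ)) := by
    rw [← Lp.fourier_toTemperedDistribution_eq, ← h1,
      TemperedDistribution.laplacian_eq_fourierMultiplierCLM,
      TemperedDistribution.fourierMultiplierCLM_apply, ← Lp.fourier_toTemperedDistribution_eq]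
    rw [← Complex.coe_smul, FourierTransform.fourier_smul,
      FourierTransform.fourier_fourierInv_eq]
  refine ae_eq_of_integral_contDiff_smul_eq ((Lp.memLp _).locallyIntegrable one_le_two) ?_ ?_
  · refine LocallyIntegrable.continuous_mul (by fun_prop) ((Lp.memLp _).locallyIntegrable one_le_two)
  · intro g hg hgs
    have hg₁ : HasCompactSupport (Complex.ofRealCLM ∘ g) := hgs.comp_left rfl
    have hg₂ : ContDiff ℝ ∞ (Complex.ofRealCLM ∘ g) := by fun_prop
    have h3 := DFunLike.congr_fun h2 (hg₁.toSchwartzMap hg₂)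
    rw [Lp.toTemperedDistribution_apply] at h3
    change _ = (((-(2 * Real.pi) ^ 2 : ℝ) : ℂ)) • (TemperedDistribution.smulLeftCLM ℂ _ _) _ at h3
    rw [TemperedDistribution.smulLeftCLM_apply_apply, Lp.toTemperedDistribution_apply,
      smul_eq_mul, ← integral_const_mul] at h3
    refine Eq.trans ?_ (h3.trans ?_)
    · rfl
    · congr 1
      ext ξ
      rw [SchwartzMap.smulLeftCLM_apply_apply hT]
      simp
      ring

/-- The weak Laplacian is a symmetric relation. -/
theorem IsWeakLaplacian.inner_eq {f k f' k' : Lp ℂ 2 (volume : Measure X)}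
    (h : IsWeakLaplacian f k) (h' : IsWeakLaplacian f' k') :
    inner ℂ k' f = inner ℂ f' k := by
  rw [← Lp.inner_fourier_eq, ← Lp.inner_fourier_eq f', L2.inner_def, L2.inner_def]
  refine integral_congr_ae ?_
  filter_upwards [h.fourier_eq, h'.fourier_eq] with ξ h1 h2
  simp only [h1, h2, RCLike.inner_apply, map_mul, Complex.conj_ofReal]
  ring

/-- The classical Laplacian of a test function is its weak Laplacian. -/
theorem isWeakLaplacian_of_contDiff {f k : Lp ℂ 2 (volume : Measure X)} {φ : X → ℂ}
    (hφ : ContDiff ℝ ∞ φ) (hφs : HasCompactSupport φ) (hf : f =ᵐ[volume] φ)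
    (hk : k =ᵐ[volume] Laplacian.laplacian φ) : IsWeakLaplacian f k := by
  intro η hη hηs
  have h1 := SchwartzMap.integral_mul_laplacian_right_eq_left (μ := (volume : Measure X))
    (hηs.toSchwartzMap hη) (hφs.toSchwartzMap hφ)
  simp only [SchwartzMap.laplacian_apply] at h1
  have h2 : ∫ x, Laplacian.laplacian η x * f x = ∫ x, Laplacian.laplacian η x * φ x :=
    integral_congr_ae (by filter_upwards [hf] with x hx; rw [hx])
  have h3 : ∫ x, η x * k x = ∫ x, η x * Laplacian.laplacian φ x :=
    integral_congr_ae (by filter_upwards [hk] with x hx; rw [hx])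
  rw [h2, h3]
  exact h1.symm

end WeakLaplacian

/-! ### Anti-symmetrization -/

section Anti

open Filter
open scoped Laplacian

variable {N d : ℕ}

theorem permute_permute (σ τ : Equiv.Perm (Fin N)) (x : OrdSpace N d) :
    permute σ (permute τ x) = permute (τ * σ) x := by
  ext1 i
  simp

theorem sign_mul_sign_self (σ : Equiv.Perm (Fin N)) :
    ((Equiv.Perm.sign σ : ℤ) : ℂ) * ((Equiv.Perm.sign σ : ℤ) : ℂ) = 1 := by
  rcases Int.units_eq_one_or (Equiv.Perm.sign σ) with h | h <;> simp [h]

/-- The anti-symmetrization of a function on `ℝ^{Nd}`. -/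
def antisym (φ : OrdSpace N d → ℂ) (x : OrdSpace N d) : ℂ :=
  (N.factorial : ℂ)⁻¹ * ∑ σ : Equiv.Perm (Fin N), ((Equiv.Perm.sign σ : ℤ) : ℂ) * φ (permute σ x)

theorem antisym_permute (φ : OrdSpace N d → ℂ) (τ : Equiv.Perm (Fin N)) (x : OrdSpace N d) :
    antisym φ (permute τ x) = ((Equiv.Perm.sign τ : ℤ) : ℂ) * antisym φ x := by
  simp only [antisym, permute_permute]
  rw [mul_left_comm, Finset.mul_sum _ _ (((Equiv.Perm.sign τ : ℤ) : ℂ))]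
  congr 1
  conv_rhs => rw [← Equiv.sum_comp (Equiv.mulLeft τ)]
  refine Finset.sum_congr rfl fun σ _ => ?_
  simp only [Equiv.coe_mulLeft, Equiv.Perm.sign_mul, Units.val_mul, Int.cast_mul]
  rw [← mul_assoc, ← mul_assoc, sign_mul_sign_self, one_mul]

theorem contDiff_antisym {φ : OrdSpace N d → ℂ} (hφ : ContDiff ℝ ∞ φ) :
    ContDiff ℝ ∞ (antisym φ) := by
  refine contDiff_const.mul (ContDiff.sum fun σ _ => contDiff_const.mul ?_)
  exact hφ.comp (permute σ).contDiff

theorem hasCompactSupport_antisym {φ : OrdSpace N d → ℂ} (hφ : HasCompactSupport φ) :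
    HasCompactSupport (antisym φ) := by
  have h1 : ∀ σ : Equiv.Perm (Fin N), HasCompactSupport fun x =>
      ((Equiv.Perm.sign σ : ℤ) : ℂ) * φ (permute σ x) := fun σ =>
    (hφ.comp_homeomorph (permute (d := d) σ).toHomeomorph).mul_left
  have h : ∀ s : Finset (Equiv.Perm (Fin N)), HasCompactSupport fun x => ∑ σ ∈ s,
      ((Equiv.Perm.sign σ : ℤ) : ℂ) * φ (permute σ x) := by
    intro s
    induction s using Finset.induction_on with
    | empty =>
      simp only [Finset.sum_empty]
      exact HasCompactSupport.zero
    | insert a s ha ih =>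
      simp only [Finset.sum_insert ha]
      exact (h1 a).add ih
  exact (h Finset.univ).mul_left

theorem laplacian_comp_permute {φ : OrdSpace N d → ℂ} (hφ : ContDiff ℝ ∞ φ)
    (σ : Equiv.Perm (Fin N)) (x : OrdSpace N d) :
    Laplacian.laplacian (fun y => φ (permute σ y)) x = Laplacian.laplacian φ (permute σ x) := by
  rw [InnerProductSpace.laplacian_eq_iteratedFDeriv_stdOrthonormalBasis,
    InnerProductSpace.laplacian_eq_iteratedFDeriv_orthonormalBasis φ
      ((stdOrthonormalBasis ℝ (OrdSpace N d)).map (permute σ))]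
  refine Finset.sum_congr rfl fun i _ => ?_
  have h := ContinuousLinearMap.iteratedFDeriv_comp_right
    (permute (d := d) σ).toLinearIsometry.toContinuousLinearMap hφ x (i := 2)
    (WithTop.coe_le_coe.2 le_top)
  have h2 := DFunLike.congr_fun h ![stdOrthonormalBasis ℝ (OrdSpace N d) i,
    stdOrthonormalBasis ℝ (OrdSpace N d) i]
  refine h2.trans ?_
  rw [ContinuousMultilinearMap.compContinuousLinearMap_apply]
  congr 1
  ext j : 1
  fin_cases j <;> simp

theorem laplacian_finset_sum {X ι : Type*} [NormedAddCommGroup X] [InnerProductSpace ℝ X]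
    [FiniteDimensional ℝ X] (s : Finset ι) (c : ι → ℂ) {f : ι → X → ℂ}
    (hf : ∀ i, ContDiff ℝ 2 (f i)) (x : X) :
    Laplacian.laplacian (fun y => ∑ i ∈ s, c i * f i y) x =
      ∑ i ∈ s, c i * Laplacian.laplacian (f i) x := by
  classical
  induction s using Finset.induction_on with
  | empty => simp
  | insert a s ha ih =>
    simp only [Finset.sum_insert ha]
    have h1 : ContDiff ℝ 2 fun y => c a * f a y := contDiff_const.mul (hf a)
    have h2 : ContDiff ℝ 2 fun y => ∑ i ∈ s, c i * f i y :=
      ContDiff.sum fun i _ => contDiff_const.mul (hf i)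
    refine (h1.contDiffAt.laplacian_add h2.contDiffAt).trans ?_
    rw [ih]
    congr 1
    exact InnerProductSpace.laplacian_smul (c a) (hf a).contDiffAt

theorem laplacian_antisym {φ : OrdSpace N d → ℂ} (hφ : ContDiff ℝ ∞ φ) :
    Laplacian.laplacian (antisym φ) = antisym (Laplacian.laplacian φ) := by
  ext x
  have h0 : ∀ σ : Equiv.Perm (Fin N), ContDiff ℝ 2 fun y => φ (permute σ y) := fun σ =>
    (hφ.comp (permute σ).contDiff).of_le (WithTop.coe_le_coe.2 le_top)
  have h1 := laplacian_finset_sum Finset.univ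
    (fun σ : Equiv.Perm (Fin N) => ((Equiv.Perm.sign σ : ℤ) : ℂ)) h0
  have h2 : ContDiff ℝ 2 fun y => ∑ σ : Equiv.Perm (Fin N),
      ((Equiv.Perm.sign σ : ℤ) : ℂ) * φ (permute σ y) :=
    ContDiff.sum fun σ _ => contDiff_const.mul (h0 σ)
  refine (InnerProductSpace.laplacian_smul ((N.factorial : ℂ)⁻¹) h2.contDiffAt).trans ?_
  rw [h1]
  simp only [laplacian_comp_permute hφ]
  rfl

theorem memLp_of_continuous {φ : OrdSpace N d → ℂ} (hφ : Continuous φ)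
    (hs : HasCompactSupport φ) : MemLp φ 2 volume :=
  hφ.memLp_of_hasCompactSupport hs

/-- Test functions may be anti-symmetrized when they are paired with anti-symmetric functions. -/
theorem integral_antisym_mul {φ : OrdSpace N d → ℂ} (hφ : Continuous φ) (hs : HasCompactSupport φ)
    (f : antiL2 N d) : ∫ x, antisym φ x * f.1 x = ∫ x, φ x * f.1 x := by
  have h0 : ∀ σ : Equiv.Perm (Fin N), MemLp (fun x => φ (permute σ x)) 2 volume := fun σ =>
    memLp_of_continuous (hφ.comp (permute σ).continuous)
      (hs.comp_homeomorph (permute (d := d) σ).toHomeomorph)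
  have h1 : ∀ σ : Equiv.Perm (Fin N), ∫ x, φ (permute σ x) * f.1 x =
      ((Equiv.Perm.sign σ : ℤ) : ℂ) * ∫ x, φ x * f.1 x := by
    intro σ
    have hmp := (permute (d := d) σ⁻¹).measurePreserving
    rw [← hmp.integral_comp (permute (d := d) σ⁻¹).toHomeomorph.measurableEmbedding,
      ← integral_const_mul]
    refine integral_congr_ae ?_
    filter_upwards [f.2 σ⁻¹] with x hx
    rw [hx, permute_permute, inv_mul_cancel]
    have : permute 1 x = x := by ext1 i; simp
    rw [this, Equiv.Perm.sign_inv]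
    ring
  have h2 : ∀ x, antisym φ x * f.1 x = (N.factorial : ℂ)⁻¹ * ∑ σ : Equiv.Perm (Fin N),
      ((Equiv.Perm.sign σ : ℤ) : ℂ) * (φ (permute σ x) * f.1 x) := by
    intro x
    rw [antisym, mul_assoc, Finset.sum_mul]
    simp only [mul_assoc]
  have h3 : ∀ σ : Equiv.Perm (Fin N), Integrable fun x => φ (permute σ x) * f.1 x := fun σ =>
    (h0 σ).integrable_mul (Lp.memLp f.1)
  simp_rw [h2]
  rw [integral_const_mul, integral_finsetSum _ fun σ _ =>
    Integrable.const_mul (h3 σ) _]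
  simp_rw [integral_const_mul, h1, ← mul_assoc, sign_mul_sign_self, one_mul]
  rw [Finset.sum_const, Finset.card_univ, Fintype.card_perm, Fintype.card_fin, nsmul_eq_mul,
    ← mul_assoc, inv_mul_cancel₀, one_mul]
  exact_mod_cast N.factorial_ne_zero

end Anti

/-! ### Essential self-adjointness on anti-symmetric functions -/

section AntiHamiltonian

open Filter

variable {N d : ℕ}

theorem laplacian_conj {X : Type*} [NormedAddCommGroup X] [InnerProductSpace ℝ X]
    [FiniteDimensional ℝ X] {φ : X → ℂ} (hφ : ContDiff ℝ 2 φ) (x : X) :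
    Laplacian.laplacian (fun y => (starRingEnd ℂ) (φ y)) x =
      (starRingEnd ℂ) (Laplacian.laplacian φ x) :=
  hφ.contDiffAt.laplacian_CLM_comp_left (l := Complex.conjCLE.toContinuousLinearMap)

theorem hamFun_conj (ħ m : ℝ) (V : OrdSpace N d → ℝ) {φ : OrdSpace N d → ℂ}
    (hφ : ContDiff ℝ 2 φ) (x : OrdSpace N d) :
    hamFun ħ m V (fun y => (starRingEnd ℂ) (φ y)) x = (starRingEnd ℂ) (hamFun ħ m V φ x) := by
  simp only [hamFun, laplacian_conj hφ, Complex.real_smul, map_add, map_mul, Complex.conj_ofReal]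

theorem memLp_mul_of_bounded {V : OrdSpace N d → ℝ} (hVm : Measurable V)
    (hVb : ∃ C, ∀ x, |V x| ≤ C) {f : OrdSpace N d → ℂ} (hf : MemLp f 2 volume) :
    MemLp (fun x => (V x : ℂ) * f x) 2 volume := by
  obtain ⟨C, hC⟩ := hVb
  refine hf.of_le_mul (c := C)
    ((Complex.measurable_ofReal.comp hVm).aestronglyMeasurable.mul hf.1)
    (Eventually.of_forall fun x => ?_)
  rw [norm_mul, Complex.norm_real, Real.norm_eq_abs]
  gcongr
  exact hC x

theorem memLp_hamFun (ħ m : ℝ) {V : OrdSpace N d → ℝ} (hVm : Measurable V)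
    (hVb : ∃ C, ∀ x, |V x| ≤ C) {φ : OrdSpace N d → ℂ} (hφ : ContDiff ℝ ∞ φ)
    (hs : HasCompactSupport φ) : MemLp (hamFun ħ m V φ) 2 volume := by
  have h1 : MemLp (Laplacian.laplacian φ) 2 volume :=
    memLp_of_continuous (continuous_laplacian (hφ.of_le (WithTop.coe_le_coe.2 le_top)))
      (hasCompactSupport_laplacian hs)
  have h2 := memLp_mul_of_bounded hVm hVb (memLp_of_continuous hφ.continuous hs)
  exact (h1.const_smul (-(ħ ^ 2 / (2 * m)))).add h2

theorem hamFun_permute (ħ m : ℝ) {V : OrdSpace N d → ℝ}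
    (hVs : ∀ (σ : Equiv.Perm (Fin N)) (x : OrdSpace N d), V (permute σ x) = V x)
    {φ : OrdSpace N d → ℂ} (hφ : ContDiff ℝ ∞ φ)
    (ha : ∀ (σ : Equiv.Perm (Fin N)) (x : OrdSpace N d),
      φ (permute σ x) = ((Equiv.Perm.sign σ : ℤ) : ℂ) * φ x)
    (σ : Equiv.Perm (Fin N)) (x : OrdSpace N d) :
    hamFun ħ m V φ (permute σ x) = ((Equiv.Perm.sign σ : ℤ) : ℂ) * hamFun ħ m V φ x := by
  have h1 := laplacian_comp_permute hφ σ x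
  have h2 : (fun y => φ (permute σ y)) = ((Equiv.Perm.sign σ : ℤ) : ℂ) • φ := by
    funext y
    rw [ha]
    rfl
  rw [h2, InnerProductSpace.laplacian_smul _
    (hφ.of_le (WithTop.coe_le_coe.2 le_top)).contDiffAt] at h1
  simp only [hamFun, ← h1, hVs, ha, Complex.real_smul, smul_eq_mul]
  ring

/-- Multiplication by a symmetric potential preserves anti-symmetry. -/
theorem ae_antisymm_mul {V : OrdSpace N d → ℝ}
    (hVs : ∀ (σ : Equiv.Perm (Fin N)) (x : OrdSpace N d), V (permute σ x) = V x)
    {f g : Lp ℂ 2 (volume : Measure (OrdSpace N d))} (hf : f ∈ antiL2 N d)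
    (hg : g =ᵐ[volume] fun x => (V x : ℂ) * f x) : g ∈ antiL2 N d := by
  intro σ
  filter_upwards [hf σ, hg, (permute (d := d) σ).measurePreserving.quasiMeasurePreserving.ae hg]
    with x h1 h2 h3
  rw [h3, h2, h1, hVs]
  ring

/-- An everywhere anti-symmetric square-integrable function as an element of `Anti L²`. -/
theorem exists_antiL2 {φ : OrdSpace N d → ℂ} (hφ : MemLp φ 2 volume)
    (ha : ∀ (σ : Equiv.Perm (Fin N)) (x : OrdSpace N d),
      φ (permute σ x) = ((Equiv.Perm.sign σ : ℤ) : ℂ) * φ x) :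
    ∃ f : antiL2 N d, f.1 =ᵐ[volume] φ := by
  refine ⟨⟨hφ.toLp φ, fun σ => ?_⟩, hφ.coeFn_toLp⟩
  filter_upwards [hφ.coeFn_toLp,
    (permute (d := d) σ).measurePreserving.quasiMeasurePreserving.ae hφ.coeFn_toLp] with x h1 h2
  rw [h2, h1, ha]

/-- The graph of `-(ħ²/2m) Δ + V` on `Anti C_0^∞(ℝ^{Nd})`. -/
def testGraph (ħ m : ℝ) (V : OrdSpace N d → ℝ) : Submodule ℂ (antiL2 N d × antiL2 N d) where
  carrier := {p | ∃ φ : OrdSpace N d → ℂ, ContDiff ℝ ∞ φ ∧ HasCompactSupport φ ∧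
    (∀ (σ : Equiv.Perm (Fin N)) (x : OrdSpace N d),
      φ (permute σ x) = ((Equiv.Perm.sign σ : ℤ) : ℂ) * φ x) ∧
    p.1.1 =ᵐ[volume] φ ∧ p.2.1 =ᵐ[volume] hamFun ħ m V φ}
  zero_mem' := by
    refine ⟨fun _ => 0, contDiff_const, HasCompactSupport.zero, by simp, Lp.coeFn_zero _ _ _, ?_⟩
    refine (Lp.coeFn_zero _ _ _).trans (Eventually.of_forall fun x => ?_)
    simp [hamFun]
  add_mem' := by
    rintro ⟨f, g⟩ ⟨f', g'⟩ ⟨φ, h1, h2, h3, h4, h5⟩ ⟨φ', h1', h2', h3', h4', h5'⟩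
    refine ⟨φ + φ', h1.add h1', h2.add h2', fun σ x => ?_,
      (Lp.coeFn_add _ _).trans (h4.add h4'), (Lp.coeFn_add _ _).trans ?_⟩
    · simp only [Pi.add_apply, h3, h3', mul_add]
    · filter_upwards [h5, h5'] with x e e'
      have := (h1.of_le (WithTop.coe_le_coe.2 le_top)).contDiffAt.laplacian_add
        (h1'.of_le (m := 2) (WithTop.coe_le_coe.2 le_top)).contDiffAt (x := x)
      simp only [Pi.add_apply, e, e', hamFun, this, smul_add]
      abel
  smul_mem' := by
    rintro c ⟨f, g⟩ ⟨φ, h1, h2, h3, h4, h5⟩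
    refine ⟨c • φ, contDiff_const.smul h1, h2.smul_left (f := fun _ => c), fun σ x => ?_,
      (Lp.coeFn_smul _ _).trans (h4.const_smul c), (Lp.coeFn_smul _ _).trans ?_⟩
    · simp only [Pi.smul_apply, h3, smul_eq_mul]
      ring
    · filter_upwards [h5] with x e
      have := InnerProductSpace.laplacian_smul c
        (h1.of_le (m := 2) (WithTop.coe_le_coe.2 le_top)).contDiffAt (x := x)
      simp only [Pi.smul_apply, e, hamFun, this, smul_eq_mul, Complex.real_smul]
      ring

theorem mem_testGraph_iff {ħ m : ℝ} {V : OrdSpace N d → ℝ} {f g : antiL2 N d} :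
    (f, g) ∈ testGraph ħ m V ↔ ∃ φ : OrdSpace N d → ℂ, ContDiff ℝ ∞ φ ∧ HasCompactSupport φ ∧
      (∀ (σ : Equiv.Perm (Fin N)) (x : OrdSpace N d),
        φ (permute σ x) = ((Equiv.Perm.sign σ : ℤ) : ℂ) * φ x) ∧
      f.1 =ᵐ[volume] φ ∧ g.1 =ᵐ[volume] hamFun ħ m V φ :=
  Iff.rfl

theorem extendsAntiHam_iff (ħ m : ℝ) {V : OrdSpace N d → ℝ} (hVm : Measurable V)
    (hVb : ∃ C, ∀ x, |V x| ≤ C)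
    (hVs : ∀ (σ : Equiv.Perm (Fin N)) (x : OrdSpace N d), V (permute σ x) = V x)
    (H : antiL2 N d →ₗ.[ℂ] antiL2 N d) :
    ExtendsAntiHam ħ m V H ↔ testGraph ħ m V ≤ H.graph := by
  constructor
  · rintro h ⟨f, g⟩ ⟨φ, h1, h2, h3, h4, h5⟩
    obtain ⟨f', g', hf', hg', hfg⟩ := h φ h1 h2 h3
    have e1 : f = f' := Subtype.ext (Lp.ext (h4.trans hf'.symm))
    have e2 : g = g' := Subtype.ext (Lp.ext (h5.trans hg'.symm))
    rwa [e1, e2]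
  · intro h φ h1 h2 h3
    obtain ⟨f, hf⟩ := exists_antiL2 (memLp_of_continuous h1.continuous h2) h3
    obtain ⟨g, hg⟩ := exists_antiL2 (memLp_hamFun ħ m hVm hVb h1 h2)
      (hamFun_permute ħ m hVs h1 h3)
    exact ⟨f, g, hf, hg, h ⟨φ, h1, h2, h3, hf, hg⟩⟩

theorem inner_antiL2_of_ae_conj {a : antiL2 N d} {φ : OrdSpace N d → ℂ}
    (ha : a.1 =ᵐ[volume] fun x => (starRingEnd ℂ) (φ x)) (f : antiL2 N d) :
    inner ℂ a f = ∫ x, φ x * f.1 x := by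
  rw [Submodule.coe_inner, L2.inner_def]
  refine integral_congr_ae ?_
  filter_upwards [ha] with x hx
  rw [hx, RCLike.inner_apply, Complex.conj_conj, mul_comm]

set_option maxHeartbeats 1000000 in
/-- Every test function, after anti-symmetrization and complex conjugation, is an element of the
domain of the Hamiltonian. -/
theorem exists_mem_testGraph (ħ m : ℝ) {V : OrdSpace N d → ℝ} (hVm : Measurable V)
    (hVb : ∃ C, ∀ x, |V x| ≤ C)
    (hVs : ∀ (σ : Equiv.Perm (Fin N)) (x : OrdSpace N d), V (permute σ x) = V x)
    {φ : OrdSpace N d → ℂ} (hφ : ContDiff ℝ ∞ φ) (hs : HasCompactSupport φ) :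
    ∃ a b : antiL2 N d, (a, b) ∈ testGraph ħ m V ∧
      (∀ f : antiL2 N d, inner ℂ a f = ∫ x, antisym φ x * f.1 x) ∧
      ∀ f : antiL2 N d, inner ℂ b f = ∫ x, hamFun ħ m V (antisym φ) x * f.1 x := by
  have hA := contDiff_antisym hφ
  have hAs := hasCompactSupport_antisym hs
  have hAa := antisym_permute φ
  generalize antisym φ = η at hA hAs hAa
  have hη : ContDiff ℝ ∞ fun y => (starRingEnd ℂ) (η y) := Complex.conjCLE.contDiff.comp hA
  have hηs : HasCompactSupport fun y => (starRingEnd ℂ) (η y) := hAs.comp_left (map_zero _)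
  have hηa : ∀ (σ : Equiv.Perm (Fin N)) (y : OrdSpace N d),
      (starRingEnd ℂ) (η (permute σ y)) =
        ((Equiv.Perm.sign σ : ℤ) : ℂ) * (starRingEnd ℂ) (η y) := by
    intro σ y
    rw [hAa, map_mul, map_intCast]
  obtain ⟨a, ha⟩ := exists_antiL2 (memLp_of_continuous hη.continuous hηs) hηa
  obtain ⟨b, hb⟩ := exists_antiL2 (memLp_hamFun ħ m hVm hVb hη hηs)
    (hamFun_permute ħ m hVs hη hηa)
  have hab : (a, b) ∈ testGraph ħ m V := mem_testGraph_iff.2 ⟨_, hη, hηs, hηa, ha, hb⟩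
  have hb' : b.1 =ᵐ[volume] fun x => (starRingEnd ℂ) (hamFun ħ m V η x) :=
    hb.trans (Eventually.of_forall
      (hamFun_conj ħ m V (hA.of_le (WithTop.coe_le_coe.2 le_top))))
  exact ⟨a, b, hab, inner_antiL2_of_ae_conj ha, inner_antiL2_of_ae_conj hb'⟩

/-- The anti-symmetric test functions are dense. -/
theorem dense_testGraph (ħ m : ℝ) {V : OrdSpace N d → ℝ} (hVm : Measurable V)
    (hVb : ∃ C, ∀ x, |V x| ≤ C)
    (hVs : ∀ (σ : Equiv.Perm (Fin N)) (x : OrdSpace N d), V (permute σ x) = V x) :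
    Dense (((testGraph ħ m V).map (LinearMap.fst ℂ _ _) : Submodule ℂ (antiL2 N d)) :
      Set (antiL2 N d)) := by
  rw [Submodule.dense_iff_topologicalClosure_eq_top, Submodule.topologicalClosure_eq_top_iff,
    Submodule.eq_bot_iff]
  intro x hx
  rw [Submodule.mem_orthogonal] at hx
  have key : ∀ φ : OrdSpace N d → ℂ, ContDiff ℝ ∞ φ → HasCompactSupport φ →
      ∫ y, φ y * x.1 y = 0 := by
    intro φ hφ hs
    obtain ⟨a, b, hab, ha, -⟩ := exists_mem_testGraph ħ m hVm hVb hVs hφ hs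
    rw [← integral_antisym_mul hφ.continuous hs, ← ha]
    exact hx a ⟨(a, b), hab, rfl⟩
  apply Subtype.ext
  apply Lp.ext
  refine EventuallyEq.trans ?_ (Lp.coeFn_zero _ _ _).symm
  refine ae_eq_zero_of_integral_contDiff_smul_eq_zero
    ((Lp.memLp x.1).locallyIntegrable one_le_two) fun g hg hgs => ?_
  have h1 := key (Complex.ofRealCLM ∘ g) (by fun_prop) (hgs.comp_left rfl)
  rw [← h1]
  rfl

/-- `g = -c Δ f + V f` with the weak Laplacian; this is the graph of the maximal operator. -/
def IsWeakHam (c : ℝ) (V : OrdSpace N d → ℝ) (f g : Lp ℂ 2 (volume : Measure (OrdSpace N d))) :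
    Prop :=
  ∃ k : Lp ℂ 2 (volume : Measure (OrdSpace N d)), IsWeakLaplacian f k ∧
    g =ᵐ[volume] fun x => -(c : ℂ) * k x + V x * f x

/-- The maximal operator is symmetric. -/
theorem IsWeakHam.inner_eq {c : ℝ} {V : OrdSpace N d → ℝ} (hVm : Measurable V)
    (hVb : ∃ C, ∀ x, |V x| ≤ C) {f g f' g' : Lp ℂ 2 (volume : Measure (OrdSpace N d))}
    (h : IsWeakHam c V f g) (h' : IsWeakHam c V f' g') : inner ℂ g' f = inner ℂ f' g := by
  obtain ⟨k, hk, hg⟩ := h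
  obtain ⟨k', hk', hg'⟩ := h'
  have e := hk.inner_eq hk'
  set W := (memLp_mul_of_bounded hVm hVb (Lp.memLp f)).toLp
  set W' := (memLp_mul_of_bounded hVm hVb (Lp.memLp f')).toLp
  have hW := (memLp_mul_of_bounded hVm hVb (Lp.memLp f)).coeFn_toLp
  have hW' := (memLp_mul_of_bounded hVm hVb (Lp.memLp f')).coeFn_toLp
  have h1 : ∀ {g k f W : Lp ℂ 2 (volume : Measure (OrdSpace N d))},
      g =ᵐ[volume] (fun x => -(c : ℂ) * k x + V x * f x) →
      W =ᵐ[volume] (fun x => (V x : ℂ) * f x) → g = -(c : ℂ) • k + W := by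
    intro g k f W hg hW
    apply Lp.ext
    filter_upwards [hg, hW, Lp.coeFn_add (-(c : ℂ) • k) W, Lp.coeFn_smul (-(c : ℂ)) k]
      with x a1 a2 a3 a4
    rw [a1, a3, Pi.add_apply, a4, a2]
    rfl
  rw [h1 hg hW, h1 hg' hW', inner_add_left, inner_add_right, inner_smul_left, inner_smul_right, e]
  congr 1
  · simp
  · rw [L2.inner_def, L2.inner_def]
    refine integral_congr_ae ?_
    filter_upwards [hW, hW'] with x a1 a2
    rw [a1, a2]
    simp only [RCLike.inner_apply, map_mul, Complex.conj_ofReal]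
    ring

theorem isWeakHam_of_mem_testGraph {ħ m : ℝ} {V : OrdSpace N d → ℝ} {f g : antiL2 N d}
    (h : (f, g) ∈ testGraph ħ m V) : IsWeakHam (ħ ^ 2 / (2 * m)) V f.1 g.1 := by
  obtain ⟨φ, h1, h2, h3, h4, h5⟩ := h
  have hL : MemLp (Laplacian.laplacian φ) 2 volume :=
    memLp_of_continuous (continuous_laplacian (h1.of_le (WithTop.coe_le_coe.2 le_top)))
      (hasCompactSupport_laplacian h2)
  refine ⟨hL.toLp, isWeakLaplacian_of_contDiff h1 h2 h4 hL.coeFn_toLp, ?_⟩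
  filter_upwards [h4, h5, hL.coeFn_toLp] with x a1 a2 a3
  rw [a1, a2, a3, hamFun]
  simp

/-- The adjoint of the operator on `Anti C_0^∞` is contained in the maximal operator. Its defining
identity tests only with anti-symmetric functions; as `f` and `g` are anti-symmetric, it follows for
all test functions. -/
theorem isWeakHam_of_mem_adjoint {ħ m : ℝ} (hħ : 0 < ħ) (hm : 0 < m) {V : OrdSpace N d → ℝ}
    (hVm : Measurable V) (hVb : ∃ C, ∀ x, |V x| ≤ C)
    (hVs : ∀ (σ : Equiv.Perm (Fin N)) (x : OrdSpace N d), V (permute σ x) = V x)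
    {f g : antiL2 N d} (h : (f, g) ∈ (testGraph ħ m V).adjoint) :
    IsWeakHam (ħ ^ 2 / (2 * m)) V f.1 g.1 := by
  rw [Submodule.mem_adjoint_iff] at h
  simp only [sub_eq_zero] at h
  set c := ħ ^ 2 / (2 * m) with hc
  have hc0 : (c : ℂ) ≠ 0 := by
    have : 0 < c := by positivity
    exact_mod_cast this.ne'
  have hV := memLp_mul_of_bounded hVm hVb (Lp.memLp f.1)
  have hWm : hV.toLp ∈ antiL2 N d := ae_antisymm_mul hVs f.2 hV.coeFn_toLp
  let W : antiL2 N d := ⟨hV.toLp, hWm⟩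
  have hW : W.1 =ᵐ[volume] fun x => (V x : ℂ) * f.1 x := hV.coeFn_toLp
  let k : antiL2 N d := (c : ℂ)⁻¹ • (W - g)
  have hk : k.1 =ᵐ[volume] fun x => (c : ℂ)⁻¹ * (V x * f.1 x - g.1 x) := by
    filter_upwards [Lp.coeFn_smul (c : ℂ)⁻¹ (W.1 - g.1), Lp.coeFn_sub W.1 g.1, hW] with x a1 a2 a3
    refine a1.trans ?_
    rw [Pi.smul_apply, a2, Pi.sub_apply, a3, smul_eq_mul]
  refine ⟨k.1, fun φ hφ hs => ?_, ?_⟩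
  · have hA2 : ContDiff ℝ 2 (antisym φ) :=
      (contDiff_antisym hφ).of_le (WithTop.coe_le_coe.2 le_top)
    have hφ2 : ContDiff ℝ 2 φ := hφ.of_le (WithTop.coe_le_coe.2 le_top)
    obtain ⟨a, b, hab, ha, hb⟩ := exists_mem_testGraph ħ m hVm hVb hVs hφ hs
    have h2 := h a b hab
    rw [ha, hb] at h2
    have hAc := hA2.continuous
    have hAs := hasCompactSupport_antisym hs
    have i1 : Integrable fun x => Laplacian.laplacian (antisym φ) x * f.1 x :=
      (memLp_of_continuous (continuous_laplacian hA2)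
        (hasCompactSupport_laplacian hAs)).integrable_mul (Lp.memLp f.1)
    have i2 : Integrable fun x => antisym φ x * (V x * f.1 x) :=
      (memLp_of_continuous hAc hAs).integrable_mul hV
    have i3 : Integrable fun x => antisym φ x * g.1 x :=
      (memLp_of_continuous hAc hAs).integrable_mul (Lp.memLp g.1)
    have h3 : ∫ x, hamFun ħ m V (antisym φ) x * f.1 x =
        -(c : ℂ) * (∫ x, Laplacian.laplacian (antisym φ) x * f.1 x) +
          ∫ x, antisym φ x * (V x * f.1 x) := by
      rw [← integral_const_mul, ← integral_add (i1.const_mul _) i2]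
      congr 1
      ext x
      simp only [hamFun, Complex.real_smul, ← hc]
      push_cast
      ring
    have h4 : ∫ x, Laplacian.laplacian φ x * f.1 x =
        ∫ x, Laplacian.laplacian (antisym φ) x * f.1 x := by
      rw [laplacian_antisym hφ]
      exact (integral_antisym_mul (continuous_laplacian hφ2)
        (hasCompactSupport_laplacian hs) f).symm
    have h5 : ∫ x, φ x * k.1 x =
        (c : ℂ)⁻¹ * ((∫ x, antisym φ x * (V x * f.1 x)) - ∫ x, antisym φ x * g.1 x) := by
      rw [← integral_antisym_mul hφ.continuous hs, ← integral_sub i2 i3, ← integral_const_mul]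
      refine integral_congr_ae ?_
      filter_upwards [hk] with x hx
      rw [hx]
      ring
    rw [h4, h5, ← h2, h3, sub_add_cancel_right, neg_mul, neg_neg, inv_mul_cancel_left₀ hc0]
  · filter_upwards [hk] with x hx
    rw [hx, neg_mul, mul_inv_cancel_left₀ hc0]
    ring

/-- Essential self-adjointness of `-(ħ²/2m) Δ + V` on `Anti C_0^∞(ℝ^{Nd})`: there is exactly one
self-adjoint extension. -/
theorem exists_antiHam {ħ m : ℝ} (hħ : 0 < ħ) (hm : 0 < m) {V : OrdSpace N d → ℝ}
    (hVm : Measurable V) (hVb : ∃ C, ∀ x, |V x| ≤ C)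
    (hVs : ∀ (σ : Equiv.Perm (Fin N)) (x : OrdSpace N d), V (permute σ x) = V x) :
    ∃ HA : antiL2 N d →ₗ.[ℂ] antiL2 N d, IsSelfAdjoint HA ∧ ExtendsAntiHam ħ m V HA ∧
      ∀ H' : antiL2 N d →ₗ.[ℂ] antiL2 N d,
        IsSelfAdjoint H' → ExtendsAntiHam ħ m V H' → H' = HA := by
  simp only [extendsAntiHam_iff ħ m hVm hVb hVs]
  refine exists_unique_selfAdjoint_extension (testGraph ħ m V) (dense_testGraph ħ m hVm hVb hVs)
    (fun x y a b h h' => ?_) (fun x y a b h h' => ?_)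
  · exact (isWeakHam_of_mem_testGraph h).inner_eq hVm hVb (isWeakHam_of_mem_testGraph h')
  · exact (isWeakHam_of_mem_adjoint hħ hm hVm hVb hVs h).inner_eq hVm hVb
      (isWeakHam_of_mem_adjoint hħ hm hVm hVb hVs h')

end AntiHamiltonian

/-! ### The projection in charts -/

section Geometry

open Filter

variable {N d : ℕ}

instance : T2Space (Conf N d) := by
  rw [t2_iff_isClosed_diagonal]
  have hq : Topology.IsQuotientMap (Prod.map (proj : OrdConf N d → Conf N d)
      (proj : OrdConf N d → Conf N d)) :=
    (isOpenMap_proj.prodMap isOpenMap_proj).isQuotientMap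
      (continuous_proj.prodMap continuous_proj) (proj_surjective.prodMap proj_surjective)
  rw [← hq.isClosed_preimage]
  -- two configurations agree if and only if they are reorderings of each other: a finite union of graphs
  have : Prod.map (proj : OrdConf N d → Conf N d) (proj : OrdConf N d → Conf N d) ⁻¹'
      Set.diagonal (Conf N d) =
      ⋃ σ : Equiv.Perm (Fin N), {p : OrdConf N d × OrdConf N d | p.2 = reorder σ p.1} := by
    ext p
    simp [proj_eq_proj_iff]
  rw [this]
  exact isClosed_iUnion_of_finite fun σ =>
    isClosed_eq continuous_snd ((continuous_reorder σ).comp continuous_fst)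

open Classical in
/-- The projection `π`, extended by an arbitrary value to all of `ℝ^{Nd}`. -/
def projExt [Nonempty (OrdConf N d)] (y : OrdSpace N d) : Conf N d :=
  if h : y ∈ OrdConf N d then proj ⟨y, h⟩ else proj (Classical.arbitrary _)

theorem projExt_coe [Nonempty (OrdConf N d)] (x : OrdConf N d) : projExt x.1 = proj x :=
  dif_pos x.2

theorem permute_mem_ordConf {x : OrdSpace N d} (hx : x ∈ OrdConf N d) (σ : Equiv.Perm (Fin N)) :
    permute σ x ∈ OrdConf N d :=
  (reorder σ ⟨x, hx⟩).2

/-- Near an ordered configuration `x`, the projection is a reordering followed by the inverse of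
the preferred chart at `π(x)`. -/
theorem exists_perm_projExt_eq [Nonempty (OrdConf N d)] (x : OrdConf N d) :
    ∃ τ : Equiv.Perm (Fin N),
      permute τ x.1 = chartAt (OrdSpace N d) (proj x) (proj x) ∧
      ∀ᶠ y in 𝓝 x.1, y ∈ OrdConf N d ∧
        permute τ y ∈ (chartAt (OrdSpace N d) (proj x)).target ∧
        projExt y = (chartAt (OrdSpace N d) (proj x)).symm (permute τ y) := by
  set e := chartAt (OrdSpace N d) (proj x)
  obtain ⟨z, hz, hez⟩ := exists_eq_chart (chart_mem_atlas (OrdSpace N d) (proj x))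
    (mem_chart_source (OrdSpace N d) (proj x))
  obtain ⟨τ, rfl⟩ := proj_eq_proj_iff.1 hz.symm
  refine ⟨τ, hez.symm, ?_⟩
  have h1 : permute τ x.1 ∈ e.target := by
    have := e.map_source (mem_chart_source (OrdSpace N d) (proj x))
    rwa [hez] at this
  filter_upwards [(OrdConf N d).isOpen.mem_nhds x.2,
    (permute τ).continuous.continuousAt.eventually_mem (e.open_target.mem_nhds h1)] with y hy hy'
  refine ⟨hy, hy', ?_⟩
  obtain ⟨w, hw, hw'⟩ := exists_eq_chart (chart_mem_atlas (OrdSpace N d) (proj x))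
    (e.map_target hy')
  rw [e.right_inv hy'] at hw'
  have : w = reorder τ ⟨y, hy⟩ := Subtype.ext hw'.symm
  rw [← hw, this, projExt_coe ⟨y, hy⟩]
  exact proj_eq_proj_iff.2 ⟨τ, rfl⟩

theorem contMDiffAt_projExt [Nonempty (OrdConf N d)] {y : OrdSpace N d} (hy : y ∈ OrdConf N d) :
    ContMDiffAt 𝓘(ℝ, OrdSpace N d) 𝓘(ℝ, OrdSpace N d) ∞ projExt y := by
  obtain ⟨τ, -, h⟩ := exists_perm_projExt_eq ⟨y, hy⟩
  have h1 := h.self_of_nhds.2.1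
  have h2 : ContMDiffAt 𝓘(ℝ, OrdSpace N d) 𝓘(ℝ, OrdSpace N d) ∞
      (chartAt (OrdSpace N d) (proj ⟨y, hy⟩)).symm (permute τ y) :=
    (contMDiffOn_chart_symm (I := 𝓘(ℝ, OrdSpace N d))).contMDiffAt
      ((chartAt (OrdSpace N d) (proj ⟨y, hy⟩)).open_target.mem_nhds h1)
  refine (h2.comp y (permute τ).contDiff.contMDiff.contMDiffAt).congr_of_eventuallyEq ?_
  filter_upwards [h] with z hz using hz.2.2

theorem mdifferentiableAt_projExt [Nonempty (OrdConf N d)] {y : OrdSpace N d}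
    (hy : y ∈ OrdConf N d) :
    MDifferentiableAt 𝓘(ℝ, OrdSpace N d) 𝓘(ℝ, OrdSpace N d) projExt y :=
  (contMDiffAt_projExt hy).mdifferentiableAt (by simp)

/-- The differential of the projection maps constant vector fields on `ℝ^{Nd}` to coordinate
fields. -/
theorem exists_perm_mfderiv_projExt [Nonempty (OrdConf N d)] (x : OrdConf N d) :
    ∃ τ : Equiv.Perm (Fin N), ∀ᶠ y in 𝓝 x.1, y ∈ OrdConf N d ∧
      projExt y ∈ (chartAt (OrdSpace N d) (proj x)).source ∧ ∀ v : OrdSpace N d,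
        mfderiv 𝓘(ℝ, OrdSpace N d) 𝓘(ℝ, OrdSpace N d) projExt y v =
          coordField (proj x) (permute τ v) (projExt y) := by
  obtain ⟨τ, -, h⟩ := exists_perm_projExt_eq x
  refine ⟨τ, ?_⟩
  filter_upwards [h.eventually_nhds] with y hy
  set e := chartAt (OrdSpace N d) (proj x)
  obtain ⟨hy1, hy2, hy3⟩ := hy.self_of_nhds
  have hs : projExt y ∈ e.source := by
    rw [hy3]
    exact e.map_target hy2
  refine ⟨hy1, hs, fun v => ?_⟩
  have h1 : projExt =ᶠ[𝓝 y] fun z => e.symm (permute τ z) := by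
    filter_upwards [hy] with z hz using hz.2.2
  have h2 : MDifferentiableAt 𝓘(ℝ, OrdSpace N d) 𝓘(ℝ, OrdSpace N d) e.symm (permute τ y) :=
    ((contMDiffOn_chart_symm (I := 𝓘(ℝ, OrdSpace N d)) (n := ∞)).contMDiffAt
      (e.open_target.mem_nhds hy2)).mdifferentiableAt (by simp)
  have h3 : HasMFDerivAt 𝓘(ℝ, OrdSpace N d) 𝓘(ℝ, OrdSpace N d) (permute (d := d) τ) y
      ((permute (d := d) τ).toContinuousLinearEquiv : OrdSpace N d →L[ℝ] OrdSpace N d) :=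
    ((permute (d := d) τ).toContinuousLinearEquiv.hasFDerivAt).hasMFDerivAt
  have h4 := (h2.hasMFDerivAt.comp y h3).congr_of_eventuallyEq h1
  have h5 : chartAt (OrdSpace N d) (proj x) (projExt y) = permute τ y := by
    rw [hy3]
    exact e.right_inv hy2
  rw [h4.mfderiv, coordField, TangentBundle.symmL_trivializationAt hs]
  simp only [mfld_simps, mfderivWithin_univ]
  rw [h5]
  rfl

end Geometry

/-! ### Smooth sections and the connection -/

section Connection

open Filter

variable {N d : ℕ} {F : Conf N d → Type*}
  [∀ q, NormedAddCommGroup (F q)] [∀ q, InnerProductSpace ℂ (F q)]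
  [TopologicalSpace (TotalSpace ℂ F)] [FiberBundle ℂ F] [VectorBundle ℂ ℂ F]

theorem SmoothSectionAt.mdifferentiableAt {ψ : ∀ q, F q} {q : Conf N d}
    (h : SmoothSectionAt ψ q) :
    MDifferentiableAt 𝓘(ℝ, OrdSpace N d) (𝓘(ℝ, OrdSpace N d).prod 𝓘(ℝ, ℂ))
      (fun p => TotalSpace.mk' ℂ p (ψ p)) q :=
  ContMDiffAt.mdifferentiableAt h (by simp)

theorem SmoothSectionAt.congr {ψ φ : ∀ q, F q} {q : Conf N d} (h : SmoothSectionAt ψ q)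
    (he : ∀ᶠ p in 𝓝 q, φ p = ψ p) : SmoothSectionAt φ q :=
  ContMDiffAt.congr_of_eventuallyEq h (he.mono fun p hp => by simp only [hp])

theorem SmoothSectionAt.real_smul {ψ : ∀ q, F q} {q : Conf N d} (h : SmoothSectionAt ψ q)
    {f : Conf N d → ℝ} (hf : ContMDiffAt 𝓘(ℝ, OrdSpace N d) 𝓘(ℝ, ℝ) ∞ f q) :
    SmoothSectionAt (fun p => f p • ψ p) q :=
  ContMDiffAt.smul_section hf h

/-- A section that is smooth near `q` agrees near `q` with a smooth section. -/
theorem exists_smooth_extension {ψ : ∀ q, F q} {q : Conf N d}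
    (h : ∀ᶠ p in 𝓝 q, SmoothSectionAt ψ p) :
    ∃ φ : ∀ q, F q, (∀ p, SmoothSectionAt φ p) ∧ ∀ᶠ p in 𝓝 q, φ p = ψ p := by
  obtain ⟨f, -, hf⟩ :=
    (SmoothBumpFunction.nhds_basis_tsupport (I := 𝓘(ℝ, OrdSpace N d)) q).mem_iff.1 h
  refine ⟨fun p => f p • ψ p, fun p => ?_, ?_⟩
  · by_cases hp : p ∈ tsupport f
    · exact (hf hp).real_smul f.contMDiffAt
    · have h0 : SmoothSectionAt (fun p => (0 : F p)) p := contMDiff_zeroSection ℝ F p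
      refine h0.congr ?_
      filter_upwards [(isClosed_tsupport f).isOpen_compl.mem_nhds hp] with p' hp'
      rw [image_eq_zero_of_notMem_tsupport hp', zero_smul]
  · filter_upwards [f.eventuallyEq_one] with p hp
    rw [hp, Pi.one_apply, one_smul]

variable {nab : CovariantDerivative 𝓘(ℝ, OrdSpace N d) ℂ F}

/-- The connection is local. -/
theorem nab_congr {ψ φ : ∀ q, F q} {q : Conf N d} (hψ : SmoothSectionAt ψ q)
    (he : ∀ᶠ p in 𝓝 q, φ p = ψ p) : nab φ q = nab ψ q :=
  nab.isCovariantDerivativeOnUniv.congr_of_eventuallyEq (hψ.congr he).mdifferentiableAt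
    hψ.mdifferentiableAt univ_mem he

theorem smoothField_coordField {q p : Conf N d} (hp : p ∈ (chartAt (OrdSpace N d) q).source)
    (v : OrdSpace N d) :
    ContMDiffAt 𝓘(ℝ, OrdSpace N d) (𝓘(ℝ, OrdSpace N d).prod 𝓘(ℝ, OrdSpace N d)) ∞
      (fun p => TotalSpace.mk' (OrdSpace N d) p (coordField q v p)) p := by
  set e := trivializationAt (OrdSpace N d) (TangentSpace 𝓘(ℝ, OrdSpace N d)) q
  have hb : e.baseSet = (chartAt (OrdSpace N d) q).source := rfl
  rw [← hb] at hp
  rw [e.contMDiffAt_section_iff hp]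
  refine (contMDiffAt_const (c := v)).congr_of_eventuallyEq ?_
  filter_upwards [e.open_baseSet.mem_nhds hp] with p hp
  change (e ⟨p, e.symmL ℝ p v⟩).2 = v
  rw [e.symmL_apply hp, e.apply_mk_symm hp]

/-- `∇_{∂_v} ψ` is smooth on the chart domain if `ψ` is. The smoothness of `∇` is available for
globally smooth sections only, so `ψ` is first replaced by a smooth extension of its germ. -/
theorem smoothSectionAt_nab_coordField (hnab : IsHermitianConnection nab) {ψ : ∀ q, F q}
    {q p : Conf N d} (hp : p ∈ (chartAt (OrdSpace N d) q).source)
    (h : ∀ᶠ p in 𝓝 p, SmoothSectionAt ψ p) (v : OrdSpace N d) :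
    SmoothSectionAt (fun p => nab ψ p (coordField q v p)) p := by
  obtain ⟨φ, hφ, he⟩ := exists_smooth_extension h
  have h1 : ContMDiffAt 𝓘(ℝ, OrdSpace N d)
      (𝓘(ℝ, OrdSpace N d).prod 𝓘(ℝ, OrdSpace N d →L[ℝ] ℂ)) ∞
      (fun p => TotalSpace.mk' (OrdSpace N d →L[ℝ] ℂ)
        (E := fun p => TangentSpace 𝓘(ℝ, OrdSpace N d) p →L[ℝ] F p) p (nab φ p)) p :=
    (hnab.smooth.contMDiff.contMDiff fun p _ => (hφ p).contMDiffWithinAt).contMDiffAt univ_mem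
  have h2 : SmoothSectionAt (fun p => nab φ p (coordField q v p)) p :=
    h1.clm_bundle_apply (smoothField_coordField hp v)
  refine h2.congr ?_
  filter_upwards [he.eventually_nhds] with p' hp'
  rw [nab_congr (hφ p') (hp'.mono fun _ h => h.symm)]

variable [ContMDiffVectorBundle ∞ ℂ F 𝓘(ℝ, OrdSpace N d)]

theorem smoothSectionAt_frame {q₁ q : Conf N d}
    (hq : q ∈ (trivializationAt ℂ F q₁).baseSet) : SmoothSectionAt (frame q₁ : ∀ q, F q) q := by
  set e₁ := trivializationAt ℂ F q₁
  rw [SmoothSectionAt, e₁.contMDiffAt_section_iff hq]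
  refine (contMDiffAt_const (c := (1 : ℂ))).congr_of_eventuallyEq ?_
  filter_upwards [e₁.open_baseSet.mem_nhds hq] with p hp
  change (e₁ ⟨p, e₁.symmL ℂ p 1⟩).2 = 1
  rw [e₁.symmL_apply hp, e₁.apply_mk_symm hp]

theorem SmoothSectionAt.contMDiffAt_coeff {ψ : ∀ q, F q} {q₁ q : Conf N d}
    (h : SmoothSectionAt ψ q) (hq : q ∈ (trivializationAt ℂ F q₁).baseSet) :
    ContMDiffAt 𝓘(ℝ, OrdSpace N d) 𝓘(ℝ, ℂ) ∞
      (fun p => (trivializationAt ℂ F q₁).continuousLinearMapAt ℂ p (ψ p)) q := by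
  set e₁ := trivializationAt ℂ F q₁
  rw [SmoothSectionAt, e₁.contMDiffAt_section_iff hq] at h
  refine h.congr_of_eventuallyEq ?_
  filter_upwards [e₁.open_baseSet.mem_nhds hq] with p hp
  rw [Trivialization.continuousLinearMapAt_apply, Trivialization.coe_linearMapAt_of_mem _ hp]

end Connection

/-! ### The chain rule for the projection -/

section ChainRule

open Filter

variable {N d : ℕ}

/-- As a local instance, this spares a long instance search in `PiLp`. -/
theorem continuousSMul_ordSpace : ContinuousSMul ℝ (OrdSpace N d) :=
  IsBoundedSMul.continuousSMul

attribute [local instance] continuousSMul_ordSpace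

/-- The differential of the projection `π`. -/
def dproj (x : OrdConf N d) : OrdSpace N d →L[ℝ] TangentSpace 𝓘(ℝ, OrdSpace N d) (proj x) :=
  haveI : Nonempty (OrdConf N d) := ⟨x⟩
  (mfderiv 𝓘(ℝ, OrdSpace N d) 𝓘(ℝ, OrdSpace N d) projExt x.1 : OrdSpace N d →L[ℝ] OrdSpace N d)

/-- Near `x`, the differential of `π` maps the constant vector fields on `ℝ^{Nd}` to the coordinate
fields of the chart at `π(x)`, up to the reordering of the particles made by the chart. -/
theorem exists_perm_dproj (x : OrdConf N d) :
    ∃ τ : Equiv.Perm (Fin N), ∀ᶠ y in 𝓝 x,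
      proj y ∈ (chartAt (OrdSpace N d) (proj x)).source ∧ ∀ v : OrdSpace N d,
        dproj y v = coordField (proj x) (permute τ v) (proj y) := by
  have : Nonempty (OrdConf N d) := ⟨x⟩
  obtain ⟨τ, h⟩ := exists_perm_mfderiv_projExt x
  refine ⟨τ, ?_⟩
  filter_upwards [continuous_subtype_val.continuousAt.eventually h] with y hy
  obtain ⟨-, h1, h2⟩ := hy
  rw [projExt_coe] at h1
  refine ⟨h1, fun v => (h2 v).trans ?_⟩
  have key : ∀ p p' : Conf N d, p = p' → (coordField (proj x) (permute τ v) p : OrdSpace N d) =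
      (coordField (proj x) (permute τ v) p' : OrdSpace N d) := by
    rintro p p' rfl
    rfl
  exact key _ _ (projExt_coe y)

theorem hasMFDerivAt_projExt [Nonempty (OrdConf N d)] (x : OrdConf N d) :
    HasMFDerivAt 𝓘(ℝ, OrdSpace N d) 𝓘(ℝ, OrdSpace N d) projExt x.1
      (dproj x : OrdSpace N d →L[ℝ] OrdSpace N d) :=
  (mdifferentiableAt_projExt x.2).hasMFDerivAt

/-- The differential of a function on `ᴺℝ^d`, with the tangent space in the form of its model. -/
def dConf (G : Conf N d → ℂ) (q : Conf N d) : OrdSpace N d →L[ℝ] ℂ :=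
  mfderiv 𝓘(ℝ, OrdSpace N d) 𝓘(ℝ, ℂ) G q

theorem hasFDerivAt_comp_projExt [Nonempty (OrdConf N d)] {G : Conf N d → ℂ} {x : OrdConf N d}
    (hG : MDifferentiableAt 𝓘(ℝ, OrdSpace N d) 𝓘(ℝ, ℂ) G (proj x)) :
    HasFDerivAt (fun y => G (projExt y))
      ((dConf G (proj x)).comp (dproj x : OrdSpace N d →L[ℝ] OrdSpace N d)) x.1 := by
  have h1 : HasMFDerivAt 𝓘(ℝ, OrdSpace N d) 𝓘(ℝ, ℂ) G (projExt x.1)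
      (dConf G (proj x)) := by
    rw [projExt_coe]
    exact hG.hasMFDerivAt
  exact (h1.comp x.1 (hasMFDerivAt_projExt x)).hasFDerivAt

theorem hasMFDerivWithinAt_proj_comp {c : ℝ → OrdConf N d} {t : ℝ} {w : OrdSpace N d}
    (hc : HasDerivWithinAt (fun t => (c t : OrdSpace N d)) w (Set.Icc 0 1) t) :
    HasMFDerivWithinAt 𝓘(ℝ, ℝ) 𝓘(ℝ, OrdSpace N d) (fun t => proj (c t)) (Set.Icc 0 1) t
      ((dproj (c t) : OrdSpace N d →L[ℝ] OrdSpace N d).comp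
        (ContinuousLinearMap.toSpanSingleton ℝ w)) := by
  have : Nonempty (OrdConf N d) := ⟨c t⟩
  have h0 : HasMFDerivWithinAt 𝓘(ℝ, ℝ) 𝓘(ℝ, OrdSpace N d) (fun t => (c t : OrdSpace N d))
      (Set.Icc 0 1) t (ContinuousLinearMap.toSpanSingleton ℝ w) :=
    hc.hasFDerivWithinAt.hasMFDerivWithinAt
  have h := HasMFDerivAt.comp_hasMFDerivWithinAt (g := projExt)
    (f := fun t => (c t : OrdSpace N d)) t (hasMFDerivAt_projExt (c t)) h0
  have e : projExt ∘ (fun t => (c t : OrdSpace N d)) = fun t => proj (c t) :=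
    funext fun t => projExt_coe (c t)
  rwa [e] at h

/-- The velocity of a projected path `π ∘ c` is `dπ(c')`. -/
theorem velocity_proj_comp {c : ℝ → OrdConf N d} {t : ℝ} (ht : t ∈ Set.Icc (0 : ℝ) 1)
    {w : OrdSpace N d}
    (hc : HasDerivWithinAt (fun t => (c t : OrdSpace N d)) w (Set.Icc 0 1) t) :
    velocity (fun t => proj (c t)) t = dproj (c t) w := by
  have hu : UniqueMDiffWithinAt 𝓘(ℝ, ℝ) (Set.Icc (0 : ℝ) 1) t :=
    (uniqueDiffOn_Icc zero_lt_one t ht).uniqueMDiffWithinAt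
  have h := (hasMFDerivWithinAt_proj_comp hc).mfderivWithin hu
  have h1 := congrArg (fun L : ℝ →L[ℝ] OrdSpace N d => L 1) h
  refine h1.trans ?_
  change (dproj (c t) : OrdSpace N d →L[ℝ] OrdSpace N d) ((1 : ℝ) • w) = _
  rw [one_smul]

theorem hasDerivWithinAt_comp_proj {G : Conf N d → ℂ} {c : ℝ → OrdConf N d} {t : ℝ}
    (ht : t ∈ Set.Icc (0 : ℝ) 1) (hc : IsSmoothPath c)
    (hG : MDifferentiableAt 𝓘(ℝ, OrdSpace N d) 𝓘(ℝ, ℂ) G (proj (c t))) :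
    HasDerivWithinAt (fun τ => G (proj (c τ)))
      (dConf G (proj (c t)) (velocity (fun t => proj (c t)) t)) (Set.Icc 0 1) t := by
  have h1 := ((hc.differentiableOn (by simp)) t ht).hasDerivWithinAt
  rw [velocity_proj_comp ht h1]
  have h2 := HasMFDerivAt.comp_hasMFDerivWithinAt (f := fun t => proj (c t)) t hG.hasMFDerivAt
    (hasMFDerivWithinAt_proj_comp h1)
  set w := derivWithin (fun t => (c t : OrdSpace N d)) (Set.Icc 0 1) t
  have h3 : HasFDerivWithinAt (fun τ => G (proj (c τ)))
      ((dConf G (proj (c t))).comp ((dproj (c t) : OrdSpace N d →L[ℝ] OrdSpace N d).comp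
          (ContinuousLinearMap.toSpanSingleton ℝ w))) (Set.Icc 0 1) t := h2.hasFDerivWithinAt
  refine h3.hasDerivWithinAt.congr_deriv ?_
  have h5 : (dproj (c t) : OrdSpace N d →L[ℝ] OrdSpace N d) ((1 : ℝ) • w) =
    (dproj (c t) : OrdSpace N d →L[ℝ] OrdSpace N d) w := by rw [one_smul]
  exact congrArg (dConf G (proj (c t))) h5

end ChainRule

/-! ### Parallel transport of a frame along segments -/

section ParallelTransport

open Filter

attribute [local instance] continuousSMul_ordSpace

variable {N d : ℕ} {F : Conf N d → Type*}
  [∀ q, NormedAddCommGroup (F q)] [∀ q, InnerProductSpace ℂ (F q)]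

theorem eventually_coe_ordConf {x : OrdConf N d} {P : OrdConf N d → Prop}
    (h : ∀ᶠ y in 𝓝 x, P y) : ∀ᶠ z in 𝓝 x.1, ∃ hz : z ∈ OrdConf N d, P ⟨z, hz⟩ := by
  have := (OrdConf N d).isOpen.isOpenEmbedding_subtypeVal.map_nhds_eq x
  rw [← this, eventually_map]
  filter_upwards [h] with y hy using ⟨y.2, hy⟩

open Classical in
/-- The function `x ↦ Î_x ψ(π(x))` on `ℝ^{d,N}_≠` that represents a section `ψ`, extended by `0`. -/
def pull (I : ∀ x : OrdConf N d, F (proj x) ≃ₗᵢ[ℂ] ℂ) (ψ : ∀ q, F q) (y : OrdSpace N d) : ℂ :=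
  if h : y ∈ OrdConf N d then I ⟨y, h⟩ (ψ (proj ⟨y, h⟩)) else 0

theorem pull_coe (I : ∀ x : OrdConf N d, F (proj x) ≃ₗᵢ[ℂ] ℂ) (ψ : ∀ q, F q) (x : OrdConf N d) :
    pull I ψ x.1 = I x (ψ (proj x)) :=
  dif_pos x.2

variable [TopologicalSpace (TotalSpace ℂ F)] [FiberBundle ℂ F] [VectorBundle ℂ ℂ F]

/-- The differential `v ↦ Î_x (∇_{dπ(v)} ψ)` of the lift of a section. -/
def pullNab (nab : CovariantDerivative 𝓘(ℝ, OrdSpace N d) ℂ F)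
    (I : ∀ x : OrdConf N d, F (proj x) ≃ₗᵢ[ℂ] ℂ) (ψ : ∀ q, F q) (x : OrdConf N d) :
    OrdSpace N d →L[ℝ] ℂ :=
  (((I x).toContinuousLinearEquiv : F (proj x) →L[ℂ] ℂ).restrictScalars ℝ).comp
    ((nab ψ (proj x)).comp (dproj x))

open Classical in
/-- The connection form of `∇` with respect to the frame of the trivialization at `q`, lifted to
`ℝ^{d,N}_≠`. -/
def connForm (nab : CovariantDerivative 𝓘(ℝ, OrdSpace N d) ℂ F) (q : Conf N d)
    (y : OrdSpace N d) : OrdSpace N d →L[ℝ] ℂ :=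
  if h : y ∈ OrdConf N d then
    (((trivializationAt ℂ F q).continuousLinearMapAt ℂ (proj ⟨y, h⟩)).restrictScalars ℝ).comp
      ((nab (frame q) (proj ⟨y, h⟩)).comp (dproj ⟨y, h⟩))
  else 0

variable {nab : CovariantDerivative 𝓘(ℝ, OrdSpace N d) ℂ F}

theorem connForm_coe (q : Conf N d) (x : OrdConf N d) (v : OrdSpace N d) :
    connForm nab q x.1 v = (trivializationAt ℂ F q).continuousLinearMapAt ℂ (proj x)
      (nab (frame q) (proj x) (dproj x v)) := by
  rw [connForm, dif_pos x.2]
  rfl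

theorem connForm_smul_frame {q : Conf N d} {x : OrdConf N d}
    (hx : proj x ∈ (trivializationAt ℂ F q).baseSet) (v : OrdSpace N d) :
    nab (frame q) (proj x) (dproj x v) = connForm nab q x.1 v • frame q (proj x) := by
  rw [connForm_coe]
  exact frame_eq hx _

/-- The metric property of the connection, along a curve. -/
theorem hasDerivWithinAt_inner_section [SmoothFiberMetric F] (hnab : IsHermitianConnection nab)
    {ψ φ : ∀ q, F q}
    {c : ℝ → OrdConf N d} (hc : IsSmoothPath c) {t : ℝ} (ht : t ∈ Set.Icc (0 : ℝ) 1)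
    (hψ : SmoothSectionAt ψ (proj (c t))) (hφ : SmoothSectionAt φ (proj (c t))) :
    HasDerivWithinAt (fun τ => (inner ℂ (ψ (proj (c τ))) (φ (proj (c τ))) : ℂ))
      (inner ℂ (nab ψ (proj (c t)) (velocity (fun t => proj (c t)) t)) (φ (proj (c t))) +
        inner ℂ (ψ (proj (c t))) (nab φ (proj (c t)) (velocity (fun t => proj (c t)) t)))
      (Set.Icc 0 1) t := by
  have h := SmoothFiberMetric.contMDiffAt_inner ψ φ (proj (c t)) hψ hφ
  exact (hasDerivWithinAt_comp_proj (G := fun p => inner ℂ (ψ p) (φ p)) ht hc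
    (h.mdifferentiableAt (by simp))).congr_deriv (hnab.metric ψ φ _ _ hψ hφ)

variable [ContMDiffVectorBundle ∞ ℂ F 𝓘(ℝ, OrdSpace N d)]

theorem eventually_continuousAt_connForm (hnab : IsHermitianConnection nab) (x : OrdConf N d) :
    ∀ᶠ y in 𝓝 x.1, ContinuousAt (connForm nab (proj x)) y := by
  have : Nonempty (OrdConf N d) := ⟨x⟩
  obtain ⟨τ, h⟩ := exists_perm_dproj x
  have hb : ∀ᶠ y in 𝓝 x, proj y ∈ (trivializationAt ℂ F (proj x)).baseSet :=
    continuous_proj.continuousAt.eventually_mem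
      ((trivializationAt ℂ F (proj x)).open_baseSet.mem_nhds
        (FiberBundle.mem_baseSet_trivializationAt ℂ F (proj x)))
  filter_upwards [(eventually_coe_ordConf (h.and hb)).eventually_nhds] with y hy
  rw [continuousAt_clm_apply]
  intro v
  obtain ⟨hy0, ⟨hy1, -⟩, hy2⟩ := hy.self_of_nhds
  have hs : ∀ᶠ p in 𝓝 (proj ⟨y, hy0⟩), SmoothSectionAt (frame (proj x) : ∀ q, F q) p := by
    filter_upwards [(trivializationAt ℂ F (proj x)).open_baseSet.mem_nhds hy2] with p hp
      using smoothSectionAt_frame hp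
  have hA := ((smoothSectionAt_nab_coordField hnab hy1 hs (permute τ v)).contMDiffAt_coeff
    hy2).continuousAt
  rw [← projExt_coe ⟨y, hy0⟩] at hA
  refine (ContinuousAt.comp (f := projExt) (x := y) hA
    (contMDiffAt_projExt hy0).continuousAt).congr ?_
  filter_upwards [hy] with z hz
  obtain ⟨hz0, ⟨-, hz1⟩, -⟩ := hz
  rw [Function.comp_apply, projExt_coe ⟨z, hz0⟩, connForm_coe _ ⟨z, hz0⟩, hz1]

variable [SmoothFiberMetric F]

/-- A frame, multiplied by the exponential of the integral of the connection form, is parallel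
along a segment. -/
theorem pull_frame_segment (hnab : IsHermitianConnection nab)
    {I : ∀ x : OrdConf N d, F (proj x) ≃ₗᵢ[ℂ] ℂ} (hI : IsLiftTrivialization nab I) {q : Conf N d}
    {x : OrdConf N d} {r : ℝ} (hr : ∀ y ∈ Metric.ball x.1 r, ContinuousAt (connForm nab q) y ∧
      ∃ h : y ∈ OrdConf N d, proj ⟨y, h⟩ ∈ (trivializationAt ℂ F q).baseSet)
    {w : OrdSpace N d} (hw : ‖w‖ < r) :
    pull I (frame q) (x.1 + w) = I x (frame q (proj x)) * Complex.exp
      (∫ t in (0 : ℝ)..1, connForm nab q (x.1 + (Set.projIcc (0 : ℝ) 1 zero_le_one t : ℝ) • w) w)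
      := by
  -- smooth paths have to be defined, without collisions, on all of `ℝ`: the segment is continued
  -- by constants
  set k : ℝ → ℝ := fun t => (Set.projIcc (0 : ℝ) 1 zero_le_one t : ℝ) with hk
  have hkc : Continuous k := continuous_subtype_val.comp continuous_projIcc
  have hkI : ∀ t ∈ Set.Icc (0 : ℝ) 1, k t = t := fun t ht => by
    simp only [hk, Set.projIcc_of_mem zero_le_one ht]
  have hk1 : ∀ t, ‖k t‖ ≤ 1 := fun t => by
    have := (Set.projIcc (0 : ℝ) 1 zero_le_one t).2
    rw [Real.norm_of_nonneg this.1]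
    exact this.2
  have hball : ∀ t, x.1 + k t • w ∈ Metric.ball x.1 r := fun t => by
    rw [mem_ball_iff_norm, add_sub_cancel_left, norm_smul]
    calc ‖k t‖ * ‖w‖ ≤ 1 * ‖w‖ := by gcongr; exact hk1 t
      _ < r := by rwa [one_mul]
  let c : ℝ → OrdConf N d := fun t => ⟨x.1 + k t • w, (hr _ (hball t)).2.1⟩
  have hcb : ∀ t, proj (c t) ∈ (trivializationAt ℂ F q).baseSet := fun t => (hr _ (hball t)).2.2
  have hcI : ∀ t ∈ Set.Icc (0 : ℝ) 1, (c t : OrdSpace N d) = x.1 + t • w := fun t ht => by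
    simp only [c, hkI t ht]
  have hc : IsSmoothPath c := by
    have h : ContDiffOn ℝ ∞ (fun t : ℝ => x.1 + t • w) (Set.Icc 0 1) := by fun_prop
    exact h.congr hcI
  set g : ℝ → ℂ := fun t => connForm nab q (x.1 + k t • w) w with hg
  have hgc : Continuous g := by
    have h1 : Continuous fun t => connForm nab q (x.1 + k t • w) := by
      rw [continuous_iff_continuousAt]
      intro t
      have h2 : Continuous fun t => x.1 + k t • w := by fun_prop
      exact ContinuousAt.comp (f := fun t => x.1 + k t • w) (hr _ (hball t)).1 h2.continuousAt
    exact h1.clm_apply continuous_const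
  set θ : ℝ → ℂ := fun t => ∫ τ in (0 : ℝ)..t, g τ with hθ
  have hθd : ∀ t, HasDerivAt θ (g t) t := fun t =>
    (hgc.integral_hasStrictDerivAt 0 t).hasDerivAt
  have hpar : IsParallelAlong nab (fun t => proj (c t))
      fun t => Complex.exp (-θ t) • frame q (proj (c t)) := by
    intro t ht ψ hψ
    have hv : velocity (fun t => proj (c t)) t = dproj (c t) w := by
      refine velocity_proj_comp ht ?_
      have h1 : HasDerivWithinAt (fun t : ℝ => x.1 + t • w) w (Set.Icc 0 1) t := by
        have := ((hasDerivAt_id t).smul_const w).const_add x.1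
        rw [one_smul] at this
        exact this.hasDerivWithinAt
      exact h1.congr hcI (hcI t ht)
    have hf : SmoothSectionAt (frame q : ∀ q, F q) (proj (c t)) := smoothSectionAt_frame (hcb t)
    have h1 := hasDerivWithinAt_inner_section hnab hc ht hψ hf
    have h2 : nab (frame q) (proj (c t)) (velocity (fun t => proj (c t)) t) =
        g t • frame q (proj (c t)) := by
      rw [hv]
      exact connForm_smul_frame (hcb t) w
    rw [h2, inner_smul_right] at h1
    have h3 := ((hθd t).neg.cexp.hasDerivWithinAt (s := Set.Icc 0 1)).mul h1
    simp only [inner_smul_right]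
    refine h3.congr_deriv ?_
    simp only [Pi.neg_apply]
    ring
  have h := hI c hc _ hpar
  have hk0 : k 0 = 0 := hkI 0 (by simp)
  have hk1 : k 1 = 1 := hkI 1 (by simp)
  have e0 : c 0 = x := Subtype.ext (by simp [c, hk0])
  have e1 : (c 1).1 = x.1 + w := by simp [c, hk1]
  simp only [map_smul, smul_eq_mul] at h
  rw [← pull_coe I, ← pull_coe I, e0, e1, pull_coe] at h
  have hθ0 : θ 0 = 0 := by simp [hθ]
  rw [hθ0, neg_zero, Complex.exp_zero, one_mul] at h
  rw [← h, mul_right_comm, ← Complex.exp_add, neg_add_cancel, Complex.exp_zero, one_mul]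

end ParallelTransport

/-! ### The connection in the trivialization -/

section LiftDerivative

open Filter

attribute [local instance] continuousSMul_ordSpace

variable {N d : ℕ}

/-- The mean of a covector field along the segment from `x` to `x + w` is differentiable at
`w = 0`, with the value of the field at `x` as derivative. -/
theorem hasFDerivAt_integral_segment {X : Type*} [NormedAddCommGroup X] [NormedSpace ℝ X]
    {a : X → X →L[ℝ] ℂ} {x : X} (ha : ContinuousAt a x)
    (ha' : ∀ᶠ y in 𝓝 x, ContinuousAt a y) :
    HasFDerivAt (fun w => ∫ t in (0 : ℝ)..1,
      a (x + (Set.projIcc (0 : ℝ) 1 zero_le_one t : ℝ) • w) w) (a x) 0 := by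
  set k : ℝ → ℝ := fun t => (Set.projIcc (0 : ℝ) 1 zero_le_one t : ℝ) with hk
  have hkc : Continuous k := continuous_subtype_val.comp continuous_projIcc
  have hk1 : ∀ t, ‖k t‖ ≤ 1 := fun t => by
    have := (Set.projIcc (0 : ℝ) 1 zero_le_one t).2
    rw [Real.norm_of_nonneg this.1]
    exact this.2
  rw [hasFDerivAt_iff_isLittleO, Asymptotics.isLittleO_iff]
  intro ε hε
  obtain ⟨r, hr, h⟩ := Metric.eventually_nhds_iff_ball.1
    (ha'.and (Metric.continuousAt_iff'.1 ha ε hε))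
  filter_upwards [Metric.ball_mem_nhds (0 : X) hr] with w hw
  rw [mem_ball_zero_iff] at hw
  have hball : ∀ t, x + k t • w ∈ Metric.ball x r := fun t => by
    rw [mem_ball_iff_norm, add_sub_cancel_left, norm_smul]
    calc ‖k t‖ * ‖w‖ ≤ 1 * ‖w‖ := by gcongr; exact hk1 t
      _ < r := by rwa [one_mul]
  have hgc : Continuous fun t => a (x + k t • w) w := by
    have h1 : Continuous fun t => a (x + k t • w) := by
      rw [continuous_iff_continuousAt]
      intro t
      have h2 : Continuous fun t => x + k t • w := by fun_prop
      exact ContinuousAt.comp (f := fun t => x + k t • w) (h _ (hball t)).1 h2.continuousAt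
    exact h1.clm_apply continuous_const
  have e : (∫ t in (0 : ℝ)..1, a (x + k t • w) w) - a x w =
      ∫ t in (0 : ℝ)..1, (a (x + k t • w) w - a x w) := by
    rw [intervalIntegral.integral_sub (hgc.intervalIntegrable _ _)
      (continuous_const.intervalIntegrable _ _)]
    simp
  simp only [map_zero, intervalIntegral.integral_zero, sub_zero]
  rw [e]
  have := intervalIntegral.norm_integral_le_of_norm_le_const (a := (0 : ℝ)) (b := 1)
    (f := fun t => a (x + k t • w) w - a x w) (C := ε * ‖w‖) fun t _ => by
      rw [← sub_apply]
      refine (ContinuousLinearMap.le_opNorm _ _).trans ?_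
      gcongr
      rw [← dist_eq_norm]
      exact (h _ (hball t)).2.le
  simpa using this

variable {F : Conf N d → Type*}
  [∀ q, NormedAddCommGroup (F q)] [∀ q, InnerProductSpace ℂ (F q)]
  [TopologicalSpace (TotalSpace ℂ F)] [FiberBundle ℂ F] [VectorBundle ℂ ℂ F]
  [ContMDiffVectorBundle ∞ ℂ F 𝓘(ℝ, OrdSpace N d)] [SmoothFiberMetric F]
  {nab : CovariantDerivative 𝓘(ℝ, OrdSpace N d) ℂ F}

/-- The trivialization `Î` carries the connection `∇` into the differential. -/
theorem hasFDerivAt_pull (hnab : IsHermitianConnection nab)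
    {I : ∀ x : OrdConf N d, F (proj x) ≃ₗᵢ[ℂ] ℂ} (hI : IsLiftTrivialization nab I)
    {ψ : ∀ q, F q} {x : OrdConf N d} (hψ : SmoothSectionAt ψ (proj x)) :
    HasFDerivAt (pull I ψ) (pullNab nab I ψ x) x.1 := by
  have : Nonempty (OrdConf N d) := ⟨x⟩
  set q := proj x with hq
  set e := trivializationAt ℂ F q
  have hqb : q ∈ e.baseSet := FiberBundle.mem_baseSet_trivializationAt ℂ F q
  have hf : SmoothSectionAt (frame q : ∀ q, F q) q := smoothSectionAt_frame hqb
  have hb : ∀ᶠ y in 𝓝 x, proj y ∈ e.baseSet :=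
    continuous_proj.continuousAt.eventually_mem (e.open_baseSet.mem_nhds hqb)
  have hcf := eventually_continuousAt_connForm hnab x
  obtain ⟨r, hr0, hr⟩ := Metric.eventually_nhds_iff_ball.1 (hcf.and (eventually_coe_ordConf hb))
  set b : OrdSpace N d → ℂ := fun w => ∫ t in (0 : ℝ)..1,
    connForm nab q (x.1 + (Set.projIcc (0 : ℝ) 1 zero_le_one t : ℝ) • w) w with hbdef
  have hbd : HasFDerivAt b (connForm nab q x.1) 0 :=
    hasFDerivAt_integral_segment hcf.self_of_nhds hcf
  have hb0 : b 0 = 0 := by simp [hbdef]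
  set h0 := I x (frame q (proj x)) with hh0
  have hf0 : (frame q (proj x) : F (proj x)) ≠ 0 := by
    intro h
    have h1 := e.continuousLinearMapAt_symmL (R := ℂ) hqb (1 : ℂ)
    change e.continuousLinearMapAt ℂ q (frame q q) = 1 at h1
    rw [← hq] at h
    rw [h, map_zero] at h1
    exact zero_ne_one h1
  have hh0' : h0 ≠ 0 := by
    rw [hh0]
    exact fun h => hf0 ((I x).map_eq_zero_iff.1 h)
  set Q : Conf N d → ℂ := fun p => inner ℂ (frame q p) (ψ p) with hQ
  have hQd := SmoothFiberMetric.contMDiffAt_inner (frame q) ψ q hf hψ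
  have hQ1 : HasFDerivAt (fun y => Q (projExt y)) ((dConf Q (proj x)).comp
      (dproj x : OrdSpace N d →L[ℝ] OrdSpace N d)) x.1 :=
    hasFDerivAt_comp_projExt (hQd.mdifferentiableAt (by simp))
  -- the frame is `h₀ exp b` in the trivialization, and the trivialization is unitary
  have heq : pull I ψ =ᶠ[𝓝 x.1] fun y => ((starRingEnd ℂ) h0)⁻¹ *
      ((starRingEnd ℂ) (Complex.exp (-b (y - x.1))) * Q (projExt y)) := by
    filter_upwards [Metric.ball_mem_nhds x.1 hr0] with y hy
    obtain ⟨-, hy1, -⟩ := hr y hy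
    have h1 := pull_frame_segment hnab hI hr (w := y - x.1) (mem_ball_iff_norm.1 hy)
    rw [add_sub_cancel, pull_coe I (frame q) ⟨y, hy1⟩] at h1
    have h2 := (I ⟨y, hy1⟩).inner_map_map (frame q (proj ⟨y, hy1⟩)) (ψ (proj ⟨y, hy1⟩))
    rw [pull_coe I ψ ⟨y, hy1⟩, projExt_coe ⟨y, hy1⟩, hQ]
    simp only
    rw [← h2, h1, RCLike.inner_apply, map_mul, ← hh0]
    have h3 : (starRingEnd ℂ) (Complex.exp (-b (y - x.1))) *
        (starRingEnd ℂ) (Complex.exp (b (y - x.1))) = 1 := by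
      rw [← map_mul, ← Complex.exp_add, neg_add_cancel, Complex.exp_zero, map_one]
    have h4 : (starRingEnd ℂ) h0 ≠ 0 := (map_ne_zero _).2 hh0'
    rw [eq_inv_mul_iff_mul_eq₀ h4]
    linear_combination (-(starRingEnd ℂ) h0 * I ⟨y, hy1⟩ (ψ (proj ⟨y, hy1⟩))) * h3
  have hexp : HasFDerivAt (fun y : OrdSpace N d => (starRingEnd ℂ) (Complex.exp (-b (y - x.1))))
      ((Complex.conjCLE : ℂ →L[ℝ] ℂ).comp (-(connForm nab q x.1))) x.1 := by
    have h1 : HasFDerivAt (fun y : OrdSpace N d => b (y - x.1)) (connForm nab q x.1) x.1 := by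
      have h2 : HasFDerivAt b (connForm nab q x.1) (x.1 - x.1) := by rwa [sub_self]
      have h3 := HasFDerivAt.comp (f := fun y => y - x.1) x.1 h2
        ((hasFDerivAt_id x.1).sub_const x.1)
      rwa [ContinuousLinearMap.comp_id] at h3
    have h3 := h1.neg.cexp
    simp only [sub_self, hb0, neg_zero, Complex.exp_zero, one_smul, Pi.neg_apply] at h3
    exact (Complex.conjCLE : ℂ →L[ℝ] ℂ).hasFDerivAt.comp x.1 h3
  have hfin := ((hexp.mul hQ1).const_mul ((starRingEnd ℂ) h0)⁻¹).congr_of_eventuallyEq heq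
  refine hfin.congr_fderiv (ContinuousLinearMap.ext fun v => ?_)
  have hm : dConf Q (proj x) (dproj x v) =
      inner ℂ (nab (frame q) (proj x) (dproj x v)) (ψ (proj x)) +
        inner ℂ (frame q (proj x)) (nab ψ (proj x) (dproj x v)) :=
    hnab.metric (frame q) ψ (proj x) (dproj x v) hf hψ
  rw [connForm_smul_frame hqb, inner_smul_left] at hm
  have hi : inner ℂ (frame q (proj x)) (nab ψ (proj x) (dproj x v)) =
      (starRingEnd ℂ) h0 * pullNab nab I ψ x v := by
    rw [← (I x).inner_map_map, RCLike.inner_apply, mul_comm]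
    rfl
  have hc : (starRingEnd ℂ) h0 ≠ 0 := (map_ne_zero _).2 hh0'
  have hQx : Q (projExt x.1) = inner ℂ (frame q (proj x)) (ψ (proj x)) := by
    rw [projExt_coe]
  simp only [add_apply, smul_apply, ContinuousLinearMap.comp_apply, sub_self, hb0, neg_zero,
    Complex.exp_zero, map_one, hQx, smul_eq_mul]
  change ((starRingEnd ℂ) h0)⁻¹ * (1 * dConf Q (proj x) (dproj x v) +
    inner ℂ (frame q (proj x)) (ψ (proj x)) * (starRingEnd ℂ) (-(connForm nab q x.1 v))) = _
  rw [hm, hi, map_neg, inv_mul_eq_iff_eq_mul₀ hc]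
  ring

end LiftDerivative

/-! ### Anti-symmetry of lifts -/

section Equivariance

open Filter

attribute [local instance] continuousSMul_ordSpace

variable {N d : ℕ}

/-- In dimension `d ≥ 2` any two collision-free configurations are joined by a smooth path of
collision-free configurations. The straight path, bent by `t(1 - t) i w` for the `i`-th particle,
has no collisions unless `w` lies on one of finitely many curves in `ℝ^d`. -/
theorem exists_smooth_path (hd : 2 ≤ d) (x y : OrdConf N d) :
    ∃ c : ℝ → OrdConf N d, IsSmoothPath c ∧ c 0 = x ∧ c 1 = y := by
  -- at time `t`, particles `p.1` and `p.2` collide if and only if `w = g p t`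
  let g : Fin N × Fin N → ℝ → EuclideanSpace ℝ (Fin d) := fun p t =>
    -(t * (1 - t) * ((p.1 : ℝ) - (p.2 : ℝ)))⁻¹ •
      ((x.1 p.1 - x.1 p.2) + t • ((y.1 p.1 - y.1 p.2) - (x.1 p.1 - x.1 p.2)))
  have hg : ∀ p : Fin N × Fin N, p.1 ≠ p.2 → ContDiffOn ℝ 1 (g p) (Set.Ioo 0 1) := by
    intro p hp
    have hp' : ((p.1 : ℝ) - (p.2 : ℝ)) ≠ 0 := by
      rw [sub_ne_zero]
      exact fun h => hp (Fin.ext (by exact_mod_cast h))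
    have h1 : ContDiffOn ℝ 1 (fun t : ℝ => (t * (1 - t) * ((p.1 : ℝ) - (p.2 : ℝ)))⁻¹)
        (Set.Ioo 0 1) := by
      refine ContDiffOn.inv (by fun_prop) fun t ht => ?_
      have := ht.1.ne'
      have := (sub_pos.2 ht.2).ne'
      positivity
    exact h1.neg.smul (by fun_prop)
  have hdim : dimH (⋃ p : {p : Fin N × Fin N // p.1 ≠ p.2}, g p.1 '' Set.Ioo 0 1) <
      Module.finrank ℝ (EuclideanSpace ℝ (Fin d)) := by
    rw [dimH_iUnion, finrank_euclideanSpace, Fintype.card_fin]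
    refine lt_of_le_of_lt (b := 1) (iSup_le fun p => ?_) (by exact_mod_cast hd)
    calc dimH (g p.1 '' Set.Ioo 0 1) ≤ dimH (Set.Ioo (0 : ℝ) 1) :=
          (hg p.1 p.2).dimH_image_le (convex_Ioo 0 1) subset_rfl
      _ ≤ dimH (Set.univ : Set ℝ) := dimH_mono (Set.subset_univ _)
      _ = 1 := Real.dimH_univ
  obtain ⟨w, hw⟩ := (dense_compl_of_dimH_lt_finrank hdim).nonempty
  let k : ℝ → ℝ := fun t => (Set.projIcc (0 : ℝ) 1 zero_le_one t : ℝ)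
  have hk : ∀ t, k t ∈ Set.Icc (0 : ℝ) 1 := fun t => (Set.projIcc (0 : ℝ) 1 zero_le_one t).2
  have hkI : ∀ t ∈ Set.Icc (0 : ℝ) 1, k t = t := fun t ht => by
    simp only [k, Set.projIcc_of_mem zero_le_one ht]
  let W : OrdSpace N d := WithLp.toLp 2 fun i => (i : ℝ) • w
  let p : ℝ → OrdSpace N d := fun t => x.1 + t • (y.1 - x.1) + (t * (1 - t)) • W
  have hp : ∀ t ∈ Set.Icc (0 : ℝ) 1, p t ∈ OrdConf N d := by
    intro t ht
    rcases eq_or_ne t 0 with rfl | h0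
    · have : p 0 = x.1 := by simp [p]
      rw [this]
      exact x.2
    rcases eq_or_ne t 1 with rfl | h1
    · have : p 1 = y.1 := by simp [p]
      rw [this]
      exact y.2
    intro i j hij
    by_contra hne
    refine hw (Set.mem_iUnion.2 ⟨⟨(i, j), hne⟩, t,
      ⟨lt_of_le_of_ne ht.1 h0.symm, lt_of_le_of_ne ht.2 h1⟩, ?_⟩)
    have hij' : ((i : ℝ) - (j : ℝ)) ≠ 0 := by
      rw [sub_ne_zero]
      exact fun h => hne (Fin.ext (by exact_mod_cast h))
    have h2 : t * (1 - t) * ((i : ℝ) - (j : ℝ)) ≠ 0 :=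
      mul_ne_zero (mul_ne_zero h0 (sub_ne_zero.2 h1.symm)) hij'
    have h3 : x.1 i + t • (y.1 i - x.1 i) + (t * (1 - t)) • ((i : ℝ) • w) =
        x.1 j + t • (y.1 j - x.1 j) + (t * (1 - t)) • ((j : ℝ) • w) := by
      simpa [p, W] using hij
    have h4 : (x.1 i - x.1 j) + t • ((y.1 i - y.1 j) - (x.1 i - x.1 j)) =
        -((t * (1 - t) * ((i : ℝ) - (j : ℝ))) • w) := by
      rw [← sub_eq_zero] at h3 ⊢
      rw [← h3]
      module
    change -(t * (1 - t) * ((i : ℝ) - (j : ℝ)))⁻¹ •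
      ((x.1 i - x.1 j) + t • ((y.1 i - y.1 j) - (x.1 i - x.1 j))) = w
    rw [h4, smul_neg, neg_smul, neg_neg, inv_smul_smul₀ h2]
  refine ⟨fun t => ⟨p (k t), hp _ (hk t)⟩, ?_, ?_, ?_⟩
  · have h : ContDiffOn ℝ ∞ p (Set.Icc 0 1) := by fun_prop
    exact h.congr fun t ht => by simp only [hkI t ht]
  · refine Subtype.ext ?_
    simp [p, hkI 0 (by simp)]
  · refine Subtype.ext ?_
    simp [p, hkI 1 (by simp)]

variable {F : Conf N d → Type*}
  [∀ q, NormedAddCommGroup (F q)] [∀ q, InnerProductSpace ℂ (F q)]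
  [TopologicalSpace (TotalSpace ℂ F)] [FiberBundle ℂ F] [VectorBundle ℂ ℂ F]
  [ContMDiffVectorBundle ∞ ℂ F 𝓘(ℝ, OrdSpace N d)] [SmoothFiberMetric F]
  {nab : CovariantDerivative 𝓘(ℝ, OrdSpace N d) ℂ F}

/-- The unit vectors of `F` given by the trivialization `Î` are parallel along every path. -/
theorem isParallelAlong_symm_one (hnab : IsHermitianConnection nab)
    {I : ∀ x : OrdConf N d, F (proj x) ≃ₗᵢ[ℂ] ℂ} (hI : IsLiftTrivialization nab I)
    {c : ℝ → OrdConf N d} (hc : IsSmoothPath c) :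
    IsParallelAlong nab (fun t => proj (c t)) fun t => (I (c t)).symm 1 := by
  intro t ht ψ hψ
  have key : ∀ (x : OrdConf N d) (v : F (proj x)),
      inner ℂ v ((I x).symm 1) = (starRingEnd ℂ) (I x v) := by
    intro x v
    rw [← (I x).inner_map_map, LinearIsometryEquiv.apply_symm_apply, RCLike.inner_apply, one_mul]
  have h1 := ((hc.differentiableOn (by simp)) t ht).hasDerivWithinAt
  have h2 := (hasFDerivAt_pull hnab hI hψ).comp_hasDerivWithinAt t h1
  have h3 := (Complex.conjCLE : ℂ →L[ℝ] ℂ).hasFDerivAt.comp_hasDerivWithinAt t h2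
  have e : ((Complex.conjCLE : ℂ →L[ℝ] ℂ) ∘ pull I ψ ∘ fun t => (c t : OrdSpace N d)) =
      fun τ => inner ℂ (ψ (proj (c τ))) ((I (c τ)).symm 1) := by
    funext τ
    rw [key]
    exact congrArg (starRingEnd ℂ) (pull_coe I ψ (c τ))
  rw [e] at h3
  refine h3.congr_deriv ?_
  rw [key, velocity_proj_comp ht h1]
  rfl

/-- The lift of a section is anti-symmetric, as the holonomies of `∇` are the signs of the
permutations. -/
theorem pull_permute (hd : 2 ≤ d) (hnab : IsHermitianConnection nab)
    (hF : HasFermionicHolonomy nab)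
    {I : ∀ x : OrdConf N d, F (proj x) ≃ₗᵢ[ℂ] ℂ} (hI : IsLiftTrivialization nab I)
    (ψ : ∀ q, F q) (σ : Equiv.Perm (Fin N)) (y : OrdSpace N d) :
    pull I ψ (permute σ y) = ((Equiv.Perm.sign σ : ℤ) : ℂ) * pull I ψ y := by
  by_cases hy : y ∈ OrdConf N d
  · obtain ⟨c, hc, hc0, hc1⟩ := exists_smooth_path hd ⟨y, hy⟩ (reorder σ ⟨y, hy⟩)
    have h := hF c hc σ (by rw [hc1, hc0]) _ (isParallelAlong_symm_one hnab hI hc)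
    have h1 := congrArg (fun z : TotalSpace ℂ F => inner ℂ z.2 (ψ z.1)) h
    have key : ∀ (x : OrdConf N d) (v : F (proj x)),
        inner ℂ ((I x).symm 1) v = I x v := by
      intro x v
      rw [← (I x).inner_map_map, LinearIsometryEquiv.apply_symm_apply, RCLike.inner_apply,
        map_one, mul_one]
    simp only [inner_smul_left, map_intCast, key] at h1
    rw [← pull_coe I ψ (c 1), ← pull_coe I ψ (c 0), hc0, hc1] at h1
    exact h1
  · have hy' : permute σ y ∉ OrdConf N d := by
      intro h
      have h1 := permute_mem_ordConf h σ⁻¹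
      rw [permute_permute, mul_inv_cancel] at h1
      have h2 : permute (1 : Equiv.Perm (Fin N)) y = y := by
        ext i
        simp
      rw [h2] at h1
      exact hy h1
    rw [pull, pull, dif_neg hy, dif_neg hy', mul_zero]

end Equivariance

/-! ### Smoothness and Laplacian of lifts -/

section LiftLaplacian

open Filter

attribute [local instance] continuousSMul_ordSpace

variable {N d : ℕ} {F : Conf N d → Type*}
  [∀ q, NormedAddCommGroup (F q)] [∀ q, InnerProductSpace ℂ (F q)]
  [TopologicalSpace (TotalSpace ℂ F)] [FiberBundle ℂ F] [VectorBundle ℂ ℂ F]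
  {nab : CovariantDerivative 𝓘(ℝ, OrdSpace N d) ℂ F}

/-- In the trivialization `Î`, the constant vector fields on `ℝ^{Nd}` act on sections as the
covariant derivatives along the coordinate fields. -/
theorem exists_perm_pullNab (hnab : IsHermitianConnection nab)
    (I : ∀ x : OrdConf N d, F (proj x) ≃ₗᵢ[ℂ] ℂ) (x : OrdConf N d) :
    ∃ τ : Equiv.Perm (Fin N), ∀ ψ : ∀ q, F q, (∀ᶠ p in 𝓝 (proj x), SmoothSectionAt ψ p) →
      (∀ᶠ y in 𝓝 x, ∀ v, pullNab nab I ψ y v =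
        pull I (fun p => nab ψ p (coordField (proj x) (permute τ v) p)) y.1) ∧
      ∀ v, ∀ᶠ p in 𝓝 (proj x),
        SmoothSectionAt (fun p => nab ψ p (coordField (proj x) (permute τ v) p)) p := by
  obtain ⟨τ, h⟩ := exists_perm_dproj x
  refine ⟨τ, fun ψ hψ => ⟨?_, fun v => ?_⟩⟩
  · filter_upwards [h] with y hy v
    rw [pull_coe, ← hy.2 v]
    rfl
  · filter_upwards [hψ.eventually_nhds,
      (chartAt (OrdSpace N d) (proj x)).open_source.mem_nhds
        (mem_chart_source (OrdSpace N d) (proj x))] with p hp hp'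
    exact smoothSectionAt_nab_coordField hnab hp' hp _

variable [ContMDiffVectorBundle ∞ ℂ F 𝓘(ℝ, OrdSpace N d)] [SmoothFiberMetric F]

theorem eventually_hasFDerivAt_pull (hnab : IsHermitianConnection nab)
    {I : ∀ x : OrdConf N d, F (proj x) ≃ₗᵢ[ℂ] ℂ} (hI : IsLiftTrivialization nab I)
    {ψ : ∀ q, F q} {x : OrdConf N d} (hψ : ∀ᶠ p in 𝓝 (proj x), SmoothSectionAt ψ p) :
    ∀ᶠ y in 𝓝 x.1, ∃ h : y ∈ OrdConf N d,
      HasFDerivAt (pull I ψ) (pullNab nab I ψ ⟨y, h⟩) y := by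
  refine eventually_coe_ordConf (P := fun y => HasFDerivAt (pull I ψ) (pullNab nab I ψ y) y.1) ?_
  filter_upwards [continuous_proj.continuousAt.eventually hψ] with y hy
    using hasFDerivAt_pull hnab hI hy

/-- Lifts of smooth sections are smooth: the partial derivatives of a lift are lifts of covariant
derivatives along coordinate fields, which are smooth sections again. -/
theorem contDiffAt_pull (hnab : IsHermitianConnection nab)
    {I : ∀ x : OrdConf N d, F (proj x) ≃ₗᵢ[ℂ] ℂ} (hI : IsLiftTrivialization nab I)
    {ψ : ∀ q, F q} {x : OrdConf N d} (hψ : ∀ᶠ p in 𝓝 (proj x), SmoothSectionAt ψ p) :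
    ContDiffAt ℝ ∞ (pull I ψ) x.1 := by
  rw [contDiffAt_infty]
  intro n
  induction n generalizing ψ x with
  | zero =>
    rw [Nat.cast_zero, contDiffAt_zero]
    exact ⟨_, eventually_hasFDerivAt_pull hnab hI hψ,
      fun y hy => hy.2.continuousAt.continuousWithinAt⟩
  | succ n ih =>
    obtain ⟨τ, h⟩ := exists_perm_pullNab hnab I x
    obtain ⟨h1, h2⟩ := h ψ hψ
    rw [Nat.cast_succ, contDiffAt_succ_iff_hasFDerivAt]
    refine ⟨fderiv ℝ (pull I ψ), ⟨_, eventually_hasFDerivAt_pull hnab hI hψ, fun y hy => ?_⟩, ?_⟩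
    · exact hy.2.differentiableAt.hasFDerivAt
    · have h3 : ∀ᶠ y in 𝓝 x.1, ∀ v, fderiv ℝ (pull I ψ) y v =
          pull I (fun p => nab ψ p (coordField (proj x) (permute τ v) p)) y := by
        filter_upwards [eventually_hasFDerivAt_pull hnab hI hψ, eventually_coe_ordConf h1]
          with y hy hy' v
        obtain ⟨hy0, hy1⟩ := hy
        rw [hy1.fderiv, hy'.2 v]
      -- near `x`, the coordinates of the differential are lifts of smooth sections
      have h4 : ∀ᶠ y in 𝓝 x.1, ∀ v, ContDiffAt ℝ n (fun y => fderiv ℝ (pull I ψ) y v) y := by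
        have h5 : ∀ᶠ y in 𝓝 x, ∀ᶠ p in 𝓝 (proj y), SmoothSectionAt ψ p :=
          continuous_proj.continuousAt.eventually hψ.eventually_nhds
        have h6 : ∀ᶠ y in 𝓝 x, proj y ∈ (chartAt (OrdSpace N d) (proj x)).source :=
          continuous_proj.continuousAt.eventually_mem
            ((chartAt (OrdSpace N d) (proj x)).open_source.mem_nhds
              (mem_chart_source (OrdSpace N d) (proj x)))
        filter_upwards [h3.eventually_nhds, eventually_coe_ordConf (h5.and h6)] with y hy hy' v
        obtain ⟨hy0, hy1, hy2⟩ := hy'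
        have h7 := ih (x := ⟨y, hy0⟩)
          (ψ := fun p => nab ψ p (coordField (proj x) (permute τ v) p)) (by
          filter_upwards [hy1.eventually_nhds,
            (chartAt (OrdSpace N d) (proj x)).open_source.mem_nhds hy2] with p hp hp'
          exact smoothSectionAt_nab_coordField hnab hp' hp _)
        exact h7.congr_of_eventuallyEq (hy.mono fun z hz => hz v)
      obtain ⟨r, hr0, hr⟩ := Metric.eventually_nhds_iff_ball.1 h4
      have h8 : ContDiffOn ℝ n (fderiv ℝ (pull I ψ)) (Metric.ball x.1 r) :=
        contDiffOn_clm_apply.2 fun v y hy => (hr y hy v).contDiffWithinAt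
      exact h8.contDiffAt (Metric.ball_mem_nhds _ hr0)

/-- The lift of the Laplacian of a section is the Laplacian of the lift. -/
theorem laplacian_pull (hnab : IsHermitianConnection nab)
    {I : ∀ x : OrdConf N d, F (proj x) ≃ₗᵢ[ℂ] ℂ} (hI : IsLiftTrivialization nab I)
    {ψ : ∀ q, F q} (hψ : ∀ q, SmoothSectionAt ψ q) (x : OrdConf N d) :
    Laplacian.laplacian (pull I ψ) x.1 = I x (laplacianSection nab ψ (proj x)) := by
  obtain ⟨τ, h⟩ := exists_perm_pullNab hnab I x
  have hC : ContDiffAt ℝ ∞ (pull I ψ) x.1 :=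
    contDiffAt_pull hnab hI (Eventually.of_forall hψ)
  have hD : DifferentiableAt ℝ (fderiv ℝ (pull I ψ)) x.1 := by
    have h1 : ContDiffAt ℝ 1 (fderiv ℝ (pull I ψ)) x.1 :=
      hC.fderiv_right (WithTop.coe_le_coe.2 le_top)
    exact h1.differentiableAt (by simp)
  have key : ∀ v : OrdSpace N d, iteratedFDeriv ℝ 2 (pull I ψ) x.1 ![v, v] =
      I x (nab (fun p => nab ψ p (coordField (proj x) (permute τ v) p)) (proj x)
        (coordField (proj x) (permute τ v) (proj x))) := by
    intro v
    set ψv : ∀ q, F q := fun p => nab ψ p (coordField (proj x) (permute τ v) p) with hψv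
    obtain ⟨h1, h2⟩ := h ψ (Eventually.of_forall hψ)
    have h3 : (fun y => fderiv ℝ (pull I ψ) y v) =ᶠ[𝓝 x.1] pull I ψv := by
      filter_upwards [eventually_hasFDerivAt_pull hnab hI (Eventually.of_forall hψ),
        eventually_coe_ordConf h1] with y hy hy'
      obtain ⟨hy0, hy1⟩ := hy
      rw [hy1.fderiv, hy'.2 v]
    obtain ⟨h4, -⟩ := h ψv (h2 v)
    have h5 : HasFDerivAt (pull I ψv) (pullNab nab I ψv x) x.1 :=
      hasFDerivAt_pull hnab hI (h2 v).self_of_nhds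
    have h6 := (h5.congr_of_eventuallyEq h3).fderiv
    have h7 : fderiv ℝ (fun y => fderiv ℝ (pull I ψ) y v) x.1 v =
        fderiv ℝ (fderiv ℝ (pull I ψ)) x.1 v v := by
      rw [fderiv_clm_apply hD (differentiableAt_const v)]
      simp
    rw [iteratedFDeriv_two_apply]
    simp only [Matrix.cons_val_zero, Matrix.cons_val_one]
    rw [← h7, h6, h4.self_of_nhds v, pull_coe]
  -- the orthonormal basis is chosen so that `τ` maps it to the basis defining `laplacianSection`
  rw [InnerProductSpace.laplacian_eq_iteratedFDeriv_orthonormalBasis _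
    ((stdOrthonormalBasis ℝ (OrdSpace N d)).map (permute τ).symm)]
  simp only [key, laplacianSection, map_sum, OrthonormalBasis.map_apply,
    LinearIsometryEquiv.apply_symm_apply]

end LiftLaplacian

/-! ### Measurability of lifts -/

section LiftMeasurable

open Filter

attribute [local instance] continuousSMul_ordSpace

variable {N d : ℕ}

theorem measurable_countable_glue {α β : Type*} [MeasurableSpace α] [MeasurableSpace β]
    {n : α → ℕ} (hn : Measurable n) {g : ℕ → α → β} (hg : ∀ k, Measurable (g k)) :
    Measurable fun a => g (n a) a := by
  have : Measurable fun p : ℕ × α => g p.1 p.2 := measurable_from_prod_countable_right hg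
  exact this.comp (hn.prodMk measurable_id)

theorem measurable_projExt [Nonempty (OrdConf N d)] :
    Measurable (projExt : OrdSpace N d → Conf N d) := by
  classical
  have hc : ContinuousOn (projExt : OrdSpace N d → Conf N d) (OrdConf N d) := fun y hy =>
    (contMDiffAt_projExt hy).continuousAt.continuousWithinAt
  have := hc.measurable_piecewise
    (continuousOn_const (c := proj (Classical.arbitrary (OrdConf N d))))
    (OrdConf N d).isOpen.measurableSet
  convert this using 1
  ext y : 1
  by_cases hy : y ∈ OrdConf N d
  · exact (Set.piecewise_eq_of_mem _ _ _ hy).symm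
  · rw [Set.piecewise_eq_of_notMem _ _ _ hy]
    exact dif_neg hy

/-- A measurable choice of an ordering. -/
theorem exists_measurable_ordering [Nonempty (OrdConf N d)] :
    ∃ s : Conf N d → OrdSpace N d, Measurable s ∧
      ∀ q, ∃ h : s q ∈ OrdConf N d, proj ⟨s q, h⟩ = q := by
  classical
  obtain ⟨t, ht, ht'⟩ := TopologicalSpace.countable_cover_nhds
    (f := fun q : Conf N d => (chartAt (OrdSpace N d) q).source)
    (fun q => (chartAt (OrdSpace N d) q).open_source.mem_nhds (mem_chart_source _ q))
  have hex' : ∀ q, ∃ p ∈ t, q ∈ (chartAt (OrdSpace N d) p).source := by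
    intro q
    have : q ∈ (Set.univ : Set (Conf N d)) := trivial
    rw [← ht'] at this
    simpa using this
  have hne : t.Nonempty := by
    obtain ⟨p, hp, -⟩ := hex' (proj (Classical.arbitrary (OrdConf N d)))
    exact ⟨p, hp⟩
  obtain ⟨c, rfl⟩ := ht.exists_eq_range hne
  have hex : ∀ q, ∃ k, q ∈ (chartAt (OrdSpace N d) (c k)).source := fun q => by
    simpa using hex' q
  have hn : Measurable fun q => Nat.find (hex q) :=
    measurable_find hex fun k => (chartAt (OrdSpace N d) (c k)).open_source.measurableSet
  let g : ℕ → Conf N d → OrdSpace N d := fun k =>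
    (chartAt (OrdSpace N d) (c k)).source.piecewise (chartAt (OrdSpace N d) (c k)) fun _ => 0
  have hg : ∀ k, Measurable (g k) := fun k =>
    (chartAt (OrdSpace N d) (c k)).continuousOn.measurable_piecewise continuousOn_const
      (chartAt (OrdSpace N d) (c k)).open_source.measurableSet
  refine ⟨fun q => g (Nat.find (hex q)) q, measurable_glue hn hg, fun q => ?_⟩
  have hq := Nat.find_spec (hex q)
  obtain ⟨z, hz, hez⟩ := exists_eq_chart (chart_mem_atlas (OrdSpace N d) (c (Nat.find (hex q)))) hq
  have e : g (Nat.find (hex q)) q = z.1 :=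
    (Set.piecewise_eq_of_mem _ _ _ hq).trans hez
  simp only [e]
  exact ⟨z.2, hz⟩

/-- Integrals over `ᴺℝ^d` are `1/N!` times integrals over the ordered configurations. -/
theorem lintegral_confVolume [Nonempty (OrdConf N d)] {g : Conf N d → ℝ≥0∞} (hg : Measurable g) :
    ∫⁻ q, g q ∂(confVolume N d) =
      (N.factorial : ℝ≥0∞)⁻¹ * ∫⁻ y in (OrdConf N d : Set (OrdSpace N d)), g (projExt y) := by
  have he : MeasurableEmbedding (Subtype.val : OrdConf N d → OrdSpace N d) :=
    MeasurableEmbedding.subtype_coe (OrdConf N d).isOpen.measurableSet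
  rw [confVolume, lintegral_smul_measure, smul_eq_mul,
    lintegral_map hg continuous_proj.measurable]
  congr 1
  have h1 := he.lintegral_map (μ := Measure.comap Subtype.val (volume : Measure (OrdSpace N d)))
    fun y => g (projExt y)
  simp only [projExt_coe] at h1
  rw [← h1, he.map_comap, Subtype.range_coe]

variable {F : Conf N d → Type*}
  [∀ q, NormedAddCommGroup (F q)] [∀ q, InnerProductSpace ℂ (F q)]

theorem liftSection_eq (I : ∀ x : OrdConf N d, F (proj x) ≃ₗᵢ[ℂ] ℂ) (ψ : ∀ q, F q) :
    liftSection I ψ = fun y => ((1 / Real.sqrt N.factorial : ℝ) : ℂ) * pull I ψ y := by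
  funext y
  by_cases hy : y ∈ OrdConf N d
  · rw [liftSection, pull, dif_pos hy, dif_pos hy]
  · rw [liftSection, pull, dif_neg hy, dif_neg hy, mul_zero]

variable [TopologicalSpace (TotalSpace ℂ F)] [FiberBundle ℂ F] [VectorBundle ℂ ℂ F]
  [ContMDiffVectorBundle ∞ ℂ F 𝓘(ℝ, OrdSpace N d)] [SmoothFiberMetric F]
  {nab : CovariantDerivative 𝓘(ℝ, OrdSpace N d) ℂ F}

/-- The lift of a local frame is continuous over its domain and vanishes outside. -/
theorem measurable_pull_frame (hnab : IsHermitianConnection nab)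
    {I : ∀ x : OrdConf N d, F (proj x) ≃ₗᵢ[ℂ] ℂ} (hI : IsLiftTrivialization nab I)
    (q : Conf N d) : Measurable (pull I (frame q)) := by
  classical
  rcases isEmpty_or_nonempty (OrdConf N d) with h | h
  · have : pull I (frame q) = fun _ => 0 := by
      funext y
      exact dif_neg fun hy => h.elim ⟨y, hy⟩
    rw [this]
    exact measurable_const
  set e := trivializationAt ℂ F q
  set S : Set (OrdSpace N d) := (OrdConf N d : Set (OrdSpace N d)) ∩ projExt ⁻¹' e.baseSet
  have hS : MeasurableSet S := (OrdConf N d).isOpen.measurableSet.inter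
    (measurable_projExt e.open_baseSet.measurableSet)
  have hc : ContinuousOn (pull I (frame q)) S := by
    rintro y ⟨hy, hy'⟩
    have hy'' : proj ⟨y, hy⟩ ∈ e.baseSet := by
      rw [← projExt_coe]
      exact hy'
    have h1 : ∀ᶠ p in 𝓝 (proj ⟨y, hy⟩), SmoothSectionAt (frame q : ∀ q, F q) p := by
      filter_upwards [e.open_baseSet.mem_nhds hy''] with p hp using smoothSectionAt_frame hp
    exact (contDiffAt_pull hnab hI h1).continuousAt.continuousWithinAt
  have := hc.measurable_piecewise (continuousOn_const (c := (0 : ℂ))) hS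
  convert this using 1
  ext y
  by_cases hy : y ∈ S
  · rw [Set.piecewise_eq_of_mem _ _ _ hy]
  · rw [Set.piecewise_eq_of_notMem _ _ _ hy]
    by_cases hy0 : y ∈ OrdConf N d
    · have h1 : proj ⟨y, hy0⟩ ∉ e.baseSet := by
        intro h1
        refine hy ⟨hy0, ?_⟩
        rw [Set.mem_preimage, projExt_coe ⟨y, hy0⟩]
        exact h1
      rw [pull_coe I _ ⟨y, hy0⟩, frame, e.symmL_apply_of_notMem h1, map_zero]
    · exact dif_neg hy0

/-- Over each of countably many domains, a section is a measurable multiple of a frame. -/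
theorem measurable_pull (hnab : IsHermitianConnection nab)
    {I : ∀ x : OrdConf N d, F (proj x) ≃ₗᵢ[ℂ] ℂ} (hI : IsLiftTrivialization nab I)
    {ψ : ∀ q, F q} (hψ : MeasurableSection ψ) : Measurable (pull I ψ) := by
  rcases isEmpty_or_nonempty (OrdConf N d) with h | h
  · have : pull I ψ = fun _ => 0 := by
      funext y
      exact dif_neg fun hy => h.elim ⟨y, hy⟩
    rw [this]
    exact measurable_const
  have : Nonempty (Conf N d) := h.map proj
  obtain ⟨c, n, hn, hmem⟩ := exists_index (F := F)
  have key : ∀ y, pull I ψ y =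
      (trivializationAt ℂ F (c (n (projExt y)))).continuousLinearMapAt ℂ (projExt y)
        (ψ (projExt y)) * pull I (frame (c (n (projExt y)))) y := by
    intro y
    by_cases hy : y ∈ OrdConf N d
    · rw [projExt_coe ⟨y, hy⟩, pull_coe I _ ⟨y, hy⟩, pull_coe I _ ⟨y, hy⟩]
      conv_lhs => rw [frame_eq (hmem _) (ψ (proj ⟨y, hy⟩)), map_smul, smul_eq_mul]
    · rw [pull, pull, dif_neg hy, dif_neg hy, mul_zero]
  rw [funext key]
  exact measurable_countable_glue (hn.comp measurable_projExt)
    (g := fun k y => (trivializationAt ℂ F (c k)).continuousLinearMapAt ℂ (projExt y)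
      (ψ (projExt y)) * pull I (frame (c k)) y)
    fun k => ((hψ (c k)).comp measurable_projExt).mul (measurable_pull_frame hnab hI _)

/-- A section is measurable if its lift is: its coefficient with respect to a measurable unit section
is determined by the two lifts, evaluated at a measurable choice of orderings. -/
theorem measurableSection_of_pull (hnab : IsHermitianConnection nab)
    {I : ∀ x : OrdConf N d, F (proj x) ≃ₗᵢ[ℂ] ℂ} (hI : IsLiftTrivialization nab I)
    [Nonempty (OrdConf N d)] {ψ : ∀ q, F q} (hψ : Measurable (pull I ψ)) :
    MeasurableSection ψ := by
  obtain ⟨u, hu, -, hu2⟩ := exists_unit_section (F := F)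
  obtain ⟨s, hs, hs'⟩ := exists_measurable_ordering (N := N) (d := d)
  have key : ∀ q, inner ℂ (u q) (ψ q) = (starRingEnd ℂ) (pull I u (s q)) * pull I ψ (s q) := by
    intro q
    obtain ⟨h, hq⟩ := hs' q
    have h1 := (I ⟨s q, h⟩).inner_map_map (u (proj ⟨s q, h⟩)) (ψ (proj ⟨s q, h⟩))
    rw [← pull_coe I, ← pull_coe I, RCLike.inner_apply, hq] at h1
    rw [← h1, mul_comm]
  have h2 : Measurable fun q => inner ℂ (u q) (ψ q) := by
    simp only [key]
    exact (Complex.continuous_conj.measurable.comp ((measurable_pull hnab hI hu).comp hs)).mul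
      (hψ.comp hs)
  have h3 := hu.smul h2
  rwa [show (fun q => inner ℂ (u q) (ψ q) • u q) = ψ from funext fun q => (hu2 q (ψ q)).symm] at h3

end LiftMeasurable

/-! ### Isometry of the lift -/

section LiftUnitary

open Filter

attribute [local instance] continuousSMul_ordSpace

variable {N d : ℕ} {F : Conf N d → Type*}
  [∀ q, NormedAddCommGroup (F q)] [∀ q, InnerProductSpace ℂ (F q)]

theorem liftSection_add (I : ∀ x : OrdConf N d, F (proj x) ≃ₗᵢ[ℂ] ℂ) (ψ φ : ∀ q, F q) :
    liftSection I (ψ + φ) = liftSection I ψ + liftSection I φ := by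
  funext y
  by_cases hy : y ∈ OrdConf N d
  · simp only [liftSection, dif_pos hy, Pi.add_apply, map_add, mul_add]
  · simp only [liftSection, dif_neg hy, Pi.add_apply, add_zero]

theorem liftSection_smul (I : ∀ x : OrdConf N d, F (proj x) ≃ₗᵢ[ℂ] ℂ) (a : ℂ) (ψ : ∀ q, F q) :
    liftSection I (a • ψ) = a • liftSection I ψ := by
  funext y
  by_cases hy : y ∈ OrdConf N d
  · simp only [liftSection, dif_pos hy, Pi.smul_apply, map_smul, smul_eq_mul]
    ring
  · simp only [liftSection, dif_neg hy, Pi.smul_apply, smul_zero]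

theorem enorm_liftSection_sq [Nonempty (OrdConf N d)]
    (I : ∀ x : OrdConf N d, F (proj x) ≃ₗᵢ[ℂ] ℂ) (ψ : ∀ q, F q) (y : OrdSpace N d) :
    ‖liftSection I ψ y‖ₑ ^ 2 = (OrdConf N d : Set (OrdSpace N d)).indicator
      (fun y => (N.factorial : ℝ≥0∞)⁻¹ * ‖ψ (projExt y)‖ₑ ^ 2) y := by
  by_cases hy : y ∈ OrdConf N d
  · have h0 : (0 : ℝ) < N.factorial := by exact_mod_cast N.factorial_pos
    rw [Set.indicator_of_mem (show y ∈ (OrdConf N d : Set (OrdSpace N d)) from hy), liftSection_eq]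
    simp only
    rw [pull_coe I ψ ⟨y, hy⟩, projExt_coe ⟨y, hy⟩, enorm_mul, mul_pow]
    congr 1
    · rw [← ofReal_norm, Complex.norm_real, ← ENNReal.ofReal_pow (norm_nonneg _),
        Real.norm_eq_abs, sq_abs, div_pow, one_pow, Real.sq_sqrt h0.le, one_div,
        ENNReal.ofReal_inv_of_pos h0, ENNReal.ofReal_natCast]
    · rw [LinearIsometryEquiv.enorm_map]
  · rw [Set.indicator_of_notMem (show y ∉ (OrdConf N d : Set (OrdSpace N d)) from hy), liftSection,
      dif_neg hy]
    simp

variable [TopologicalSpace (TotalSpace ℂ F)] [FiberBundle ℂ F] [VectorBundle ℂ ℂ F]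
  [ContMDiffVectorBundle ∞ ℂ F 𝓘(ℝ, OrdSpace N d)] [SmoothFiberMetric F]
  {nab : CovariantDerivative 𝓘(ℝ, OrdSpace N d) ℂ F}

/-- The lift is isometric: the factor `1/√N!` compensates the `N!` sheets of the covering. -/
theorem eLpNorm_liftSection [Nonempty (OrdConf N d)]
    (I : ∀ x : OrdConf N d, F (proj x) ≃ₗᵢ[ℂ] ℂ) {ψ : ∀ q, F q} (hψ : MeasurableSection ψ) :
    eLpNorm (liftSection I ψ) 2 volume = eLpNorm (fun q => ‖ψ q‖) 2 (confVolume N d) := by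
  have h0 : (N.factorial : ℝ≥0∞)⁻¹ ≠ ⊤ := by
    simp [N.factorial_ne_zero]
  rw [eLpNorm_eq_lintegral_rpow_enorm_toReal two_ne_zero ENNReal.ofNat_ne_top,
    eLpNorm_eq_lintegral_rpow_enorm_toReal two_ne_zero ENNReal.ofNat_ne_top]
  simp only [ENNReal.toReal_ofNat, ENNReal.rpow_ofNat, enorm_norm, enorm_liftSection_sq]
  congr 1
  rw [lintegral_indicator (OrdConf N d).isOpen.measurableSet, lintegral_const_mul' _ _ h0,
    lintegral_confVolume]
  have := hψ.norm.enorm.pow_const 2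
  simpa only [enorm_norm] using this

theorem measurable_liftSection (hnab : IsHermitianConnection nab)
    {I : ∀ x : OrdConf N d, F (proj x) ≃ₗᵢ[ℂ] ℂ} (hI : IsLiftTrivialization nab I)
    {ψ : ∀ q, F q} (hψ : MeasurableSection ψ) : Measurable (liftSection I ψ) := by
  rw [liftSection_eq]
  exact (measurable_pull hnab hI hψ).const_mul _

/-- A section with measurable square-integrable lift is square-integrable. -/
theorem mem_sqIntSections_of_memLp [Nonempty (OrdConf N d)]
    (I : ∀ x : OrdConf N d, F (proj x) ≃ₗᵢ[ℂ] ℂ) {ψ : ∀ q, F q} (hψ : MeasurableSection ψ)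
    (h : MemLp (liftSection I ψ) 2 volume) : ψ ∈ sqIntSections F :=
  ⟨hψ, hψ.norm.aestronglyMeasurable, by
    rw [← eLpNorm_liftSection I hψ]
    exact h.2⟩

theorem memLp_liftSection [Nonempty (OrdConf N d)] (hnab : IsHermitianConnection nab)
    {I : ∀ x : OrdConf N d, F (proj x) ≃ₗᵢ[ℂ] ℂ} (hI : IsLiftTrivialization nab I)
    {ψ : ∀ q, F q} (hψ : ψ ∈ sqIntSections F) : MemLp (liftSection I ψ) 2 volume :=
  ⟨(measurable_liftSection hnab hI hψ.1).aestronglyMeasurable, by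
    rw [eLpNorm_liftSection I hψ.1]
    exact hψ.2.2⟩

theorem liftSection_permute (hd : 2 ≤ d) (hnab : IsHermitianConnection nab)
    (hF : HasFermionicHolonomy nab)
    {I : ∀ x : OrdConf N d, F (proj x) ≃ₗᵢ[ℂ] ℂ} (hI : IsLiftTrivialization nab I)
    (ψ : ∀ q, F q) (σ : Equiv.Perm (Fin N)) (y : OrdSpace N d) :
    liftSection I ψ (permute σ y) = ((Equiv.Perm.sign σ : ℤ) : ℂ) * liftSection I ψ y := by
  rw [liftSection_eq]
  simp only [pull_permute hd hnab hF hI]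
  ring

/-- An everywhere anti-symmetric function is the lift of a section: it vanishes at collisions, and
elsewhere it is determined by its values at one ordering of each configuration. -/
theorem exists_liftSection_eq [Nonempty (OrdConf N d)] (hd : 2 ≤ d)
    (hnab : IsHermitianConnection nab) (hF : HasFermionicHolonomy nab)
    {I : ∀ x : OrdConf N d, F (proj x) ≃ₗᵢ[ℂ] ℂ} (hI : IsLiftTrivialization nab I)
    {f : OrdSpace N d → ℂ} (hf : Measurable f)
    (ha : ∀ (σ : Equiv.Perm (Fin N)) (x : OrdSpace N d),
      f (permute σ x) = ((Equiv.Perm.sign σ : ℤ) : ℂ) * f x) :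
    ∃ ψ : ∀ q, F q, MeasurableSection ψ ∧ liftSection I ψ = f := by
  obtain ⟨u, hu, hu1, -⟩ := exists_unit_section (F := F)
  obtain ⟨s, hs, hs'⟩ := exists_measurable_ordering (N := N) (d := d)
  have h0 : (0 : ℝ) < N.factorial := by exact_mod_cast N.factorial_pos
  have h1 : ((1 / Real.sqrt N.factorial : ℝ) : ℂ) ≠ 0 := by
    have : 0 < 1 / Real.sqrt N.factorial := by positivity
    exact_mod_cast this.ne'
  have hne : ∀ q, pull I u (s q) ≠ 0 := by
    intro q h
    obtain ⟨hq, -⟩ := hs' q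
    rw [pull_coe I u ⟨s q, hq⟩, LinearIsometryEquiv.map_eq_zero_iff] at h
    have := hu1 (proj ⟨s q, hq⟩)
    rw [h, norm_zero] at this
    exact zero_ne_one this
  let G : Conf N d → ℂ := fun q =>
    ((1 / Real.sqrt N.factorial : ℝ) : ℂ)⁻¹ * f (s q) * (pull I u (s q))⁻¹
  have hG : Measurable G :=
    ((hf.comp hs).const_mul _).mul ((measurable_pull hnab hI hu).comp hs).inv
  refine ⟨fun q => G q • u q, hu.smul hG, funext fun y => ?_⟩
  by_cases hy : y ∈ OrdConf N d
  · obtain ⟨hq, hq'⟩ := hs' (proj ⟨y, hy⟩)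
    obtain ⟨σ, hσ⟩ := proj_eq_proj_iff.1 hq'
    have hy' : y = permute σ (s (proj ⟨y, hy⟩)) := congrArg Subtype.val hσ
    have h2 : liftSection I (fun q => G q • u q) (s (proj ⟨y, hy⟩)) = f (s (proj ⟨y, hy⟩)) := by
      rw [liftSection_eq]
      simp only
      rw [pull_coe I _ ⟨_, hq⟩, map_smul, ← pull_coe I u ⟨_, hq⟩, hq', smul_eq_mul,
        inv_mul_cancel_right₀ (hne _), mul_inv_cancel_left₀ h1]
    have e1 := liftSection_permute hd hnab hF hI (fun q => G q • u q) σ (s (proj ⟨y, hy⟩))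
    have e2 := ha σ (s (proj ⟨y, hy⟩))
    rw [← hy'] at e1 e2
    rw [e1, h2, e2]
  · rw [liftSection, dif_neg hy]
    have : ∃ i j, y i = y j ∧ i ≠ j := by
      by_contra! h
      exact hy fun i j hij => h i j hij
    obtain ⟨i, j, hij, hne⟩ := this
    have h2 : permute (Equiv.swap i j) y = y := by
      ext1 k
      rw [permute_apply]
      rcases eq_or_ne k i with rfl | hki
      · rw [Equiv.swap_apply_left, hij]
      rcases eq_or_ne k j with rfl | hkj
      · rw [Equiv.swap_apply_right, hij]
      · rw [Equiv.swap_apply_of_ne_of_ne hki hkj]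
    have h3 := ha (Equiv.swap i j) y
    rw [h2, Equiv.Perm.sign_swap hne] at h3
    have h4 : f y = - f y := by simpa using h3
    exact (self_eq_neg.1 h4).symm

/-- Every element of `Anti L²` has an everywhere anti-symmetric measurable representative. -/
theorem exists_antisymm_representative (f : antiL2 N d) : ∃ g : OrdSpace N d → ℂ, Measurable g ∧
    (∀ (σ : Equiv.Perm (Fin N)) (x : OrdSpace N d),
      g (permute σ x) = ((Equiv.Perm.sign σ : ℤ) : ℂ) * g x) ∧ f.1 =ᵐ[volume] g := by
  obtain ⟨f0, hf0, hff0⟩ := Lp.aestronglyMeasurable f.1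
  refine ⟨antisym f0, ?_, fun σ x => antisym_permute f0 σ x, ?_⟩
  · exact (Finset.measurable_sum _ fun σ _ =>
      (hf0.measurable.comp (permute σ).continuous.measurable).const_mul _).const_mul _
  · have h1 : ∀ᵐ x ∂(volume : Measure (OrdSpace N d)), ∀ σ : Equiv.Perm (Fin N),
        f0 (permute σ x) = ((Equiv.Perm.sign σ : ℤ) : ℂ) * f.1 x := by
      rw [ae_all_iff]
      intro σ
      filter_upwards [f.2 σ,
        (permute (d := d) σ).measurePreserving.quasiMeasurePreserving.ae hff0] with x a1 a2
      rw [← a2, a1]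
    filter_upwards [h1] with x hx
    simp only [antisym, hx, ← mul_assoc, sign_mul_sign_self, one_mul, Finset.sum_const,
      Finset.card_univ, Fintype.card_perm, Fintype.card_fin, nsmul_eq_mul]
    rw [inv_mul_cancel₀ (by exact_mod_cast N.factorial_ne_zero), one_mul]

end LiftUnitary

/-! ### The unitary isomorphism -/

section Unitary

open Filter

attribute [local instance] continuousSMul_ordSpace

variable {N d : ℕ} {F : Conf N d → Type*}
  [∀ q, NormedAddCommGroup (F q)] [∀ q, InnerProductSpace ℂ (F q)]
  [TopologicalSpace (TotalSpace ℂ F)] [FiberBundle ℂ F] [VectorBundle ℂ ℂ F]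
  [ContMDiffVectorBundle ∞ ℂ F 𝓘(ℝ, OrdSpace N d)] [SmoothFiberMetric F]

theorem norm_toPreL2_eq (ψ : sqIntSections F) :
    ‖toPreL2 ψ‖ = (eLpNorm (fun q => ‖ψ.1 q‖) 2 (confVolume N d)).toReal := by
  refine (pow_left_inj₀ (norm_nonneg _) ENNReal.toReal_nonneg two_ne_zero).1 ?_
  have h0 : 0 ≤ ∫ q, ‖ψ.1 q‖ ^ 2 ∂(confVolume N d) := integral_nonneg fun q => by positivity
  rw [norm_sq_toPreL2, ψ.2.2.eLpNorm_eq_integral_rpow_norm two_ne_zero ENNReal.ofNat_ne_top,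
    ENNReal.toReal_ofReal (by positivity)]
  simp only [ENNReal.toReal_ofNat, Real.rpow_ofNat, norm_norm]
  rw [← Real.rpow_natCast, ← Real.rpow_mul h0]
  simp

variable [Nonempty (OrdConf N d)] {nab : CovariantDerivative 𝓘(ℝ, OrdSpace N d) ℂ F}

/-- The map `ψ ↦ liftSection I ψ` from square-integrable sections to `Anti L²`. -/
def liftLinear (hd : 2 ≤ d) (hnab : IsHermitianConnection nab) (hF : HasFermionicHolonomy nab)
    {I : ∀ x : OrdConf N d, F (proj x) ≃ₗᵢ[ℂ] ℂ} (hI : IsLiftTrivialization nab I) :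
    PreL2 F →ₗ[ℂ] antiL2 N d where
  toFun ψ := ⟨(memLp_liftSection hnab hI (ψ : sqIntSections F).2).toLp _, fun σ => by
    have h := (memLp_liftSection hnab hI (ψ : sqIntSections F).2).coeFn_toLp
    filter_upwards [h, (permute (d := d) σ).measurePreserving.quasiMeasurePreserving.ae h]
      with x h1 h2
    rw [h1, h2, liftSection_permute hd hnab hF hI]⟩
  map_add' ψ φ := by
    apply Subtype.ext
    apply Lp.ext
    filter_upwards [
      (memLp_liftSection hnab hI ((ψ : sqIntSections F) + (φ : sqIntSections F)).2).coeFn_toLp,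
      (memLp_liftSection hnab hI (ψ : sqIntSections F).2).coeFn_toLp,
      (memLp_liftSection hnab hI (φ : sqIntSections F).2).coeFn_toLp,
      Lp.coeFn_add ((memLp_liftSection hnab hI (ψ : sqIntSections F).2).toLp _)
        ((memLp_liftSection hnab hI (φ : sqIntSections F).2).toLp _)] with x h1 h2 h3 h4
    refine h1.trans (Eq.trans ?_ h4.symm)
    rw [Pi.add_apply, h2, h3]
    exact congrFun (liftSection_add I _ _) x
  map_smul' a ψ := by
    apply Subtype.ext
    apply Lp.ext
    filter_upwards [
      (memLp_liftSection hnab hI (a • (ψ : sqIntSections F)).2).coeFn_toLp,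
      (memLp_liftSection hnab hI (ψ : sqIntSections F).2).coeFn_toLp,
      Lp.coeFn_smul a ((memLp_liftSection hnab hI (ψ : sqIntSections F).2).toLp _)]
      with x h1 h2 h3
    refine h1.trans (Eq.trans ?_ h3.symm)
    rw [Pi.smul_apply, h2]
    exact congrFun (liftSection_smul I a _) x

theorem norm_liftLinear (hd : 2 ≤ d) (hnab : IsHermitianConnection nab)
    (hF : HasFermionicHolonomy nab)
    {I : ∀ x : OrdConf N d, F (proj x) ≃ₗᵢ[ℂ] ℂ} (hI : IsLiftTrivialization nab I)
    (ψ : sqIntSections F) : ‖liftLinear hd hnab hF hI (toPreL2 ψ)‖ = ‖toPreL2 ψ‖ := by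
  rw [norm_toPreL2_eq, ← eLpNorm_liftSection I ψ.2.1]
  exact Lp.norm_toLp _ (memLp_liftSection hnab hI ψ.2)

/-- The unitary isomorphism `U` from `L²(F)` to `Anti L²(ℝ^{Nd})`. It is onto because every element
of `Anti L²` has an everywhere anti-symmetric representative, and these are lifts of sections. -/
theorem exists_unitary (hd : 2 ≤ d) (hnab : IsHermitianConnection nab)
    (hF : HasFermionicHolonomy nab)
    {I : ∀ x : OrdConf N d, F (proj x) ≃ₗᵢ[ℂ] ℂ} (hI : IsLiftTrivialization nab I) :
    ∃ U : L2Section F ≃ₗᵢ[ℂ] antiL2 N d, ∀ (ψ : ∀ q, F q) (hψ : ψ ∈ sqIntSections F),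
      (U (toL2 ψ hψ)).1 =ᵐ[volume] liftSection I ψ := by
  let J : PreL2 F →L[ℂ] antiL2 N d := (liftLinear hd hnab hF hI).mkContinuous 1 fun ψ => by
    rw [one_mul]
    exact (norm_liftLinear hd hnab hF hI ψ).le
  have hJ : ∀ ψ φ : PreL2 F, Inseparable ψ φ → J ψ = J φ := fun ψ φ h =>
    (h.map J.continuous).eq
  let U₀ : L2Section F →L[ℂ] antiL2 N d := SeparationQuotient.liftCLM J hJ
  let U₁ : L2Section F →ₗᵢ[ℂ] antiL2 N d :=
    { toLinearMap := U₀.toLinearMap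
      norm_map' := fun z => by
        obtain ⟨ψ, rfl⟩ := SeparationQuotient.surjective_mk z
        exact (norm_liftLinear hd hnab hF hI ψ).trans (SeparationQuotient.norm_mk ψ).symm }
  have hU : ∀ (ψ : ∀ q, F q) (hψ : ψ ∈ sqIntSections F),
      (U₁ (toL2 ψ hψ)).1 =ᵐ[volume] liftSection I ψ := fun ψ hψ =>
    (memLp_liftSection hnab hI hψ).coeFn_toLp
  have hs : Function.Surjective U₁ := by
    intro f
    obtain ⟨g, hg, hga, hfg⟩ := exists_antisymm_representative f
    obtain ⟨ψ, hψ, rfl⟩ := exists_liftSection_eq hd hnab hF hI hg hga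
    have hψ' : ψ ∈ sqIntSections F :=
      mem_sqIntSections_of_memLp I hψ ((memLp_congr_ae hfg).1 (Lp.memLp f.1))
    exact ⟨toL2 ψ hψ', Subtype.ext (Lp.ext ((hU ψ hψ').trans hfg.symm))⟩
  exact ⟨LinearIsometryEquiv.ofSurjective U₁ hs, hU⟩

end Unitary

/-! ### The Hamiltonian on sections -/

section Intertwining

open Filter

attribute [local instance] continuousSMul_ordSpace

variable {N d : ℕ}

theorem nonempty_ordConf (hd : 2 ≤ d) : Nonempty (OrdConf N d) := by
  have : NeZero d := ⟨by omega⟩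
  have : Nontrivial (EuclideanSpace ℝ (Fin d)) := inferInstance
  have : Infinite (EuclideanSpace ℝ (Fin d)) := Module.Free.infinite ℝ _
  refine ⟨⟨WithLp.toLp 2 fun i => Infinite.natEmbedding _ (i : ℕ), fun i j h => ?_⟩⟩
  exact Fin.ext ((Infinite.natEmbedding _).injective h)

theorem measurable_hamFun (ħ m : ℝ) {V : OrdSpace N d → ℝ} (hVm : Measurable V)
    {φ : OrdSpace N d → ℂ} (hφ : ContDiff ℝ 2 φ) : Measurable (hamFun ħ m V φ) := by
  have h1 : Measurable (Laplacian.laplacian φ) := (continuous_laplacian hφ).measurable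
  have h2 : Measurable φ := hφ.continuous.measurable
  unfold hamFun
  fun_prop

/-- The projection is proper, being a finite covering. -/
theorem exists_compact_preimage {K : Set (Conf N d)} (hK : IsCompact K) :
    ∃ C : Set (OrdConf N d), IsCompact C ∧ proj ⁻¹' K ⊆ C := by
  have : LocallyCompactSpace (OrdConf N d) := (OrdConf N d).isOpen.locallyCompactSpace
  choose z hz using proj_surjective (N := N) (d := d)
  choose D hD hDz using fun q => exists_compact_mem_nhds (z q)
  obtain ⟨t, ht⟩ := hK.elim_nhds_subcover' (fun q _ => proj '' D q) fun q _ => by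
    have := isOpenMap_proj.image_mem_nhds (hDz q)
    rwa [hz] at this
  refine ⟨⋃ q ∈ t, ⋃ σ : Equiv.Perm (Fin N), reorder σ '' D q.1, ?_, fun x hx => ?_⟩
  · exact t.isCompact_biUnion fun q _ => isCompact_iUnion fun σ =>
      (hD q.1).image (continuous_reorder σ)
  · have h : proj x ∈ ⋃ q ∈ t, proj '' D (q : Conf N d) := ht hx
    simp only [Set.mem_iUnion] at h ⊢
    obtain ⟨q, hq, y, hy, hyx⟩ := h
    obtain ⟨σ, rfl⟩ := proj_eq_proj_iff.1 hyx
    exact ⟨q, hq, σ, y, hy, rfl⟩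

variable {F : Conf N d → Type*}
  [∀ q, NormedAddCommGroup (F q)] [∀ q, InnerProductSpace ℂ (F q)]
  [TopologicalSpace (TotalSpace ℂ F)] [FiberBundle ℂ F] [VectorBundle ℂ ℂ F]
  [ContMDiffVectorBundle ∞ ℂ F 𝓘(ℝ, OrdSpace N d)] [SmoothFiberMetric F]
  {nab : CovariantDerivative 𝓘(ℝ, OrdSpace N d) ℂ F}

/-- The lift of a smooth section with compact support is smooth with compact support. -/
theorem liftSection_smooth (hnab : IsHermitianConnection nab)
    {I : ∀ x : OrdConf N d, F (proj x) ≃ₗᵢ[ℂ] ℂ} (hI : IsLiftTrivialization nab I)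
    {ψ : ∀ q, F q} (hψ : ∀ q, SmoothSectionAt ψ q) (hK : ∃ K, IsCompact K ∧ ∀ q ∉ K, ψ q = 0) :
    ContDiff ℝ ∞ (liftSection I ψ) ∧ HasCompactSupport (liftSection I ψ) ∧
      ∀ y ∉ OrdConf N d, liftSection I ψ =ᶠ[𝓝 y] 0 := by
  obtain ⟨K, hK, hψK⟩ := hK
  obtain ⟨C, hC, hKC⟩ := exists_compact_preimage hK
  have hC' : IsCompact (Subtype.val '' C : Set (OrdSpace N d)) := hC.image continuous_subtype_val
  have h0 : ∀ y ∉ (Subtype.val '' C : Set (OrdSpace N d)), liftSection I ψ y = 0 := by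
    intro y hy
    by_cases hy0 : y ∈ OrdConf N d
    · have h1 : proj ⟨y, hy0⟩ ∉ K := fun h => hy ⟨_, hKC h, rfl⟩
      rw [liftSection, dif_pos hy0, hψK _ h1, map_zero, mul_zero]
    · exact dif_neg hy0
  have hz : ∀ y ∉ OrdConf N d, liftSection I ψ =ᶠ[𝓝 y] 0 := by
    intro y hy
    have h1 : y ∉ (Subtype.val '' C : Set (OrdSpace N d)) := by
      rintro ⟨x, -, rfl⟩
      exact hy x.2
    filter_upwards [hC'.isClosed.isOpen_compl.mem_nhds h1] with z hz using h0 z hz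
  refine ⟨contDiff_iff_contDiffAt.2 fun y => ?_, HasCompactSupport.intro hC' h0, hz⟩
  by_cases hy : y ∈ OrdConf N d
  · rw [liftSection_eq]
    exact contDiffAt_const.mul
      (contDiffAt_pull (x := ⟨y, hy⟩) hnab hI (Eventually.of_forall hψ))
  · exact (contDiffAt_const (c := (0 : ℂ))).congr_of_eventuallyEq (hz y hy)

theorem apply_ordering (V : OrdSpace N d → ℝ)
    (hVs : ∀ (σ : Equiv.Perm (Fin N)) (x : OrdSpace N d), V (permute σ x) = V x)
    (x : OrdConf N d) : V (ordering (proj x)).1 = V x.1 := by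
  obtain ⟨σ, hσ⟩ := proj_eq_proj_iff.1 (Function.surjInv_eq proj_surjective (proj x))
  have h : x.1 = permute σ (ordering (proj x)).1 := congrArg Subtype.val hσ
  rw [h, hVs]

/-- Lifting intertwines the differential expressions `-(ħ²/2m) Δ + V`. -/
theorem liftSection_hamSection (hnab : IsHermitianConnection nab)
    {I : ∀ x : OrdConf N d, F (proj x) ≃ₗᵢ[ℂ] ℂ} (hI : IsLiftTrivialization nab I)
    (ħ m : ℝ) {V : OrdSpace N d → ℝ}
    (hVs : ∀ (σ : Equiv.Perm (Fin N)) (x : OrdSpace N d), V (permute σ x) = V x)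
    {ψ : ∀ q, F q} (hψ : ∀ q, SmoothSectionAt ψ q) (hK : ∃ K, IsCompact K ∧ ∀ q ∉ K, ψ q = 0) :
    liftSection I (hamSection ħ m V nab ψ) = hamFun ħ m V (liftSection I ψ) := by
  funext y
  by_cases hy : y ∈ OrdConf N d
  · set a : ℂ := ((1 / Real.sqrt N.factorial : ℝ) : ℂ)
    have h1 : Laplacian.laplacian (liftSection I ψ) y =
        a * I ⟨y, hy⟩ (laplacianSection nab ψ (proj ⟨y, hy⟩)) := by
      rw [← laplacian_pull hnab hI hψ, liftSection_eq]
      exact InnerProductSpace.laplacian_smul a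
        ((contDiffAt_pull (x := ⟨y, hy⟩) hnab hI (Eventually.of_forall hψ)).of_le
          (WithTop.coe_le_coe.2 le_top))
    have h2 : ∀ (r : ℝ) (v : F (proj ⟨y, hy⟩)), I ⟨y, hy⟩ (r • v) = (r : ℂ) * I ⟨y, hy⟩ v :=
      fun r v => (I ⟨y, hy⟩).toLinearEquiv.toLinearMap.map_smul_of_tower r v
    rw [hamFun, h1]
    simp only [liftSection, dif_pos hy, hamSection, map_add, h2, apply_ordering V hVs,
      Complex.real_smul]
    ring
  · have h0 := (liftSection_smooth hnab hI hψ hK).2.2 y hy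
    have h1 : Laplacian.laplacian (liftSection I ψ) y = 0 := by
      rw [(InnerProductSpace.laplacian_congr_nhds h0).self_of_nhds]
      exact congrFun (InnerProductSpace.laplacian_const (c := (0 : ℂ))) y
    rw [hamFun, h1, h0.self_of_nhds, liftSection, dif_neg hy]
    simp

end Intertwining

section Conclusion

open Filter

attribute [local instance] continuousSMul_ordSpace

variable {N d : ℕ} {F : Conf N d → Type*}
  [∀ q, NormedAddCommGroup (F q)] [∀ q, InnerProductSpace ℂ (F q)]
  [TopologicalSpace (TotalSpace ℂ F)] [FiberBundle ℂ F] [VectorBundle ℂ ℂ F]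
  [ContMDiffVectorBundle ∞ ℂ F 𝓘(ℝ, OrdSpace N d)] [SmoothFiberMetric F]
  [Nonempty (OrdConf N d)] {nab : CovariantDerivative 𝓘(ℝ, OrdSpace N d) ℂ F}

theorem mem_sqIntSections_of_liftSection (hnab : IsHermitianConnection nab)
    {I : ∀ x : OrdConf N d, F (proj x) ≃ₗᵢ[ℂ] ℂ} (hI : IsLiftTrivialization nab I)
    {ψ : ∀ q, F q} (hψ : Measurable (liftSection I ψ)) (h2 : MemLp (liftSection I ψ) 2 volume) :
    ψ ∈ sqIntSections F := by
  refine mem_sqIntSections_of_memLp I (measurableSection_of_pull hnab hI ?_) h2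
  have ha : ((1 / Real.sqrt N.factorial : ℝ) : ℂ) ≠ 0 := by
    have : (0 : ℝ) < N.factorial := by exact_mod_cast N.factorial_pos
    exact_mod_cast (by positivity : (1 / Real.sqrt N.factorial : ℝ) ≠ 0)
  have h : pull I ψ =
      fun y => ((1 / Real.sqrt N.factorial : ℝ) : ℂ)⁻¹ * liftSection I ψ y := by
    funext y
    rw [liftSection_eq]
    exact (inv_mul_cancel_left₀ ha _).symm
  rw [h]
  exact hψ.const_mul _

theorem hamSection_mem_sqIntSections (hnab : IsHermitianConnection nab)
    {I : ∀ x : OrdConf N d, F (proj x) ≃ₗᵢ[ℂ] ℂ} (hI : IsLiftTrivialization nab I)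
    (ħ m : ℝ) {V : OrdSpace N d → ℝ} (hVm : Measurable V) (hVb : ∃ C, ∀ x, |V x| ≤ C)
    (hVs : ∀ (σ : Equiv.Perm (Fin N)) (x : OrdSpace N d), V (permute σ x) = V x)
    {ψ : ∀ q, F q} (hψ : ∀ q, SmoothSectionAt ψ q) (hK : ∃ K, IsCompact K ∧ ∀ q ∉ K, ψ q = 0) :
    hamSection ħ m V nab ψ ∈ sqIntSections F := by
  obtain ⟨hs, hc, -⟩ := liftSection_smooth hnab hI hψ hK
  have hham := liftSection_hamSection hnab hI ħ m hVs hψ hK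
  refine mem_sqIntSections_of_liftSection hnab hI ?_ ?_
  · exact hham ▸ measurable_hamFun ħ m hVm (hs.of_le (WithTop.coe_le_coe.2 le_top))
  · exact hham ▸ memLp_hamFun ħ m hVm hVb hs hc

/-- Transporting an extension of `-(ħ²/2m) Δ + V` on `Anti C_0^∞` by `U` gives an extension of
`-(ħ²/2m) Δ + V` on `C_0^∞(F)`: the lift of a section in `C_0^∞(F)` is in `Anti C_0^∞`, and lifting
intertwines the two differential expressions. -/
theorem extendsSectionHam_conjOp (hd : 2 ≤ d) (hnab : IsHermitianConnection nab)
    (hF : HasFermionicHolonomy nab)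
    {I : ∀ x : OrdConf N d, F (proj x) ≃ₗᵢ[ℂ] ℂ} (hI : IsLiftTrivialization nab I)
    {ħ m : ℝ} {V : OrdSpace N d → ℝ} (hVm : Measurable V) (hVb : ∃ C, ∀ x, |V x| ≤ C)
    (hVs : ∀ (σ : Equiv.Perm (Fin N)) (x : OrdSpace N d), V (permute σ x) = V x)
    {U : L2Section F ≃ₗᵢ[ℂ] antiL2 N d}
    (hU : ∀ (ψ : ∀ q, F q) (hψ : ψ ∈ sqIntSections F),
      (U (toL2 ψ hψ)).1 =ᵐ[volume] liftSection I ψ)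
    {H : antiL2 N d →ₗ.[ℂ] antiL2 N d} (hH : ExtendsAntiHam ħ m V H) :
    ExtendsSectionHam ħ m V nab (conjOp U H) := by
  intro ψ hψ hK
  obtain ⟨hs, hc, -⟩ := liftSection_smooth hnab hI hψ hK
  have h₁ : ψ ∈ sqIntSections F := mem_sqIntSections_of_liftSection hnab hI
    hs.continuous.measurable (hs.continuous.memLp_of_hasCompactSupport hc)
  have h₂ := hamSection_mem_sqIntSections hnab hI ħ m hVm hVb hVs hψ hK
  obtain ⟨f, g, hf, hg, hfg⟩ := hH _ hs hc (liftSection_permute hd hnab hF hI ψ)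
  rw [← liftSection_hamSection hnab hI ħ m hVs hψ hK] at hg
  have e₁ : U (toL2 ψ h₁) = f := Subtype.ext (Lp.ext ((hU ψ h₁).trans hf.symm))
  have e₂ : U (toL2 (hamSection ħ m V nab ψ) h₂) = g :=
    Subtype.ext (Lp.ext ((hU _ h₂).trans hg.symm))
  subst e₁ e₂
  exact ⟨h₁, h₂, (mem_graph_conjOp U H _ _).2 hfg⟩

end Conclusion

end Fermion

end

theorem mainTheorem2 (N d : ℕ) (hd : 2 ≤ d)
    (F : Fermion.Conf N d → Type*)
    [∀ q, NormedAddCommGroup (F q)] [∀ q, InnerProductSpace ℂ (F q)]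
    [TopologicalSpace (TotalSpace ℂ F)] [FiberBundle ℂ F] [VectorBundle ℂ ℂ F]
    [ContMDiffVectorBundle ∞ ℂ F 𝓘(ℝ, Fermion.OrdSpace N d)] [Fermion.SmoothFiberMetric F]
    (nab : CovariantDerivative 𝓘(ℝ, Fermion.OrdSpace N d) ℂ F)
    (hnab : Fermion.IsHermitianConnection nab) (hF : Fermion.HasFermionicHolonomy nab)
    (I : ∀ x : Fermion.OrdConf N d, F (Fermion.proj x) ≃ₗᵢ[ℂ] ℂ)
    (hI : Fermion.IsLiftTrivialization nab I)
    (ħ m : ℝ) (hħ : 0 < ħ) (hm : 0 < m)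
    (V : Fermion.OrdSpace N d → ℝ) (hVm : Measurable V) (hVb : ∃ C, ∀ x, |V x| ≤ C)
    (hVs : ∀ (σ : Equiv.Perm (Fin N)) (x : Fermion.OrdSpace N d),
      V (Fermion.permute σ x) = V x) :
    ∃ U : Fermion.L2Section F ≃ₗᵢ[ℂ] Fermion.antiL2 N d,
      (∀ (ψ : ∀ q, F q) (hψ : ψ ∈ Fermion.sqIntSections F),
        (U (Fermion.toL2 ψ hψ)).1 =ᵐ[volume] Fermion.liftSection I ψ) ∧
      ∃ HA : Fermion.antiL2 N d →ₗ.[ℂ] Fermion.antiL2 N d,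
        (IsSelfAdjoint HA ∧ Fermion.ExtendsAntiHam ħ m V HA ∧
          ∀ H' : Fermion.antiL2 N d →ₗ.[ℂ] Fermion.antiL2 N d,
            IsSelfAdjoint H' → Fermion.ExtendsAntiHam ħ m V H' → H' = HA) ∧
        ∃ HF : Fermion.L2Section F →ₗ.[ℂ] Fermion.L2Section F,
          IsSelfAdjoint HF ∧ Fermion.ExtendsSectionHam ħ m V nab HF ∧
          (U '' (HF.domain : Set (Fermion.L2Section F)) =
            (HA.domain : Set (Fermion.antiL2 N d))) ∧
          (∀ (ψ : Fermion.L2Section F) (h₁ : ψ ∈ HF.domain) (h₂ : U ψ ∈ HA.domain),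
            HF ⟨ψ, h₁⟩ = U.symm (HA ⟨U ψ, h₂⟩)) ∧
          (∃! T, Fermion.IsTimeEvolution ħ HF T) ∧ (∃! T, Fermion.IsTimeEvolution ħ HA T) ∧
          ∀ TF TA, Fermion.IsTimeEvolution ħ HF TF → Fermion.IsTimeEvolution ħ HA TA →
            ∀ (t : ℝ) (ψ : Fermion.L2Section F), TF t ψ = U.symm (TA t (U ψ)) := by
  have := Fermion.nonempty_ordConf (N := N) hd
  refine (Fermion.exists_unitary hd hnab hF hI).elim fun U hU => ?_
  refine (Fermion.exists_antiHam hħ hm hVm hVb hVs).elim fun HA hHA => ?_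
  have hA := hHA.1
  -- `H_F` is defined as `U⁻¹ H_Anti U`
  have hF' := Fermion.isSelfAdjoint_conjOp U hA
  refine ⟨U, hU, HA, hHA, Fermion.conjOp U HA, hF',
    Fermion.extendsSectionHam_conjOp hd hnab hF hI hVm hVb hVs hU hHA.2.1,
    Set.image_preimage_eq _ U.surjective, fun ψ h₁ h₂ => rfl,
    Fermion.existsUnique_isTimeEvolution hħ hF', Fermion.existsUnique_isTimeEvolution hħ hA,
    fun TF TA hTF hTA t ψ => ?_⟩
  rw [Fermion.IsTimeEvolution.unique hF' hTF (hTA.conj U)]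
  rfl
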